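/- **Theorem 5.6 (label collapse).** *Setting.* Let $t<0$ and $\gamma\in(0,1)$. Put $$h(z)=h(z;t,\gamma):=-\ln\bigl(1-\gamma e^{-\frac12t^2z^2}\bigr)\ \ (\text{principal branch}),\qquad \delta=\delta_{t\gamma}:=\min\Bigl\{\frac{\sqrt{-\ln\gamma}}{|t|},\frac12\Bigr\}.$$ Let $\Sigma_{\bf M}=\Sigma_{\bf M}(t,\gamma)\subset\mathbb C$ be the union of the two half-lines $(-\infty,-2]$, $[2,\infty)$ and the six edges of the hexagon with vertices $\pm2$, $-1\pm i\delta$, $1\pm i\delta$; all eight pieces are oriented from left to right, and limits from the two sides of an oriented piece are denoted ${\bf M}_\pm(z)=\lim_{\eta\downarrow0}{\bf M}(z\pm i\eta)$. For $z$ with $0<|\Im z|\le\delta$ put $$\phi(z):=\tfrac14\bigl(z^2-4iz\,\mathrm{sgn}(\Im z)\bigr)+\frac{\mathrm{sgn}(\Im z)}{i\pi}\int_{-\infty}^\infty\frac{h(s)}{t^2(s-z)}\,ds-\frac{h(z)}{t^2},$$ and for real $z$ put $$\phi_\pm(z):=\tfrac14(z^2\mp4iz)\pm\frac1{i\pi}\,\mathrm{pv}\!\int_{-\infty}^\infty\frac{h(s)}{t^2(s-z)}\,ds.$$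 The jump matrix ${\bf G}_{\bf M}$ on $\Sigma_{\bf M}$ is $$\begin{bmatrix}1&-i\sqrt\gamma e^{-t^2\phi(z)}\\0&1\end{bmatrix}(\Im z>0),\quad \begin{bmatrix}1&0\\-i\sqrt\gamma e^{-t^2\phi(z)}&1\end{bmatrix}(\Im z<0),\quad \begin{bmatrix}1&-i\sqrt\gamma e^{-t^2\phi_+(z)}\\-i\sqrt\gamma e^{-t^2\phi_-(z)}&1-\gamma e^{-\frac12t^2z^2}\end{bmatrix}(z\in\mathbb R\setminus[-2,2]).$$ *The Riemann–Hilbert problem (RHP 5.5).* A function ${\bf M}:\mathbb C\setminus\Sigma_{\bf M}\to\mathbb C^{2\times2}$ solves the RHP in $L^2(\Sigma_{\bf M},|dz|)$ if 1. ${\bf M}$ is analytic on $\mathbb C\setminus\Sigma_{\bf M}$, and ${\bf M}(z)=\mathbb I+\frac1{2\pi i}\int_{\Sigma_{\bf M}}\frac{f(\lambda)}{\lambda-z}\,d\lambda$ there for some $f\in L^2(\Sigma_{\bf M},|dz|)$; 2. the limiting values ${\bf M}_\pm$ exist almost everywhere on $\Sigma_{\bf M}$, ${\bf M}_\pm-\mathbb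 I\in L^2(\Sigma_{\bf M},|dz|)$, and ${\bf M}_+={\bf M}_-{\bf G}_{\bf M}$ almost everywhere on $\Sigma_{\bf M}$; 3. ${\bf M}(z)=\mathbb I+{\bf S}_1(t,\gamma)z^{-1}+\mathcal O(z^{-2})$ for some matrix ${\bf S}_1(t,\gamma)$, as $z\to\infty$, $z\notin\Sigma_{\bf M}$. *Statement.* For every fixed $0<\epsilon<2$ there are positive constants $t_0=t_0(\epsilon)$ and $c=c(\epsilon)$ such that for all $t$ and $\gamma$ with $-t\ge t_0$ and $0<\gamma\le1-|t|^{-\epsilon}$ the RHP has exactly one solution ${\bf M}(z)={\bf M}(z;t,\gamma)$ in $L^2(\Sigma_{\bf M},|dz|)$, and ${\bf S}_1(t,\gamma)=\lim_{z\to\infty,\,z\notin\Sigma_{\bf M}}z\bigl({\bf M}(z;t,\gamma)-\mathbb I\bigr)$ satisfies, for each of its entries, $$\bigl|S_1^{jk}(t,\gamma)\bigr|\le c\,|t|^{-1+\epsilon}e^{-|t|^{1-\epsilon/2}},\qquad j,k\in\{1,2\}.$$ -/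

import Mathlib

open Filter Topology MeasureTheory
open Complex (I)

namespace GinibreRHP

/-- Complex `2 × 2` matrices. -/
abbrev Mat : Type := Matrix (Fin 2) (Fin 2) ℂ

/-- `h(z; t, γ) = -ln (1 - γ e^{-t² z² / 2})`, with the principal branch of the logarithm. -/
noncomputable def h (t γ : ℝ) (z : ℂ) : ℂ :=
  -Complex.log (1 - (γ : ℂ) * Complex.exp (-((t : ℂ) ^ 2 * z ^ 2) / 2))

/-- The half-height `δ_{tγ} = min {√(-ln γ) / |t|, 1/2}` of the hexagon. -/
noncomputable def delta (t γ : ℝ) : ℝ :=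
  min (Real.sqrt (-Real.log γ) / |t|) (1 / 2)

/-! ### The contour

The contour is the union of eight line segments or half-lines, each of which is the graph
`{x + i y_j(x) : x ∈ J_j}` of an affine function `y_j` over a closed interval `J_j`, oriented from
left to right (in the direction of increasing `x`). The six vertices are `±2`, `-1 ± iδ` and
`1 ± iδ`. The pieces are numbered from `0` to `7`: left half-line, upper left edge, lower left
edge, upper horizontal edge, lower horizontal edge, upper right edge, lower right edge,
right half-line. -/

/-- The range `J_j` of the real part on the `j`-th piece. -/
def interval : Fin 8 → Set ℝ :=
  ![Set.Iic (-2), Set.Icc (-2) (-1), Set.Icc (-2) (-1), Set.Icc (-1) 1, Set.Icc (-1) 1,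
    Set.Icc 1 2, Set.Icc 1 2, Set.Ici 2]

/-- The imaginary part `y_j(x)` on the `j`-th piece, for a hexagon of half-height `d`. -/
def height (d : ℝ) (j : Fin 8) (x : ℝ) : ℝ :=
  ![0, d * (x + 2), -(d * (x + 2)), d, -d, d * (2 - x), -(d * (2 - x)), 0] j

/-- The slope `y_j'` of the `j`-th piece. -/
def slope (d : ℝ) : Fin 8 → ℝ :=
  ![0, d, -d, 0, 0, -d, d, 0]

/-- The parametrization `x ↦ x + i y_j(x)` of the `j`-th piece. -/
noncomputable def param (t γ : ℝ) (j : Fin 8) (x : ℝ) : ℂ :=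
  (x : ℂ) + I * (height (delta t γ) j x : ℂ)

/-- The derivative `1 + i y_j'` of the parametrization of the `j`-th piece. -/
noncomputable def tangent (t γ : ℝ) (j : Fin 8) : ℂ :=
  1 + I * (slope (delta t γ) j : ℂ)

/-- The contour `Σ_M`, as a closed subset of the plane. -/
noncomputable def contour (t γ : ℝ) : Set ℂ :=
  ⋃ j : Fin 8, param t γ j '' interval j

/-- Arc length `|dz|` on the contour, as a measure on the plane. -/
noncomputable def arcLength (t γ : ℝ) : Measure ℂ :=
  ∑ j : Fin 8, ENNReal.ofReal ‖tangent t γ j‖ •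
    Measure.map (param t γ j) (volume.restrict (interval j))

/-- The oriented line integral `∫_{Σ_M} f(z) dz`. -/
noncomputable def lineIntegral (t γ : ℝ) (f : ℂ → ℂ) : ℂ :=
  ∑ j : Fin 8, ∫ x in interval j, f (param t γ j x) * tangent t γ j

/-- `f ∈ L²(Σ_M, |dz|)` for a matrix-valued function `f`. -/
def IsL2 (t γ : ℝ) (f : ℂ → Mat) : Prop :=
  ∀ i k : Fin 2, MemLp (fun z => f z i k) 2 (arcLength t γ)

/-- The Cauchy transform `(2πi)⁻¹ ∫_{Σ_M} f(λ) (λ - z)⁻¹ dλ` (entry by entry). -/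
noncomputable def cauchy (t γ : ℝ) (f : ℂ → Mat) (z : ℂ) : Mat :=
  Matrix.of fun i k =>
    (2 * (Real.pi : ℂ) * I)⁻¹ * lineIntegral t γ (fun w => f w i k / (w - z))

/-! ### The jump matrix -/

/-- The phase `φ(z; t, γ)` off the real axis. -/
noncomputable def phase (t γ : ℝ) (z : ℂ) : ℂ :=
  (z ^ 2 - 4 * I * z * (Real.sign z.im : ℂ)) / 4
    + (1 / (I * (Real.pi : ℂ))) * (Real.sign z.im : ℂ)
        * (∫ s : ℝ, h t γ (s : ℂ) / ((t : ℂ) ^ 2 * ((s : ℂ) - z)))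
    - h t γ z / (t : ℂ) ^ 2

/-- The Cauchy principal value `pv ∫ f(s) (s - x)⁻¹ ds` over the real line. -/
noncomputable def pvCauchy (f : ℝ → ℂ) (x : ℝ) : ℂ :=
  limUnder (𝓝[>] (0 : ℝ)) fun r => ∫ s in {s : ℝ | r < |s - x|}, f s / ((s : ℂ) - (x : ℂ))

/-- The phases `φ_±(x; t, γ)` on the real axis; `σ = 1` gives `φ_+` and `σ = -1` gives `φ_-`. -/
noncomputable def phaseReal (t γ σ x : ℝ) : ℂ :=
  ((x : ℂ) ^ 2 - (σ : ℂ) * 4 * I * (x : ℂ)) / 4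
    + (σ : ℂ) * (1 / (I * (Real.pi : ℂ)))
        * pvCauchy (fun s => h t γ (s : ℂ) / (t : ℂ) ^ 2) x

/-- The jump matrix `G_M(z; t, γ)` on the contour. -/
noncomputable def jump (t γ : ℝ) (z : ℂ) : Mat :=
  if 0 < z.im then
    !![1, -I * (Real.sqrt γ : ℂ) * Complex.exp (-(t : ℂ) ^ 2 * phase t γ z); 0, 1]
  else if z.im < 0 then
    !![1, 0; -I * (Real.sqrt γ : ℂ) * Complex.exp (-(t : ℂ) ^ 2 * phase t γ z), 1]
  else
    !![1, -I * (Real.sqrt γ : ℂ) * Complex.exp (-(t : ℂ) ^ 2 * phaseReal t γ 1 z.re);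
       -I * (Real.sqrt γ : ℂ) * Complex.exp (-(t : ℂ) ^ 2 * phaseReal t γ (-1) z.re),
       1 - (γ : ℂ) * Complex.exp (-((t : ℂ) ^ 2 * z ^ 2) / 2)]

/-! ### The Riemann-Hilbert problem -/

/-- `z → ∞` in the complement of the contour. -/
noncomputable def atInfinity (t γ : ℝ) : Filter ℂ :=
  Bornology.cobounded ℂ ⊓ 𝓟 (contour t γ)ᶜ

/-- `M` solves the Riemann-Hilbert problem with data `(t, γ)` in the sense of `L²(Σ_M, |dz|)`.
Only the values of `M` off the contour matter. All pieces of the contour are oriented from left to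
right, so the `±` sides are approached along `z ± iη`, `η ↓ 0`. As usual for `L²` problems,
`M - 𝟙` is required to be the Cauchy transform of an `L²` function, and the limiting values
are taken almost everywhere. -/
structure IsSolution (t γ : ℝ) (M : ℂ → Mat) : Prop where
  /-- `M` is analytic off the contour. -/
  analytic : ∀ i k : Fin 2, DifferentiableOn ℂ (fun z => M z i k) (contour t γ)ᶜ
  /-- `M - 𝟙` lies in the range of the Cauchy transform on `L²`. -/
  cauchy_rep : ∃ f : ℂ → Mat, IsL2 t γ f ∧ ∀ z ∈ (contour t γ)ᶜ, M z = 1 + cauchy t γ f z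
  /-- The limiting values `M_±` exist, `M_± - 𝟙` is square integrable, and `M_+ = M_- G_M`. -/
  jump_rel : ∃ Mp Mm : ℂ → Mat,
    IsL2 t γ (fun z => Mp z - 1) ∧ IsL2 t γ (fun z => Mm z - 1) ∧
    ∀ᵐ z ∂(arcLength t γ),
      Tendsto (fun η : ℝ => M (z + I * (η : ℂ))) (𝓝[>] 0) (𝓝 (Mp z)) ∧
      Tendsto (fun η : ℝ => M (z - I * (η : ℂ))) (𝓝[>] 0) (𝓝 (Mm z)) ∧
      Mp z = Mm z * jump t γ z
  /-- `M(z) = 𝟙 + S₁ z⁻¹ + O(z⁻²)` as `z → ∞`. -/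
  asymptotics : ∃ S₁ : Mat, ∀ i k : Fin 2,
    (fun z : ℂ => (M z - 1 - z⁻¹ • S₁) i k) =O[atInfinity t γ] fun z : ℂ => z⁻¹ ^ 2

end GinibreRHP

/-!
Let `A(z)` be the upper right entry `-i √γ e^{-t² φ}` of the jump matrix above the real axis.
Writing the Cauchy integral of `h` over the shifted line `Im = -(6/5) δ` continues `A`
holomorphically to a strip (`upperEntry`), because `h` has no singularity there:
`|γ e^{-t² z² / 2}| < 1` for `|Im z| ≤ (7/5) δ`. The formulas of Sokhotski and Plemelj for `h`
(`pvCauchy_eq`, `pvCauchy_h`) show that all jump entries are values of this one function: the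
upper right entry is `A(z)`, the lower left entry is `A(-z)`, and
`1 - γ e^{-t² x² / 2} = 1 + A(x) A(-x)` on the real line. So the jump on the real line is the
product of the jumps of the two halves of the contour, which are exchanged by `z ↦ -z`.

*Existence.* In each row `(M₁, M₂)` of a solution the column `M₁` should jump only across the
lower half of the contour and `M₂` only across the upper half, with `M₂₊ = M₂₋ + A M₁`. Under the
symmetry `z ↦ -z` the ansatz `M₁(z) = s W(-z)`, `M₂(z) = W(z)`, `s = ± i`, is consistent and
decouples the problem into two scalar equations `W(z) = 1 + s (2πi)⁻¹ ∫ A(w) W(-w) (w - z)⁻¹ dw`;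
the rows of `M` are linear combinations of the two. Moving the integral from the upper half of the
contour to the line `Im w = (6/5) δ` gives an equation with a bounded kernel, as `w` and `-w` stay
at distance `(12/5) δ` in the imaginary direction. It is solved by contraction
(`exists_isScalarSolution`), because `A` is exponentially small on that line: for
`0 ≤ Im z ≤ (6/5) δ` positivity of the Poisson integral of `h ≥ 0` gives
`|A(x + iy)| ≤ 4 (1 - γ)⁻¹ e^{-t² x² / 4 - t² y}` (`norm_upperEntry_le`). Deforming back to the
hexagon (`lineIntegral_cutoff_of_above`, `lineIntegral_cutoff_of_below`) yields the solution
(`isSolution_matrixSolution`). Its coefficient `S₁` is bounded by the `L¹` norm of `A` on the line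
(`norm_matrixCoeff_le`, `integral_norm_upperEntry_le`), which is of order
`(1 - γ)⁻¹ |t|⁻¹ e^{-t² δ}`. Finally `(1 - γ)⁻¹ ≤ |t|^ε` and `δ ≥ |t|^{-1-ε/2}`.

*Uniqueness.* The difference of two solutions is the Cauchy integral of some `g ∈ L²`. At almost
every point its boundary values jump by `g`, so `g = N₋ (G - 1)`, where `N₋` is the boundary value
from below. The `L²` norm of `N₋` is at most a multiple of `δ⁻¹ ‖g‖`
(`boundary_values_of_tendsto`): the piece of the contour on which `N₋` is taken contributes
through the `L²` bound for Cauchy integrals over the real line (`lintegral_sq_cauchyReal_le`), and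
every other piece meets it at an angle of size at least comparable to `δ` or not at all, so that
it contributes through a kernel `δ⁻¹ (|x - c| + |y - c|)⁻¹`, which is bounded by Schur's test
(`lintegral_sq_hilbert_le`). Since `G - 1` is small compared with `δ` (`norm_jump_sub_one_le`), it
follows that `g = 0` (`eqOn_of_isSolution`).
-/

namespace GinibreRHP

/-! ### Deformation of contours that are graphs -/

/-- Green's theorem for the quadrilateral between the horizontal line `Im = s` and the graph of
`x ↦ α x + β`, over the interval with end points `a` and `b`. -/
lemma integral_affine_sub_integral_horizontal {U : Set ℂ} (hU : IsOpen U) {F : ℂ → ℂ}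
    (hF : DifferentiableOn ℂ F U) (s α β a b : ℝ)
    (hsub : ∀ x ∈ Set.uIcc a b, ∀ σ ∈ Set.Icc (0 : ℝ) 1,
      (x : ℂ) + I * ((s : ℂ) + σ * (α * x + β - s)) ∈ U) :
    (∫ x in a..b, F (x + I * (α * x + β)) * (1 + I * α)) - ∫ x in a..b, F (x + I * s) =
      (∫ σ in (0 : ℝ)..1, F (b + I * (s + σ * (α * b + β - s))) * (I * (α * b + β - s))) -
      ∫ σ in (0 : ℝ)..1, F (a + I * (s + σ * (α * a + β - s))) * (I * (α * a + β - s)) := by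
  set p : ℝ × ℝ → ℂ := fun z => (z.1 : ℂ) + I * ((s : ℂ) + z.2 * (α * z.1 + β - s)) with hp
  have hmaps : Set.MapsTo p (Set.uIcc a b ×ˢ Set.uIcc (0 : ℝ) 1) U := by
    rintro ⟨x, σ⟩ ⟨hx, hσ⟩
    rw [Set.uIcc_of_le zero_le_one] at hσ
    exact hsub x hx σ hσ
  have hpc : Continuous p := by fun_prop
  have hFc : ContinuousOn (fun z => F (p z)) (Set.uIcc a b ×ˢ Set.uIcc (0 : ℝ) 1) :=
    hF.continuousOn.comp hpc.continuousOn hmaps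
  set fst' : ℝ × ℝ →L[ℝ] ℂ := Complex.ofRealCLM.comp (ContinuousLinearMap.fst ℝ ℝ ℝ)
  set snd' : ℝ × ℝ →L[ℝ] ℂ := Complex.ofRealCLM.comp (ContinuousLinearMap.snd ℝ ℝ ℝ)
  have h1 : ∀ z : ℝ × ℝ, HasFDerivAt (fun z : ℝ × ℝ => (z.1 : ℂ)) fst' z := fun z =>
    fst'.hasFDerivAt
  have h2 : ∀ z : ℝ × ℝ, HasFDerivAt (fun z : ℝ × ℝ => (z.2 : ℂ)) snd' z := fun z =>
    snd'.hasFDerivAt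
  set p' : ℝ × ℝ → ℝ × ℝ →L[ℝ] ℂ := fun z =>
    fst' + I • ((z.2 : ℂ) • ((α : ℂ) • fst') + (α * z.1 + β - s : ℂ) • snd')
  have hpd : ∀ z, HasFDerivAt p (p' z) z := by
    intro z
    have h3 : HasFDerivAt (fun z : ℝ × ℝ => (α * z.1 + β - s : ℂ)) ((α : ℂ) • fst') z :=
      (((h1 z).const_mul (α : ℂ)).add_const (β : ℂ)).sub_const (s : ℂ)
    exact (h1 z).add ((((h2 z).mul h3).const_add (s : ℂ)).const_mul I)
  have hFd : ∀ z ∈ Set.Ioo (min a b) (max a b) ×ˢ Set.Ioo (min (0 : ℝ) 1) (max 0 1),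
      HasFDerivAt (fun z => F (p z)) (deriv F (p z) • p' z) z := by
    intro z hz
    have hzU : p z ∈ U := hmaps ⟨Set.Ioo_subset_Icc_self hz.1, Set.Ioo_subset_Icc_self hz.2⟩
    exact ((hF.differentiableAt (hU.mem_nhds hzU)).hasDerivAt).comp_hasFDerivAt z (hpd z)
  have hc1 : Continuous fun z : ℝ × ℝ => (I * (α * z.1 + β - s) : ℂ) := by fun_prop
  have hc2 : Continuous fun z : ℝ × ℝ => (1 + I * (z.2 * α) : ℂ) := by fun_prop
  have key := integral2_divergence_prod_of_hasFDerivAt_off_countable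
    (fun z => -(F (p z) * (I * (α * z.1 + β - s)))) (fun z => F (p z) * (1 + I * (z.2 * α)))
    (fun z => -((F (p z)) • (I • ((α : ℂ) • fst')) +
      (I * (α * z.1 + β - s) : ℂ) • (deriv F (p z) • p' z)))
    (fun z => F (p z) • (I • ((α : ℂ) • snd')) + (1 + I * (z.2 * α) : ℂ) • (deriv F (p z) • p' z))
    a 0 b 1 ∅ Set.countable_empty
    ((hFc.mul hc1.continuousOn).neg) (hFc.mul hc2.continuousOn) ?_ ?_ ?_
  · have hz : ∀ x y : ℝ, (-((F (p (x, y))) • (I • ((α : ℂ) • fst')) +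
      (I * (α * ((x, y) : ℝ × ℝ).1 + β - s) : ℂ) • (deriv F (p (x, y)) • p' (x, y)))) (1, 0) +
      (F (p (x, y)) • (I • ((α : ℂ) • snd')) + (1 + I * (((x, y) : ℝ × ℝ).2 * α) : ℂ) •
        (deriv F (p (x, y)) • p' (x, y))) (0, 1) = 0 := by
      intro x y
      simp [p', fst', snd']
      ring
    simp only [hz, intervalIntegral.integral_zero] at key
    simp only [hp, intervalIntegral.integral_neg] at key
    have e1 : ∀ x : ℝ, (s : ℂ) + (α * x + β - s) = α * x + β := fun x => by ring
    simp only [Complex.ofReal_one, Complex.ofReal_zero, one_mul, zero_mul,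
      mul_zero, add_zero, mul_one, e1] at key
    linear_combination -key
  · intro z hz
    rw [Set.sdiff_empty] at hz
    have h3 : HasFDerivAt (fun z : ℝ × ℝ => (I * (α * z.1 + β - s) : ℂ))
        (I • ((α : ℂ) • fst')) z :=
      ((((h1 z).const_mul (α : ℂ)).add_const (β : ℂ)).sub_const (s : ℂ)).const_mul I
    exact ((hFd z hz).mul h3).neg
  · intro z hz
    rw [Set.sdiff_empty] at hz
    have h3 : HasFDerivAt (fun z : ℝ × ℝ => (1 + I * (z.2 * α) : ℂ))
        (I • ((α : ℂ) • snd')) z := by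
      have := (((h2 z).mul_const (α : ℂ)).const_mul I).const_add (1 : ℂ)
      exact this
    exact (hFd z hz).mul h3
  · have hz : ∀ z : ℝ × ℝ, (-((F (p z)) • (I • ((α : ℂ) • fst')) +
      (I * (α * z.1 + β - s) : ℂ) • (deriv F (p z) • p' z))) (1, 0) +
      (F (p z) • (I • ((α : ℂ) • snd')) + (1 + I * (z.2 * α) : ℂ) •
        (deriv F (p z) • p' z)) (0, 1) = 0 := by
      intro z
      simp [p', fst', snd']
      ring
    simp only [hz]
    exact integrableOn_zero

/-- The integral of `F` along the vertical segment from `x + i s` to `x + i y`. -/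
noncomputable def verticalIntegral (F : ℂ → ℂ) (s y x : ℝ) : ℂ :=
  ∫ σ in (0 : ℝ)..1, F (x + I * (s + σ * (y - s))) * (I * (y - s))

lemma tendsto_verticalIntegral {F : ℂ → ℂ} {s y C : ℝ} {l : Filter ℝ}
    (hl : Tendsto (fun x : ℝ => (1 + x ^ 2)⁻¹) l (𝓝 0))
    (hF : ∀ᶠ x : ℝ in l, ∀ σ ∈ Set.Icc (0 : ℝ) 1,
      ‖F (x + I * (s + σ * (y - s)))‖ ≤ C * (1 + x ^ 2)⁻¹) :
    Tendsto (verticalIntegral F s y) l (𝓝 0) := by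
  have hlim : Tendsto (fun x : ℝ => C * (1 + x ^ 2)⁻¹ * |y - s|) l (𝓝 0) := by
    simpa using (hl.const_mul C).mul_const |y - s|
  refine squeeze_zero_norm' ?_ hlim
  filter_upwards [hF] with x hx
  have := intervalIntegral.norm_integral_le_of_norm_le_const (a := (0 : ℝ)) (b := 1)
    (C := C * (1 + x ^ 2)⁻¹ * |y - s|)
    (f := fun σ : ℝ => F (x + I * (s + σ * (y - s))) * (I * (y - s))) ?_
  · simpa [verticalIntegral] using this
  · intro σ hσ
    rw [Set.uIoc_of_le zero_le_one] at hσ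
    have hn : ‖(I * (y - s) : ℂ)‖ = |y - s| := by
      rw [norm_mul, Complex.norm_I, one_mul, ← Complex.ofReal_sub, Complex.norm_real,
        Real.norm_eq_abs]
    rw [norm_mul, hn]
    exact mul_le_mul_of_nonneg_right (hx σ ⟨hσ.1.le, hσ.2⟩) (abs_nonneg _)

lemma tendsto_inv_one_add_sq_atTop : Tendsto (fun x : ℝ => (1 + x ^ 2)⁻¹) atTop (𝓝 0) :=
  tendsto_inv_atTop_zero.comp
    (tendsto_atTop_add_const_left _ _ (tendsto_pow_atTop (by norm_num)))

lemma tendsto_inv_one_add_sq_atBot : Tendsto (fun x : ℝ => (1 + x ^ 2)⁻¹) atBot (𝓝 0) := by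
  have := tendsto_inv_one_add_sq_atTop.comp tendsto_neg_atBot_atTop
  refine this.congr fun x => ?_
  simp

/-- A function on a measurable set of reals that is continuous there and is dominated by
`C (1 + x²)⁻¹` is integrable. -/
lemma integrableOn_of_le_inv_one_add_sq {f : ℝ → ℂ} {S : Set ℝ} (hS : MeasurableSet S) {C : ℝ}
    (hf : ContinuousOn f S) (hb : ∀ x ∈ S, ‖f x‖ ≤ C * (1 + x ^ 2)⁻¹) : IntegrableOn f S := by
  refine Integrable.mono' ((integrable_inv_one_add_sq.const_mul C).integrableOn)
    (hf.aestronglyMeasurable hS) ?_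
  filter_upwards [ae_restrict_mem hS] with x hx using hb x hx

section deformation

variable {U : Set ℂ} {F : ℂ → ℂ} {s C : ℝ}

lemma setIntegral_Icc_sub_setIntegral_horizontal (hU : IsOpen U) (hF : DifferentiableOn ℂ F U)
    (α β : ℝ) {a b : ℝ} (hab : a ≤ b)
    (hsub : ∀ x ∈ Set.Icc a b, ∀ σ ∈ Set.Icc (0 : ℝ) 1,
      (x : ℂ) + I * ((s : ℂ) + σ * ((α * x + β : ℝ) - s)) ∈ U) :
    (∫ x in Set.Icc a b, F (x + I * (α * x + β : ℝ)) * (1 + I * α)) -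
      ∫ x in Set.Icc a b, F (x + I * s) =
      verticalIntegral F s (α * b + β) b - verticalIntegral F s (α * a + β) a := by
  have := integral_affine_sub_integral_horizontal hU hF s α β a b (by
    rw [Set.uIcc_of_le hab]
    intro x hx σ hσ
    simpa using hsub x hx σ hσ)
  rw [integral_Icc_eq_integral_Ioc, integral_Icc_eq_integral_Ioc,
    ← intervalIntegral.integral_of_le hab, ← intervalIntegral.integral_of_le hab]
  simpa [verticalIntegral] using this

lemma setIntegral_Iic_sub_setIntegral_horizontal (hU : IsOpen U) (hF : DifferentiableOn ℂ F U)
    (y b : ℝ)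
    (hsub : ∀ x ∈ Set.Iic b, ∀ σ ∈ Set.Icc (0 : ℝ) 1,
      (x : ℂ) + I * ((s : ℂ) + σ * (y - s)) ∈ U)
    (hb : ∀ x ∈ Set.Iic b, ∀ σ ∈ Set.Icc (0 : ℝ) 1,
      ‖F (x + I * ((s : ℂ) + σ * (y - s)))‖ ≤ C * (1 + x ^ 2)⁻¹) :
    (∫ x in Set.Iic b, F (x + I * y)) - ∫ x in Set.Iic b, F (x + I * s) =
      verticalIntegral F s y b := by
  have hint : ∀ y' : ℝ, (∃ σ ∈ Set.Icc (0 : ℝ) 1, (y' : ℂ) = s + σ * (y - s)) →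
      IntegrableOn (fun x : ℝ => F (x + I * y')) (Set.Iic b) := by
    rintro y' ⟨σ, hσ, e⟩
    refine integrableOn_of_le_inv_one_add_sq measurableSet_Iic (C := C) ?_ ?_
    · refine hF.continuousOn.comp (by fun_prop) fun x hx => ?_
      rw [e]; exact hsub x hx σ hσ
    · intro x hx; rw [e]; exact hb x hx σ hσ
  have h1 := hint y ⟨1, by simp, by simp⟩
  have h0 := hint s ⟨0, by simp, by simp⟩
  have t1 := intervalIntegral_tendsto_integral_Iic b h1 tendsto_id
  have t0 := intervalIntegral_tendsto_integral_Iic b h0 tendsto_id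
  have tv : Tendsto (verticalIntegral F s y) atBot (𝓝 0) :=
    tendsto_verticalIntegral (C := C) tendsto_inv_one_add_sq_atBot (by
      filter_upwards [Iic_mem_atBot b] with x hx using hb x hx)
  have t2 : Tendsto (fun a => verticalIntegral F s y b - verticalIntegral F s y a) atBot
      (𝓝 (verticalIntegral F s y b - 0)) := tendsto_const_nhds.sub tv
  rw [sub_zero] at t2
  refine tendsto_nhds_unique (t1.sub t0) (t2.congr' ?_)
  filter_upwards [Iic_mem_atBot b] with a ha
  have := setIntegral_Icc_sub_setIntegral_horizontal hU hF (s := s) 0 y (Set.mem_Iic.1 ha) (by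
    intro x hx σ hσ
    simpa using hsub x hx.2 σ hσ)
  rw [integral_Icc_eq_integral_Ioc, integral_Icc_eq_integral_Ioc,
    ← intervalIntegral.integral_of_le ha, ← intervalIntegral.integral_of_le ha] at this
  simpa using this.symm

lemma setIntegral_Ici_sub_setIntegral_horizontal (hU : IsOpen U) (hF : DifferentiableOn ℂ F U)
    (y a : ℝ)
    (hsub : ∀ x ∈ Set.Ici a, ∀ σ ∈ Set.Icc (0 : ℝ) 1,
      (x : ℂ) + I * ((s : ℂ) + σ * (y - s)) ∈ U)
    (hb : ∀ x ∈ Set.Ici a, ∀ σ ∈ Set.Icc (0 : ℝ) 1,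
      ‖F (x + I * ((s : ℂ) + σ * (y - s)))‖ ≤ C * (1 + x ^ 2)⁻¹) :
    (∫ x in Set.Ici a, F (x + I * y)) - ∫ x in Set.Ici a, F (x + I * s) =
      -verticalIntegral F s y a := by
  have hint : ∀ y' : ℝ, (∃ σ ∈ Set.Icc (0 : ℝ) 1, (y' : ℂ) = s + σ * (y - s)) →
      IntegrableOn (fun x : ℝ => F (x + I * y')) (Set.Ici a) := by
    rintro y' ⟨σ, hσ, e⟩
    refine integrableOn_of_le_inv_one_add_sq measurableSet_Ici (C := C) ?_ ?_
    · refine hF.continuousOn.comp (by fun_prop) fun x hx => ?_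
      rw [e]; exact hsub x hx σ hσ
    · intro x hx; rw [e]; exact hb x hx σ hσ
  have h1 := hint y ⟨1, by simp, by simp⟩
  have h0 := hint s ⟨0, by simp, by simp⟩
  have t1 := intervalIntegral_tendsto_integral_Ioi a (h1.mono_set Set.Ioi_subset_Ici_self)
    tendsto_id
  have t0 := intervalIntegral_tendsto_integral_Ioi a (h0.mono_set Set.Ioi_subset_Ici_self)
    tendsto_id
  rw [integral_Ici_eq_integral_Ioi, integral_Ici_eq_integral_Ioi]
  have tv : Tendsto (verticalIntegral F s y) atTop (𝓝 0) :=
    tendsto_verticalIntegral (C := C) tendsto_inv_one_add_sq_atTop (by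
      filter_upwards [Ici_mem_atTop a] with x hx using hb x hx)
  have t2 : Tendsto (fun b => verticalIntegral F s y b - verticalIntegral F s y a) atTop
      (𝓝 (0 - verticalIntegral F s y a)) := tv.sub tendsto_const_nhds
  rw [zero_sub] at t2
  refine tendsto_nhds_unique (t1.sub t0) (t2.congr' ?_)
  filter_upwards [Ici_mem_atTop a] with b ha
  have := setIntegral_Icc_sub_setIntegral_horizontal hU hF (s := s) 0 y (Set.mem_Ici.1 ha) (by
    intro x hx σ hσ
    simpa using hsub x hx.1 σ hσ)
  rw [integral_Icc_eq_integral_Ioc, integral_Icc_eq_integral_Ioc,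
    ← intervalIntegral.integral_of_le ha, ← intervalIntegral.integral_of_le ha] at this
  simpa using this.symm

/-- **Cauchy's theorem for a strip**: the integrals of a decaying holomorphic function over two
horizontal lines agree. -/
lemma integral_horizontal_eq (hU : IsOpen U) (hF : DifferentiableOn ℂ F U) (s y : ℝ)
    (hsub : ∀ x v : ℝ, v ∈ Set.uIcc s y → (x : ℂ) + I * v ∈ U)
    (hb : ∀ x v : ℝ, v ∈ Set.uIcc s y → ‖F (x + I * v)‖ ≤ C * (1 + x ^ 2)⁻¹) :
    ∫ x : ℝ, F (x + I * y) = ∫ x : ℝ, F (x + I * s) := by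
  have hseg : ∀ σ ∈ Set.Icc (0 : ℝ) 1, s + σ * (y - s) ∈ Set.uIcc s y := by
    intro σ hσ
    rw [← segment_eq_uIcc]
    exact ⟨1 - σ, σ, by linarith [hσ.2], hσ.1, by ring, by simp [smul_eq_mul]; ring⟩
  have hsub' : ∀ x : ℝ, ∀ σ ∈ Set.Icc (0 : ℝ) 1, (x : ℂ) + I * ((s : ℂ) + σ * (y - s)) ∈ U := by
    intro x σ hσ
    simpa using hsub x _ (hseg σ hσ)
  have hb' : ∀ x : ℝ, ∀ σ ∈ Set.Icc (0 : ℝ) 1,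
      ‖F (x + I * ((s : ℂ) + σ * (y - s)))‖ ≤ C * (1 + x ^ 2)⁻¹ := by
    intro x σ hσ
    simpa using hb x _ (hseg σ hσ)
  have hint : ∀ v ∈ Set.uIcc s y, Integrable (fun x : ℝ => F (x + I * v)) := by
    intro v hv
    rw [← integrableOn_univ]
    refine integrableOn_of_le_inv_one_add_sq MeasurableSet.univ (C := C) ?_ fun x _ => hb x v hv
    exact hF.continuousOn.comp (by fun_prop) fun x _ => hsub x v hv
  have e1 := setIntegral_Iic_sub_setIntegral_horizontal (C := C) hU hF y 0
    (fun x _ => hsub' x) (fun x _ => hb' x)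
  have e2 := setIntegral_Ici_sub_setIntegral_horizontal (C := C) hU hF y 0
    (fun x _ => hsub' x) (fun x _ => hb' x)
  have iy := hint y Set.right_mem_uIcc
  have is' := hint s Set.left_mem_uIcc
  rw [integral_Ici_eq_integral_Ioi, integral_Ici_eq_integral_Ioi] at e2
  rw [← intervalIntegral.integral_Iic_add_Ioi (b := 0) iy.integrableOn iy.integrableOn,
    ← intervalIntegral.integral_Iic_add_Ioi (b := 0) is'.integrableOn is'.integrableOn]
  linear_combination e1 + e2

end deformation

/-! ### Cauchy integrals over horizontal lines -/

/-- The integral `∫ g(x) (x + i s - z)⁻¹ dx`: the Cauchy integral, without the factor `(2πi)⁻¹`,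
of the density `g` on the horizontal line `Im = s`. -/
noncomputable def cauchyLine (g : ℝ → ℂ) (s : ℝ) (z : ℂ) : ℂ :=
  ∫ x : ℝ, g x / (x + I * s - z)

lemma abs_sub_im_le (s : ℝ) (z : ℂ) (x : ℝ) : |s - z.im| ≤ ‖(x + I * s - z : ℂ)‖ := by
  have := Complex.abs_im_le_norm (x + I * s - z : ℂ)
  simpa using this

lemma line_sub_ne_zero {s : ℝ} {z : ℂ} (hz : z.im ≠ s) (x : ℝ) : (x + I * s - z : ℂ) ≠ 0 := by
  intro h0
  have h1 := abs_sub_im_le s z x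
  rw [h0, norm_zero] at h1
  exact hz (sub_eq_zero.1 (abs_eq_zero.1 (le_antisymm h1 (abs_nonneg _)))).symm

lemma norm_div_line_sub_le (g : ℝ → ℂ) {s r : ℝ} {z : ℂ} (hr : 0 < r) (hz : r ≤ |s - z.im|)
    (x : ℝ) : ‖g x / (x + I * s - z)‖ ≤ ‖g x‖ / r := by
  rw [norm_div]
  exact div_le_div_of_nonneg_left (norm_nonneg _) hr (hz.trans (abs_sub_im_le s z x))

lemma aestronglyMeasurable_div_line {g : ℝ → ℂ} (hg : AEStronglyMeasurable g) (s : ℝ) (z : ℂ) :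
    AEStronglyMeasurable fun x : ℝ => g x / (x + I * s - z) := by
  have : Measurable fun x : ℝ => ((x : ℂ) + I * s - z)⁻¹ := by fun_prop
  exact (hg.mul this.aestronglyMeasurable).congr
    (Eventually.of_forall fun x => (div_eq_mul_inv _ _).symm)

lemma integrable_div_line {g : ℝ → ℂ} (hg : Integrable g) {s : ℝ} {z : ℂ} (hz : z.im ≠ s) :
    Integrable fun x : ℝ => g x / (x + I * s - z) := by
  have hr : 0 < |s - z.im| := abs_pos.2 (sub_ne_zero.2 (Ne.symm hz))
  refine Integrable.mono' (hg.norm.div_const |s - z.im|)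
    (aestronglyMeasurable_div_line hg.1 s z) ?_
  exact Eventually.of_forall (norm_div_line_sub_le g hr le_rfl)

lemma norm_cauchyLine_le {g : ℝ → ℂ} (hg : Integrable g) {s r : ℝ} {z : ℂ} (hr : 0 < r)
    (hz : r ≤ |s - z.im|) : ‖cauchyLine g s z‖ ≤ (∫ x, ‖g x‖) / r := by
  rw [← integral_div]
  exact norm_integral_le_of_norm_le (hg.norm.div_const r)
    (Eventually.of_forall (norm_div_line_sub_le g hr hz))

lemma differentiableAt_cauchyLine {g : ℝ → ℂ} (hg : Integrable g) {s : ℝ} {z : ℂ}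
    (hz : z.im ≠ s) : DifferentiableAt ℂ (cauchyLine g s) z := by
  set r := |s - z.im| / 2 with hr
  have hr0 : 0 < r := half_pos (abs_pos.2 (sub_ne_zero.2 (Ne.symm hz)))
  have hball : ∀ w ∈ Metric.ball z r, r ≤ |s - w.im| := by
    intro w hw
    have h1 : |w.im - z.im| < r := by
      have := Complex.abs_im_le_norm (w - z)
      rw [Metric.mem_ball, dist_eq_norm] at hw
      simpa using this.trans_lt hw
    have h2 : |s - z.im| ≤ |s - w.im| + |w.im - z.im| := abs_sub_le _ _ _
    linarith
  have hne : ∀ w ∈ Metric.ball z r, w.im ≠ s := by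
    intro w hw h0
    have := hball w hw
    rw [h0, sub_self, abs_zero] at this
    linarith
  refine (hasDerivAt_integral_of_dominated_loc_of_deriv_le (s := Metric.ball z r)
    (F := fun w x => g x / (x + I * s - w)) (F' := fun w x => g x / (x + I * s - w) ^ 2)
    (bound := fun x => ‖g x‖ / r ^ 2) (Metric.ball_mem_nhds z hr0)
    (Eventually.of_forall fun w => aestronglyMeasurable_div_line hg.1 s w)
    (integrable_div_line hg hz) ?_ ?_ (hg.norm.div_const _) ?_).2.differentiableAt
  · have : Measurable fun x : ℝ => (((x : ℂ) + I * s - z) ^ 2)⁻¹ := by fun_prop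
    exact (hg.1.mul this.aestronglyMeasurable).congr
      (Eventually.of_forall fun x => (div_eq_mul_inv _ _).symm)
  · refine Eventually.of_forall fun x w hw => ?_
    rw [norm_div, norm_pow]
    exact div_le_div_of_nonneg_left (norm_nonneg _) (by positivity)
      (pow_le_pow_left₀ hr0.le ((hball w hw).trans (abs_sub_im_le s w x)) 2)
  · refine Eventually.of_forall fun x w hw => ?_
    have hne' := line_sub_ne_zero (hne w hw) x
    have h1 : HasDerivAt (fun w : ℂ => (x + I * s - w : ℂ)) (-1) w := by
      simpa using (hasDerivAt_id w).const_sub (x + I * s : ℂ)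
    have h2 := (h1.inv hne').const_mul (g x)
    exact h2.congr_deriv (by simp [div_eq_mul_inv])

lemma sq_add_one_le_line (s x : ℝ) :
    ‖(x + I * s : ℂ)‖ ^ 2 = x ^ 2 + s ^ 2 := by
  rw [← Complex.normSq_eq_norm_sq, Complex.normSq_apply]
  simp
  ring

/-- The expansion `-m₀ z⁻¹ + O(z⁻²)` of a Cauchy integral at infinity, `m₀ = ∫ g`, uniformly at
distance at least `r` from the line. -/
lemma exists_norm_cauchyLine_add_le {g : ℝ → ℂ} {C : ℝ} (hm : AEStronglyMeasurable g)
    (hg : ∀ x, ‖g x‖ ≤ C * (1 + x ^ 2)⁻¹ ^ 2) (s : ℝ) {r : ℝ} (hr : 0 < r) :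
    ∃ K : ℝ, ∀ z : ℂ, z ≠ 0 → r ≤ |s - z.im| →
      ‖cauchyLine g s z + (∫ x, g x) * z⁻¹‖ ≤ K * ‖z⁻¹ ^ 2‖ := by
  have hC : 0 ≤ C := by simpa using (norm_nonneg _).trans (hg 0)
  have hgi : Integrable g := by
    refine Integrable.mono' (integrable_inv_one_add_sq.const_mul C) hm
      (Eventually.of_forall fun x => (hg x).trans (mul_le_mul_of_nonneg_left ?_ hC))
    have : (1 + x ^ 2)⁻¹ ≤ 1 := inv_le_one_of_one_le₀ (by nlinarith [sq_nonneg x])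
    have h0 : 0 ≤ (1 + x ^ 2)⁻¹ := by positivity
    nlinarith
  set D : ℝ := (1 + s ^ 2) * (1 + r⁻¹) * C with hD
  refine ⟨∫ x : ℝ, D * (1 + x ^ 2)⁻¹, fun z hz0 hz => ?_⟩
  have hzs : z.im ≠ s := by
    intro h0
    rw [h0, sub_self, abs_zero] at hz
    linarith
  have e : cauchyLine g s z + (∫ x, g x) * z⁻¹ =
      ∫ x : ℝ, g x * (-(x + I * s) + (x + I * s) ^ 2 / (x + I * s - z)) * z⁻¹ ^ 2 := by
    rw [cauchyLine, ← integral_mul_const, ← integral_add (integrable_div_line hgi hzs)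
      (hgi.mul_const _)]
    refine integral_congr_ae (Eventually.of_forall fun x => ?_)
    have := line_sub_ne_zero hzs x
    simp only
    field_simp
    ring
  rw [e, integral_mul_const, norm_mul]
  refine mul_le_mul_of_nonneg_right ?_ (norm_nonneg _)
  refine norm_integral_le_of_norm_le (integrable_inv_one_add_sq.const_mul D)
    (Eventually.of_forall fun x => ?_)
  set l : ℂ := x + I * s with hl
  have hl2 : ‖l‖ ^ 2 ≤ (1 + s ^ 2) * (1 + x ^ 2) := by
    rw [hl, sq_add_one_le_line]
    nlinarith [mul_nonneg (sq_nonneg x) (sq_nonneg s)]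
  have hl1 : ‖l‖ ≤ (1 + s ^ 2) * (1 + x ^ 2) := by
    have h1 : (1 : ℝ) ≤ (1 + s ^ 2) * (1 + x ^ 2) := by
      nlinarith [mul_nonneg (sq_nonneg x) (sq_nonneg s), sq_nonneg x, sq_nonneg s]
    by_cases h2 : ‖l‖ ≤ 1
    · linarith
    · nlinarith
  have hq : ‖-l + l ^ 2 / (l - z)‖ ≤ (1 + s ^ 2) * (1 + x ^ 2) * (1 + r⁻¹) := by
    refine (norm_add_le _ _).trans ?_
    rw [norm_neg, norm_div, norm_pow]
    have h3 : ‖l‖ ^ 2 / ‖l - z‖ ≤ (1 + s ^ 2) * (1 + x ^ 2) * r⁻¹ := by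
      rw [div_eq_mul_inv]
      refine mul_le_mul hl2 ?_ (by positivity) (by positivity)
      exact inv_anti₀ hr (hz.trans (abs_sub_im_le s z x))
    linarith
  rw [norm_mul]
  have hx : 0 < 1 + x ^ 2 := by positivity
  calc ‖g x‖ * ‖-l + l ^ 2 / (l - z)‖
      ≤ (C * (1 + x ^ 2)⁻¹ ^ 2) * ((1 + s ^ 2) * (1 + x ^ 2) * (1 + r⁻¹)) :=
        mul_le_mul (hg x) hq (norm_nonneg _) (by positivity)
    _ = D * (1 + x ^ 2)⁻¹ := by rw [hD]; field_simp

lemma integrable_div_sq_add_sq {c : ℝ} (hc : 0 < c) :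
    Integrable (fun x : ℝ => c / (x ^ 2 + c ^ 2)) := by
  have h1 := (integrable_inv_one_add_sq.comp_div hc.ne').div_const c
  refine h1.congr (Eventually.of_forall fun x => ?_)
  simp only
  field_simp
  ring

lemma integral_div_sq_add_sq {c : ℝ} (hc : 0 < c) :
    ∫ x : ℝ, c / (x ^ 2 + c ^ 2) = Real.pi := by
  have h1 := Measure.integral_comp_div (fun x : ℝ => (1 + x ^ 2)⁻¹) c
  rw [integral_univ_inv_one_add_sq, smul_eq_mul, abs_of_pos hc] at h1
  have h2 : ∀ x : ℝ, c / (x ^ 2 + c ^ 2) = c⁻¹ * (1 + (x / c) ^ 2)⁻¹ := by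
    intro x
    field_simp
    ring
  simp only [h2]
  rw [integral_const_mul, h1]
  field_simp

/-- The kernel `B² w⁻¹ (w² + B²)⁻¹`: it has the same residue at `0` as `w⁻¹`, and is integrable
on the horizontal lines that avoid its poles. -/
noncomputable def regularizedInv (B : ℝ) (w : ℂ) : ℂ := B ^ 2 / (w * (w ^ 2 + B ^ 2))

lemma regularizedInv_im {B σ : ℝ} (h0 : σ ≠ 0) (hσ : |σ| < B) (x : ℝ) :
    (regularizedInv B (x + I * σ)).im = -(σ / (x ^ 2 + σ ^ 2)) -
      (1 / 2) * ((B - σ) / (x ^ 2 + (B - σ) ^ 2)) + (1 / 2) * ((B + σ) / (x ^ 2 + (B + σ) ^ 2)) := by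
  obtain ⟨h1, h2⟩ := abs_lt.1 hσ
  have hne : ∀ c : ℝ, c ≠ 0 → (x : ℂ) + I * c ≠ 0 := by
    intro c hc h3
    have := congrArg Complex.im h3
    simp at this
    exact hc this
  have a0 := hne σ h0
  have a1 := hne (σ - B) (by linarith)
  have a2 := hne (σ + B) (by linarith)
  push_cast at a1 a2
  have e : regularizedInv B (x + I * σ) = ((x : ℂ) + I * σ)⁻¹ -
      (1 / 2) * ((x : ℂ) + I * (σ - B : ℝ))⁻¹ - (1 / 2) * ((x : ℂ) + I * (σ + B : ℝ))⁻¹ := by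
    have e2 : ((x : ℂ) + I * σ) ^ 2 + B ^ 2 = (x + I * (σ - B)) * (x + I * (σ + B)) := by
      linear_combination ((B : ℂ) ^ 2) * Complex.I_sq
    rw [regularizedInv, e2]
    push_cast
    field_simp
    linear_combination (2 * (B : ℂ) ^ 2) * Complex.I_sq
  have him : ∀ c : ℝ, (((x : ℂ) + I * c)⁻¹).im = -(c / (x ^ 2 + c ^ 2)) := by
    intro c
    rw [Complex.inv_im, Complex.normSq_apply]
    simp
    ring
  have hre : (1 / 2 : ℂ) = ((1 / 2 : ℝ) : ℂ) := by push_cast; rfl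
  rw [e, hre, Complex.sub_im, Complex.sub_im, Complex.im_ofReal_mul, Complex.im_ofReal_mul, him,
    him, him]
  have e3 : (σ - B) ^ 2 = (B - σ) ^ 2 := by ring
  have e4 : σ + B = B + σ := by ring
  rw [e3, e4, show σ - B = -(B - σ) by ring, neg_div]
  ring

lemma integrable_regularizedInv {B σ : ℝ} (h0 : σ ≠ 0) (hσ : |σ| < B) :
    Integrable fun x : ℝ => regularizedInv B (x + I * σ) := by
  have hB : 0 < B ^ 2 - σ ^ 2 := by
    obtain ⟨h1, h2⟩ := abs_lt.1 hσ
    nlinarith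
  set c := Real.sqrt (B ^ 2 - σ ^ 2) with hc
  have hc0 : 0 < c := Real.sqrt_pos.2 hB
  have hc2 : c ^ 2 = B ^ 2 - σ ^ 2 := Real.sq_sqrt hB.le
  have hm : Measurable fun x : ℝ => regularizedInv B (x + I * σ) := by
    unfold regularizedInv
    fun_prop
  refine Integrable.mono' ((integrable_div_sq_add_sq hc0).const_mul (B ^ 2 / |σ| / c))
    hm.aestronglyMeasurable (Eventually.of_forall fun x => ?_)
  have h1 : |σ| ≤ ‖(x + I * σ : ℂ)‖ := by
    have := Complex.abs_im_le_norm (x + I * σ : ℂ)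
    simpa using this
  have h2 : x ^ 2 + c ^ 2 ≤ ‖((x : ℂ) + I * σ) ^ 2 + B ^ 2‖ := by
    have := Complex.re_le_norm (((x : ℂ) + I * σ) ^ 2 + B ^ 2)
    refine le_trans (le_of_eq ?_) this
    rw [hc2]
    simp [pow_two]
    ring
  have hσ0 := abs_pos.2 h0
  rw [regularizedInv, norm_div, norm_mul, norm_pow, Complex.norm_real, Real.norm_eq_abs, sq_abs]
  calc B ^ 2 / (‖(x + I * σ : ℂ)‖ * ‖((x : ℂ) + I * σ) ^ 2 + B ^ 2‖)
      ≤ B ^ 2 / (|σ| * (x ^ 2 + c ^ 2)) := by gcongr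
    _ = B ^ 2 / |σ| / c * (c / (x ^ 2 + c ^ 2)) := by field_simp

lemma integral_regularizedInv {B σ : ℝ} (h0 : σ ≠ 0) (hσ : |σ| < B) :
    ∫ x : ℝ, regularizedInv B (x + I * σ) = -(Real.pi * Real.sign σ : ℝ) * I := by
  have hi := integrable_regularizedInv h0 hσ
  obtain ⟨h1, h2⟩ := abs_lt.1 hσ
  have hconj : ∀ x : ℝ, regularizedInv B ((-x : ℝ) + I * σ) =
      -(starRingEnd ℂ) (regularizedInv B (x + I * σ)) := by
    intro x
    have e1 : ((-x : ℝ) : ℂ) + I * σ = -(starRingEnd ℂ) (x + I * σ) := by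
      simp [add_comm]
    rw [e1]
    generalize (x : ℂ) + I * σ = w
    rw [regularizedInv, regularizedInv, map_div₀, map_mul, map_add, map_pow, map_pow,
      Complex.conj_ofReal, neg_sq, neg_mul, div_neg]
  apply Complex.ext
  · have e := integral_neg_eq_self (fun x : ℝ => regularizedInv B (x + I * σ)) volume
    simp only [hconj] at e
    rw [integral_neg, integral_conj] at e
    have := congrArg Complex.re e
    simp at this
    have h3 : (∫ x : ℝ, regularizedInv B (x + I * σ)).re = 0 := by linarith
    simpa using h3
  · have e : (∫ x : ℝ, regularizedInv B (x + I * σ)).im =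
        ∫ x : ℝ, (regularizedInv B (x + I * σ)).im := (Complex.imCLM.integral_comp_comm hi).symm
    rw [e]
    simp only [regularizedInv_im h0 hσ]
    have p1 : 0 < B - σ := by linarith
    have p2 : 0 < B + σ := by linarith
    have i1 := (integrable_div_sq_add_sq p1).const_mul (1 / 2)
    have i2 := (integrable_div_sq_add_sq p2).const_mul (1 / 2)
    have key : Integrable (fun x : ℝ => σ / (x ^ 2 + σ ^ 2)) ∧
        ∫ x : ℝ, σ / (x ^ 2 + σ ^ 2) = Real.pi * Real.sign σ := by
      rcases lt_or_gt_of_ne h0 with h | h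
      · have p : 0 < -σ := by linarith
        have e5 : ∀ x : ℝ, σ / (x ^ 2 + σ ^ 2) = -(-σ / (x ^ 2 + (-σ) ^ 2)) := by
          intro x; rw [neg_sq, neg_div, neg_neg]
        simp only [e5]
        rw [Real.sign_of_neg h, integral_neg, integral_div_sq_add_sq p]
        exact ⟨(integrable_div_sq_add_sq p).neg, by ring⟩
      · rw [Real.sign_of_pos h, integral_div_sq_add_sq h]
        exact ⟨integrable_div_sq_add_sq h, by ring⟩
    have i0 : Integrable fun x : ℝ => -(σ / (x ^ 2 + σ ^ 2)) := key.1.neg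
    have i3 : Integrable fun x : ℝ => -(σ / (x ^ 2 + σ ^ 2)) -
      1 / 2 * ((B - σ) / (x ^ 2 + (B - σ) ^ 2)) := i0.sub i1
    rw [integral_add i3 i2, integral_sub i0 i1, integral_neg,
      integral_const_mul, integral_const_mul, integral_div_sq_add_sq p1,
      integral_div_sq_add_sq p2, key.2]
    simp

lemma inv_one_add_sub_sq_le (x a : ℝ) :
    (1 + (x - a) ^ 2)⁻¹ ≤ 2 * (1 + a ^ 2) * (1 + x ^ 2)⁻¹ := by
  rw [← div_eq_mul_inv, le_div_iff₀ (by positivity), inv_mul_le_iff₀ (by positivity)]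
  nlinarith [sq_nonneg (x - 2 * a), mul_nonneg (sq_nonneg a) (sq_nonneg (x - a))]

section

variable {U : Set ℂ} {G : ℂ → ℂ} {C : ℝ}

/-- The Cauchy integrals of a holomorphic function over two lines on the same side of the
evaluation point agree. -/
lemma cauchyLine_eq_of_notMem (hU : IsOpen U) (hG : DifferentiableOn ℂ G U) {s y : ℝ}
    (hsub : ∀ x v : ℝ, v ∈ Set.uIcc s y → (x : ℂ) + I * v ∈ U)
    (hb : ∀ x v : ℝ, v ∈ Set.uIcc s y → ‖G (x + I * v)‖ ≤ C * (1 + x ^ 2)⁻¹)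
    {z : ℂ} (hz : z.im ∉ Set.uIcc s y) :
    cauchyLine (fun x => G (x + I * y)) y z = cauchyLine (fun x => G (x + I * s)) s z := by
  obtain ⟨r, hr0, hr⟩ : ∃ r > 0, ∀ v ∈ Set.uIcc s y, r ≤ |v - z.im| := by
    have hcl : IsClosed (Set.uIcc s y) := isClosed_Icc
    obtain ⟨r, hr, hball⟩ := Metric.isOpen_iff.1 hcl.isOpen_compl z.im hz
    refine ⟨r, hr, fun v hv => not_lt.1 fun hlt => hball ?_ hv⟩
    rwa [Metric.mem_ball, Real.dist_eq]
  have hzU : ∀ w ∈ U \ {z}, w - z ≠ 0 := fun w hw => sub_ne_zero.2 hw.2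
  refine integral_horizontal_eq (U := U \ {z}) (F := fun w => G w / (w - z)) (C := C / r)
    (hU.sdiff isClosed_singleton) ?_ s y ?_ ?_
  · exact (hG.mono Set.sdiff_subset).div (by fun_prop) hzU
  · intro x v hv
    refine ⟨hsub x v hv, fun h0 => ?_⟩
    rw [Set.mem_singleton_iff] at h0
    apply hz
    rw [← h0]
    simpa using hv
  · intro x v hv
    refine (norm_div_line_sub_le (fun x => G (x + I * v)) hr0 (hr v hv) x).trans ?_
    rw [div_mul_eq_mul_div]
    exact div_le_div_of_nonneg_right (hb x v hv) hr0.le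

/-- **Cauchy's integral formula for a strip.** -/
lemma cauchyLine_sub_cauchyLine (hU : IsOpen U) (hG : DifferentiableOn ℂ G U) {s y : ℝ}
    (hsub : ∀ x v : ℝ, v ∈ Set.Icc s y → (x : ℂ) + I * v ∈ U)
    (hb : ∀ x v : ℝ, v ∈ Set.Icc s y → ‖G (x + I * v)‖ ≤ C * (1 + x ^ 2)⁻¹)
    {z : ℂ} (hz : z.im ∈ Set.Ioo s y) :
    cauchyLine (fun x => G (x + I * s)) s z - cauchyLine (fun x => G (x + I * y)) y z =
      2 * Real.pi * I * G z := by
  have hsy : s < y := hz.1.trans hz.2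
  set B : ℝ := y - s + 1 with hB
  have hzeq : z = (z.re : ℂ) + I * z.im := by
    rw [mul_comm]; exact (Complex.re_add_im z).symm
  have hzU : z ∈ U := by rw [hzeq]; exact hsub _ _ ⟨hz.1.le, hz.2.le⟩
  set V : Set ℂ := U ∩ {w | |(w - z).im| < B} with hV
  have hVo : IsOpen V := hU.inter (isOpen_lt (by fun_prop) continuous_const)
  have hdre : ∀ w : ℂ, |(w - z).im| < B → ((w - z).re) ^ 2 + (B ^ 2 - (w - z).im ^ 2) ≤
      ‖(w - z) ^ 2 + (B : ℂ) ^ 2‖ ∧ 0 < B ^ 2 - (w - z).im ^ 2 := by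
    intro w hw
    constructor
    · refine le_trans (le_of_eq ?_) (Complex.re_le_norm _)
      rw [Complex.add_re, pow_two (w - z), pow_two (B : ℂ), Complex.mul_re, Complex.mul_re]
      simp
      ring
    · obtain ⟨h1, h2⟩ := abs_lt.1 hw
      nlinarith
  have hden : ∀ w ∈ V, (w - z) ^ 2 + (B : ℂ) ^ 2 ≠ 0 := by
    intro w hw h0
    obtain ⟨h1, h2⟩ := hdre w hw.2
    rw [h0, norm_zero] at h1
    nlinarith [sq_nonneg (w - z).re]
  have hB0 : (B : ℂ) ≠ 0 := by
    rw [Ne, Complex.ofReal_eq_zero]; linarith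
  -- subtracting a multiple of a kernel with the same pole leaves a function holomorphic at `z`
  set N : ℂ → ℂ := fun w => G w - G z * (B ^ 2 / ((w - z) ^ 2 + B ^ 2)) with hN
  have hNz : N z = 0 := by
    simp [hN, hB0]
  have hNd : DifferentiableOn ℂ N V := by
    refine (hG.mono Set.inter_subset_left).sub (DifferentiableOn.const_mul ?_ _)
    exact DifferentiableOn.div (by fun_prop) (by fun_prop) hden
  have hzV : z ∈ V := ⟨hzU, by simp only [Set.mem_ofPred_eq, sub_self, Complex.zero_im, abs_zero]; linarith⟩
  set F : ℂ → ℂ := dslope N z with hF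
  have hFd : DifferentiableOn ℂ F V :=
    (Complex.differentiableOn_dslope (hVo.mem_nhds hzV)).2 hNd
  have hFne : ∀ w, w ≠ z → F w = G w / (w - z) - G z * regularizedInv B (w - z) := by
    intro w hw
    have : w - z ≠ 0 := sub_ne_zero.2 hw
    rw [hF, dslope_of_ne _ hw, slope_def_field, hNz, sub_zero, hN, regularizedInv, sub_div,
      mul_div_assoc, div_div, mul_comm ((w - z) ^ 2 + (B : ℂ) ^ 2)]
  have hsubV : ∀ x v : ℝ, v ∈ Set.uIcc s y → (x : ℂ) + I * v ∈ V := by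
    intro x v hv
    rw [Set.uIcc_of_le hsy.le] at hv
    refine ⟨hsub x v hv, ?_⟩
    simp only [Set.mem_ofPred_eq]
    have : ((x : ℂ) + I * v - z).im = v - z.im := by simp
    rw [this, abs_lt]
    constructor <;> linarith [hv.1, hv.2, hz.1, hz.2]
  -- a bound near `z` by compactness
  obtain ⟨K, hK⟩ : ∃ K, ∀ x v : ℝ, |x - z.re| ≤ 1 → v ∈ Set.Icc s y → ‖F (x + I * v)‖ ≤ K := by
    have hc : IsCompact (Set.Icc (z.re - 1) (z.re + 1) ×ˢ Set.Icc s y) :=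
      isCompact_Icc.prod isCompact_Icc
    have hcont : ContinuousOn (fun q : ℝ × ℝ => F (q.1 + I * q.2))
        (Set.Icc (z.re - 1) (z.re + 1) ×ˢ Set.Icc s y) := by
      refine hFd.continuousOn.comp (by fun_prop) fun q hq => hsubV _ _ ?_
      rw [Set.uIcc_of_le hsy.le]; exact hq.2
    obtain ⟨K, hK⟩ := hc.exists_bound_of_continuousOn hcont
    refine ⟨K, fun x v hx hv => hK (x, v) ⟨?_, hv⟩⟩
    obtain ⟨h1, h2⟩ := abs_le.1 hx
    constructor <;> linarith
  have hC : 0 ≤ C := by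
    have := (norm_nonneg _).trans (hb 0 s ⟨le_rfl, hsy.le⟩)
    simpa using this
  have hK0 : 0 ≤ K := (norm_nonneg _).trans (hK z.re s (by simp) ⟨le_rfl, hsy.le⟩)
  have main := integral_horizontal_eq (U := V) (F := F)
    (C := K * 2 * (2 * (1 + z.re ^ 2)) + (C + ‖G z‖ * (B ^ 2) * (2 * (1 + z.re ^ 2))))
    hVo hFd s y hsubV ?_
  · have hline : ∀ v ∈ Set.Icc s y, v ≠ z.im → ∫ x : ℝ, F (x + I * v) =
        cauchyLine (fun x => G (x + I * v)) v z + G z * ((Real.pi * Real.sign (v - z.im) : ℝ) * I) := by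
      intro v hv hvz
      have hgi : Integrable fun x : ℝ => G (x + I * v) := by
        rw [← integrableOn_univ]
        refine integrableOn_of_le_inv_one_add_sq MeasurableSet.univ (C := C) ?_
          fun x _ => hb x v hv
        exact hG.continuousOn.comp (by fun_prop) fun x _ => hsub x v hv
      have hσ : |v - z.im| < B := by
        rw [abs_lt]
        constructor <;> linarith [hv.1, hv.2, hz.1, hz.2]
      have hσ0 : v - z.im ≠ 0 := sub_ne_zero.2 hvz
      have e1 : ∀ x : ℝ, F (x + I * v) = G (x + I * v) / (x + I * v - z) -
          G z * regularizedInv B (((x - z.re : ℝ) : ℂ) + I * (v - z.im : ℝ)) := by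
        intro x
        have hne : (x : ℂ) + I * v ≠ z := sub_ne_zero.1 (line_sub_ne_zero (Ne.symm hvz) x)
        rw [hFne _ hne]
        congr 3
        conv_lhs => rw [hzeq]
        push_cast
        ring
      have hr := integrable_regularizedInv hσ0 hσ
      simp only [e1]
      rw [integral_sub (integrable_div_line hgi (Ne.symm hvz))
        ((hr.comp_sub_right z.re).const_mul _), integral_const_mul,
        integral_sub_right_eq_self (fun x : ℝ => regularizedInv B ((x : ℂ) + I * (v - z.im : ℝ))),
        integral_regularizedInv hσ0 hσ]
      simp only [cauchyLine]
      ring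
    rw [hline y ⟨hsy.le, le_rfl⟩ hz.2.ne', hline s ⟨le_rfl, hsy.le⟩ hz.1.ne,
      Real.sign_of_pos (by linarith [hz.2]), Real.sign_of_neg (by linarith [hz.1])] at main
    push_cast at main
    linear_combination -main
  · intro x v hv
    have hv' := hv
    rw [Set.uIcc_of_le hsy.le] at hv'
    have hinv := inv_one_add_sub_sq_le x z.re
    have hp : 0 ≤ C * (1 + x ^ 2)⁻¹ := by positivity
    by_cases hx : |x - z.re| ≤ 1
    · have h1 : ‖F (x + I * v)‖ ≤ K := hK x v hx hv'
      have h2 : 1 ≤ 2 * (1 + (x - z.re) ^ 2)⁻¹ := by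
        rw [← div_eq_mul_inv, le_div_iff₀ (by positivity)]
        have := sq_le_one_iff_abs_le_one (x - z.re) |>.2 hx
        linarith
      have h3 : K ≤ K * 2 * (2 * (1 + z.re ^ 2) * (1 + x ^ 2)⁻¹) := by nlinarith
      have h4 : 0 ≤ ‖G z‖ * (B ^ 2) * (2 * (1 + z.re ^ 2)) * (1 + x ^ 2)⁻¹ := by positivity
      linarith
    · have hx1 : 1 ≤ |x - z.re| := (not_le.1 hx).le
      have hre : ((x : ℂ) + I * v - z).re = x - z.re := by simp
      have hn1 : 1 ≤ ‖(x : ℂ) + I * v - z‖ := by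
        refine hx1.trans ?_
        have := Complex.abs_re_le_norm ((x : ℂ) + I * v - z)
        rwa [hre] at this
      have hne : (x : ℂ) + I * v ≠ z := by
        intro h0
        rw [h0, sub_self, norm_zero] at hn1
        linarith
      rw [hFne _ hne]
      refine (norm_sub_le _ _).trans ?_
      have g1 : ‖G (x + I * v) / (x + I * v - z)‖ ≤ C * (1 + x ^ 2)⁻¹ := by
        rw [norm_div]
        exact (div_le_self (norm_nonneg _) hn1).trans (hb x v hv')
      obtain ⟨d1, d2⟩ := hdre _ (hsubV x v hv).2
      have d3 : 1 + (x - z.re) ^ 2 ≤ ‖((x : ℂ) + I * v - z) ^ 2 + (B : ℂ) ^ 2‖ := by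
        refine le_trans ?_ d1
        have : ((x : ℂ) + I * v - z).im = v - z.im := by simp
        rw [hre, this]
        have h5 : |v - z.im| ≤ y - s := by
          rw [abs_le]
          constructor <;> linarith [hv'.1, hv'.2, hz.1, hz.2]
        have h6 : (v - z.im) ^ 2 ≤ (y - s) ^ 2 := sq_le_sq' (by linarith [(abs_le.1 h5).1])
          (abs_le.1 h5).2
        nlinarith
      have g2 : ‖G z * regularizedInv B (x + I * v - z)‖ ≤
          ‖G z‖ * (B ^ 2) * (2 * (1 + z.re ^ 2)) * (1 + x ^ 2)⁻¹ := by
        rw [norm_mul, regularizedInv, norm_div, norm_mul, norm_pow, Complex.norm_real,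
          Real.norm_eq_abs, sq_abs]
        have : B ^ 2 / (‖(x : ℂ) + I * v - z‖ * ‖((x : ℂ) + I * v - z) ^ 2 + (B : ℂ) ^ 2‖) ≤
            B ^ 2 * (1 + (x - z.re) ^ 2)⁻¹ := by
          rw [← div_eq_mul_inv]
          refine div_le_div_of_nonneg_left (sq_nonneg _) (by positivity) ?_
          nlinarith [sq_nonneg (x - z.re)]
        calc _ ≤ ‖G z‖ * (B ^ 2 * (1 + (x - z.re) ^ 2)⁻¹) :=
              mul_le_mul_of_nonneg_left this (norm_nonneg _)
          _ ≤ ‖G z‖ * (B ^ 2 * (2 * (1 + z.re ^ 2) * (1 + x ^ 2)⁻¹)) := by gcongr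
          _ = _ := by ring
      have h3 : 0 ≤ K * 2 * (2 * (1 + z.re ^ 2)) * (1 + x ^ 2)⁻¹ := by positivity
      linarith
end

/-! ### The scalar problem -/

/-- A function `A` that is holomorphic in a strip around `-d ≤ Im z ≤ D` (up to `Im z > -D`), and
decays there like `x⁻⁴`. -/
structure IsStripDatum (A : ℂ → ℂ) (d D : ℝ) : Prop where
  d_pos : 0 < d
  d_lt : d < D
  diff : ∃ D₁ > D, DifferentiableOn ℂ A {z | -D < z.im ∧ z.im < D₁}
  bound : ∃ C, ∀ x v : ℝ, v ∈ Set.Icc (-d) D → ‖A (x + I * v)‖ ≤ C * (1 + x ^ 2)⁻¹ ^ 2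

/-- The reflected density `G(w) = A(w) W(-w)` of the scalar problem. -/
def reflected (A W : ℂ → ℂ) (w : ℂ) : ℂ := A w * W (-w)

/-- `W` solves the nonlocal scalar equation `W = 1 + s C[A(·) W(-·)]` below the line `Im = D`, where
`C` is the Cauchy transform of that line. -/
structure IsScalarSolution (A : ℂ → ℂ) (d D : ℝ) (s : ℂ) (W : ℂ → ℂ) : Prop where
  datum : IsStripDatum A d D
  eqn : ∀ z : ℂ, z.im < D →
    W z = 1 + s / (2 * Real.pi * I) * cauchyLine (fun x => reflected A W (x + I * D)) D z
  line_bound : ∀ x : ℝ, ‖W (-(x + I * D))‖ ≤ 2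

lemma sq_inv_one_add_sq_le (x : ℝ) : (1 + x ^ 2)⁻¹ ^ 2 ≤ (1 + x ^ 2)⁻¹ := by
  have h1 : (1 + x ^ 2)⁻¹ ≤ 1 := inv_le_one_of_one_le₀ (by nlinarith [sq_nonneg x])
  have h0 : 0 ≤ (1 + x ^ 2)⁻¹ := by positivity
  nlinarith

lemma IsStripDatum.const_nonneg {A : ℂ → ℂ} {d D C : ℝ} (hA : IsStripDatum A d D)
    (hC : ∀ x v : ℝ, v ∈ Set.Icc (-d) D → ‖A (x + I * v)‖ ≤ C * (1 + x ^ 2)⁻¹ ^ 2) : 0 ≤ C := by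
  have := (norm_nonneg _).trans (hC 0 D ⟨by linarith [hA.d_pos, hA.d_lt], le_rfl⟩)
  simpa using this

lemma IsStripDatum.integrable_line {A : ℂ → ℂ} {d D : ℝ} (hA : IsStripDatum A d D) :
    Integrable fun x : ℝ => A (x + I * D) := by
  obtain ⟨D₁, hD₁, hdiff⟩ := hA.diff
  obtain ⟨C, hC⟩ := hA.bound
  have hD : D ∈ Set.Icc (-d) D := ⟨by linarith [hA.d_pos, hA.d_lt], le_rfl⟩
  rw [← integrableOn_univ]
  refine integrableOn_of_le_inv_one_add_sq MeasurableSet.univ (C := C) ?_ fun x _ =>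
    (hC x D hD).trans (mul_le_mul_of_nonneg_left (sq_inv_one_add_sq_le x) (hA.const_nonneg hC))
  refine hdiff.continuousOn.comp (by fun_prop) fun x _ => ?_
  have : 0 < D := hA.d_pos.trans hA.d_lt
  simp [hD₁]
  linarith

/-- The scalar equation has a solution when `A` is small on the line: after restriction to the
line `Im = -D` the Cauchy kernel is bounded by `(2D)⁻¹`, and the equation is solved by the
contraction mapping principle in the space of bounded continuous functions. -/
theorem exists_isScalarSolution {A : ℂ → ℂ} {d D : ℝ} (hA : IsStripDatum A d D) {s : ℂ}
    (hs : ‖s‖ = 1) (hsmall : (∫ x : ℝ, ‖A (x + I * D)‖) ≤ 2 * D) :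
    ∃ W, IsScalarSolution A d D s W := by
  have hD : 0 < D := hA.d_pos.trans hA.d_lt
  set a : ℝ → ℂ := fun x => A (x + I * D) with ha
  have hai : Integrable a := hA.integrable_line
  have him : ∀ x : ℝ, (-(x + I * D : ℂ)).im = -D := by intro x; simp
  have hr : ∀ x : ℝ, 2 * D ≤ |D - (-(x + I * D : ℂ)).im| := by
    intro x
    rw [him, sub_neg_eq_add, abs_of_pos (by linarith)]
    linarith
  have hprod : ∀ w : BoundedContinuousFunction ℝ ℂ, Integrable fun x => a x * w x := fun w =>
    hai.mul_bdd (c := ‖w‖) w.continuous.aestronglyMeasurable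
      (Eventually.of_forall w.norm_coe_le_norm)
  have hcs : ‖s / (2 * Real.pi * I)‖ ≤ 1 / 2 := by
    rw [norm_div, hs]
    have : (2 : ℝ) ≤ ‖(2 * Real.pi * I : ℂ)‖ := by
      simp [abs_of_pos Real.pi_pos]
      linarith [Real.pi_gt_three]
    exact div_le_div_of_nonneg_left zero_le_one two_pos this
  have hint : ∀ w : BoundedContinuousFunction ℝ ℂ, (∫ x, ‖a x * w x‖) ≤ 2 * D * ‖w‖ := by
    intro w
    calc (∫ x, ‖a x * w x‖) ≤ ∫ x, ‖a x‖ * ‖w‖ := by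
          refine integral_mono (hprod w).norm (hai.norm.mul_const _) fun x => ?_
          simp only [norm_mul]
          exact mul_le_mul_of_nonneg_left (w.norm_coe_le_norm x) (norm_nonneg _)
      _ = (∫ x, ‖a x‖) * ‖w‖ := integral_mul_const _ _
      _ ≤ _ := mul_le_mul_of_nonneg_right hsmall (norm_nonneg _)
  have hcl : ∀ (w : BoundedContinuousFunction ℝ ℂ) (x : ℝ),
      ‖s / (2 * Real.pi * I) * cauchyLine (fun y => a y * w y) D (-(x + I * D))‖ ≤
        1 / 2 * ‖w‖ := by
    intro w x
    rw [norm_mul]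
    refine mul_le_mul hcs ?_ (norm_nonneg _) (by norm_num)
    refine (norm_cauchyLine_le (hprod w) (by linarith : 0 < 2 * D) (hr x)).trans ?_
    rw [div_le_iff₀ (by linarith)]
    linarith [hint w]
  have hcont : ∀ w : BoundedContinuousFunction ℝ ℂ, Continuous fun x : ℝ =>
      s / (2 * Real.pi * I) * cauchyLine (fun y => a y * w y) D (-(x + I * D)) := by
    intro w
    refine continuous_const.mul (continuous_iff_continuousAt.2 fun x => ?_)
    have h1 : ContinuousAt (cauchyLine (fun y => a y * w y) D) (-(x + I * D)) :=
      (differentiableAt_cauchyLine (hprod w) (by rw [him]; linarith)).continuousAt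
    exact ContinuousAt.comp (f := fun x : ℝ => (-(x + I * D) : ℂ)) h1 (by fun_prop)
  let T : BoundedContinuousFunction ℝ ℂ → BoundedContinuousFunction ℝ ℂ := fun w =>
    1 + BoundedContinuousFunction.ofNormedAddCommGroup _ (hcont w) _ (hcl w)
  have hT : ∀ w x, T w x = 1 + s / (2 * Real.pi * I) *
      cauchyLine (fun y => a y * w y) D (-(x + I * D)) := fun w x => rfl
  have hcontr : ContractingWith (1 / 2) T := by
    refine ⟨by rw [← NNReal.coe_lt_coe]; norm_num, LipschitzWith.of_dist_le_mul fun w w' => ?_⟩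
    rw [BoundedContinuousFunction.dist_le (by positivity)]
    intro x
    rw [dist_eq_norm, dist_eq_norm, hT, hT, add_sub_add_left_eq_sub, ← mul_sub]
    have e : cauchyLine (fun y => a y * w y) D (-(x + I * D)) -
        cauchyLine (fun y => a y * w' y) D (-(x + I * D)) =
        cauchyLine (fun y => a y * (w - w') y) D (-(x + I * D)) := by
      rw [cauchyLine, cauchyLine, cauchyLine, ← integral_sub (integrable_div_line (hprod w)
        (by rw [him]; linarith)) (integrable_div_line (hprod w') (by rw [him]; linarith))]
      refine integral_congr_ae (Eventually.of_forall fun y => ?_)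
      simp only [BoundedContinuousFunction.coe_sub, Pi.sub_apply]
      ring
    rw [e]
    simpa using hcl (w - w') x
  set w := ContractingWith.fixedPoint T hcontr
  have hw : T w = w := hcontr.fixedPoint_isFixedPt
  have hwn : ‖w‖ ≤ 2 := by
    have h1 : ‖w‖ ≤ 1 + 1 / 2 * ‖w‖ := by
      rw [BoundedContinuousFunction.norm_le (by positivity)]
      intro x
      rw [← hw, hT, hw]
      refine (norm_add_le _ _).trans ?_
      rw [norm_one]
      exact add_le_add le_rfl (hcl w x)
    linarith
  refine ⟨fun z => 1 + s / (2 * Real.pi * I) * cauchyLine (fun y => a y * w y) D z, hA, ?_, ?_⟩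
  · intro z _
    have : ∀ x : ℝ, reflected A (fun z => 1 + s / (2 * Real.pi * I) *
        cauchyLine (fun y => a y * w y) D z) (x + I * D) = a x * w x := by
      intro x
      rw [reflected, ← hT, hw]
    simp only [this]
  · intro x
    rw [← hT, hw]
    exact (w.norm_coe_le_norm x).trans hwn

namespace IsScalarSolution

variable {A W : ℂ → ℂ} {d D : ℝ} {s : ℂ}

lemma D_pos (hW : IsScalarSolution A d D s W) : 0 < D := hW.datum.d_pos.trans hW.datum.d_lt

lemma integrable_line (hW : IsScalarSolution A d D s W) (hm : AEStronglyMeasurable fun x : ℝ =>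
    reflected A W (x + I * D)) : Integrable fun x : ℝ => reflected A W (x + I * D) := by
  refine Integrable.mono' (hW.datum.integrable_line.norm.mul_const 2) hm
    (Eventually.of_forall fun x => ?_)
  rw [reflected, norm_mul]
  exact mul_le_mul_of_nonneg_left (hW.line_bound x) (norm_nonneg _)

lemma integrable_top (hW : IsScalarSolution A d D s W) :
    Integrable fun x : ℝ => reflected A W (x + I * D) := by
  by_contra hni
  have hnm : ¬ AEStronglyMeasurable fun x : ℝ => reflected A W (x + I * D) := fun hm =>
    hni (hW.integrable_line hm)
  have hz : ∀ z : ℂ, z.im < D →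
      cauchyLine (fun x => reflected A W (x + I * D)) D z = 0 := by
    intro z hz
    refine integral_undef fun hi => hnm ?_
    have h1 : Measurable fun x : ℝ => ((x : ℂ) + I * D - z) := by fun_prop
    refine (hi.1.mul h1.aestronglyMeasurable).congr (Eventually.of_forall fun x => ?_)
    exact div_mul_cancel₀ _ (line_sub_ne_zero hz.ne x)
  have hW1 : ∀ x : ℝ, reflected A W (x + I * D) = A (x + I * D) := by
    intro x
    have him : (-(x + I * D : ℂ)).im < D := by
      simp; linarith [hW.D_pos]
    rw [reflected, hW.eqn _ him, hz _ him, mul_zero, add_zero, mul_one]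
  simp only [hW1] at hni
  exact hni hW.datum.integrable_line

lemma differentiableAt (hW : IsScalarSolution A d D s W) {z : ℂ} (hz : z.im < D) :
    DifferentiableAt ℂ W z := by
  have h1 : DifferentiableAt ℂ (fun z => 1 + s / (2 * Real.pi * I) *
      cauchyLine (fun x => reflected A W (x + I * D)) D z) z :=
    ((differentiableAt_cauchyLine hW.integrable_top hz.ne).const_mul _).const_add _
  refine h1.congr_of_eventuallyEq ?_
  have : {z : ℂ | z.im < D} ∈ 𝓝 z :=
    (isOpen_lt Complex.continuous_im continuous_const).mem_nhds hz
  filter_upwards [this] with w hw using hW.eqn w hw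

lemma exists_bound (hW : IsScalarSolution A d D s W) :
    ∃ K, ∀ z : ℂ, z.im ≤ d → ‖W z‖ ≤ K := by
  refine ⟨1 + ‖s / (2 * Real.pi * I)‖ *
    ((∫ x : ℝ, ‖reflected A W (x + I * D)‖) / (D - d)), fun z hz => ?_⟩
  have hd := hW.datum.d_lt
  rw [hW.eqn z (hz.trans_lt hd)]
  refine (norm_add_le _ _).trans ?_
  rw [norm_one, norm_mul]
  refine add_le_add le_rfl (mul_le_mul_of_nonneg_left ?_ (norm_nonneg _))
  refine norm_cauchyLine_le hW.integrable_top (by linarith) ?_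
  rw [abs_of_pos (by linarith)]
  linarith

lemma exists_differentiableOn (hW : IsScalarSolution A d D s W) : ∃ D₁ > D,
    DifferentiableOn ℂ (reflected A W) {z | -D < z.im ∧ z.im < D₁} := by
  obtain ⟨D₁, hD₁, hdiff⟩ := hW.datum.diff
  refine ⟨D₁, hD₁, hdiff.mul fun z hz => ?_⟩
  have h1 : DifferentiableAt ℂ W (-z) := hW.differentiableAt (by simp; linarith [hz.1])
  exact (h1.comp z differentiable_neg.differentiableAt).differentiableWithinAt

lemma exists_reflected_bound (hW : IsScalarSolution A d D s W) : ∃ C, ∀ x v : ℝ,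
    v ∈ Set.Icc (-d) D → ‖reflected A W (x + I * v)‖ ≤ C * (1 + x ^ 2)⁻¹ ^ 2 := by
  obtain ⟨C, hC⟩ := hW.datum.bound
  obtain ⟨K, hK⟩ := hW.exists_bound
  refine ⟨K * C, fun x v hv => ?_⟩
  rw [reflected, norm_mul, mul_comm, mul_assoc]
  exact mul_le_mul (hK _ (by simp; linarith [hv.1])) (hC x v hv) (norm_nonneg _)
    ((norm_nonneg _).trans (hK 0 (by simpa using hW.datum.d_pos.le)))

/-- The bound in the form that the contour deformations need. -/
lemma exists_reflected_bound' (hW : IsScalarSolution A d D s W) : ∃ C, 0 ≤ C ∧ ∀ x v : ℝ,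
    v ∈ Set.Icc (-d) D → ‖reflected A W (x + I * v)‖ ≤ C * (1 + x ^ 2)⁻¹ := by
  obtain ⟨C, hC⟩ := hW.exists_reflected_bound
  have hC0 : 0 ≤ C := by
    have := (norm_nonneg _).trans (hC 0 D ⟨by linarith [hW.datum.d_pos, hW.D_pos], le_rfl⟩)
    simpa using this
  exact ⟨C, hC0, fun x v hv => (hC x v hv).trans
    (mul_le_mul_of_nonneg_left (sq_inv_one_add_sq_le x) hC0)⟩

lemma continuous_line (hW : IsScalarSolution A d D s W) {v : ℝ} (hv : v ∈ Set.Icc (-d) D) :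
    Continuous fun x : ℝ => reflected A W (x + I * v) := by
  obtain ⟨D₁, hD₁, hdiff⟩ := hW.exists_differentiableOn
  rw [← continuousOn_univ]
  refine hdiff.continuousOn.comp (by fun_prop) fun x _ => ?_
  have := hW.datum.d_lt
  simp
  constructor <;> linarith [hv.1, hv.2]

lemma integrable_reflected (hW : IsScalarSolution A d D s W) {v : ℝ} (hv : v ∈ Set.Icc (-d) D) :
    Integrable fun x : ℝ => reflected A W (x + I * v) := by
  obtain ⟨C, -, hC⟩ := hW.exists_reflected_bound'
  rw [← integrableOn_univ]
  exact integrableOn_of_le_inv_one_add_sq MeasurableSet.univ (C := C)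
    (hW.continuous_line hv).continuousOn fun x _ => hC x v hv

end IsScalarSolution

/-- The continuation of the scalar solution from above: the density is integrated over the lower
line `Im = -d`. -/
noncomputable def upperContinuation (A : ℂ → ℂ) (d : ℝ) (s : ℂ) (W : ℂ → ℂ) (z : ℂ) : ℂ :=
  1 + s / (2 * Real.pi * I) *
    cauchyLine (fun x => reflected A W (x + I * ((-d : ℝ) : ℂ))) (-d) z

namespace IsScalarSolution

variable {A W : ℂ → ℂ} {d D : ℝ} {s : ℂ}

lemma neg_d_mem (hW : IsScalarSolution A d D s W) : -d ∈ Set.Icc (-d) D :=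
  ⟨le_rfl, by linarith [hW.datum.d_pos, hW.D_pos]⟩

lemma D_mem (hW : IsScalarSolution A d D s W) : D ∈ Set.Icc (-d) D :=
  ⟨by linarith [hW.datum.d_pos, hW.D_pos], le_rfl⟩

lemma differentiableAt_upper (hW : IsScalarSolution A d D s W) {z : ℂ} (hz : -d < z.im) :
    DifferentiableAt ℂ (upperContinuation A d s W) z :=
  ((differentiableAt_cauchyLine (hW.integrable_reflected hW.neg_d_mem) hz.ne').const_mul
    _).const_add _

/-- The jump relation of the scalar problem, as an identity between continuations in the strip. -/
lemma upper_eq (hW : IsScalarSolution A d D s W) {z : ℂ} (hz : z.im ∈ Set.Ioo (-d) D) :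
    upperContinuation A d s W z = W z + s * reflected A W z := by
  obtain ⟨D₁, hD₁, hdiff⟩ := hW.exists_differentiableOn
  obtain ⟨C, -, hC⟩ := hW.exists_reflected_bound'
  have hd := hW.datum.d_lt
  have hU : IsOpen {z : ℂ | -D < z.im ∧ z.im < D₁} :=
    (isOpen_lt continuous_const Complex.continuous_im).inter
      (isOpen_lt Complex.continuous_im continuous_const)
  have key := cauchyLine_sub_cauchyLine hU hdiff (s := -d) (y := D) (C := C) (by
    intro x v hv
    simp
    constructor <;> linarith [hv.1, hv.2]) hC hz
  rw [hW.eqn z hz.2, upperContinuation]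
  have hpi : (Real.pi : ℂ) ≠ 0 := Complex.ofReal_ne_zero.2 Real.pi_ne_zero
  have hI := Complex.I_ne_zero
  rw [sub_eq_iff_eq_add] at key
  rw [key]
  field_simp
  ring

lemma integral_line_eq (hW : IsScalarSolution A d D s W) :
    ∫ x : ℝ, reflected A W (x + I * ((-d : ℝ) : ℂ)) = ∫ x : ℝ, reflected A W (x + I * D) := by
  obtain ⟨D₁, hD₁, hdiff⟩ := hW.exists_differentiableOn
  obtain ⟨C, -, hC⟩ := hW.exists_reflected_bound'
  have hd := hW.datum.d_lt
  have hd0 := hW.datum.d_pos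
  have hU : IsOpen {z : ℂ | -D < z.im ∧ z.im < D₁} :=
    (isOpen_lt continuous_const Complex.continuous_im).inter
      (isOpen_lt Complex.continuous_im continuous_const)
  have hIcc : Set.uIcc (-d) D = Set.Icc (-d) D := Set.uIcc_of_le (by linarith)
  refine (integral_horizontal_eq hU hdiff (C := C) (-d) D (fun x v hv => ?_)
    fun x v hv => ?_).symm
  · rw [hIcc] at hv
    simp
    constructor <;> linarith [hv.1, hv.2]
  · rw [hIcc] at hv
    exact hC x v hv

/-- The coefficient of `z⁻¹` in the expansion of the scalar solution at infinity. -/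
noncomputable def _root_.GinibreRHP.firstCoeff (A : ℂ → ℂ) (D : ℝ) (s : ℂ) (W : ℂ → ℂ) : ℂ :=
  -(s / (2 * Real.pi * I) * ∫ x : ℝ, reflected A W (x + I * D))

lemma exists_asymptotics (hW : IsScalarSolution A d D s W) : ∃ K : ℝ, ∀ z : ℂ, z ≠ 0 →
    (z.im ≤ 0 → ‖W z - 1 - firstCoeff A D s W * z⁻¹‖ ≤ K * ‖z⁻¹ ^ 2‖) ∧
    (0 ≤ z.im → ‖upperContinuation A d s W z - 1 - firstCoeff A D s W * z⁻¹‖ ≤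
      K * ‖z⁻¹ ^ 2‖) := by
  obtain ⟨C, hC⟩ := hW.exists_reflected_bound
  have hd0 := hW.datum.d_pos
  have hD0 := hW.D_pos
  obtain ⟨K₁, h₁⟩ := exists_norm_cauchyLine_add_le (hW.integrable_reflected hW.D_mem).1
    (fun x => hC x D hW.D_mem) D hD0
  obtain ⟨K₂, h₂⟩ := exists_norm_cauchyLine_add_le (hW.integrable_reflected hW.neg_d_mem).1
    (fun x => hC x (-d) hW.neg_d_mem) (-d) hd0
  set σ := s / (2 * Real.pi * I) with hσ
  refine ⟨‖σ‖ * max K₁ K₂, fun z hz0 => ⟨fun hz => ?_, fun hz => ?_⟩⟩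
  · have e : W z - 1 - firstCoeff A D s W * z⁻¹ = σ *
        (cauchyLine (fun x => reflected A W (x + I * D)) D z +
          (∫ x : ℝ, reflected A W (x + I * D)) * z⁻¹) := by
      rw [hW.eqn z (by linarith), firstCoeff, ← hσ]
      ring
    rw [e, norm_mul, mul_assoc]
    refine mul_le_mul_of_nonneg_left ((h₁ z hz0 ?_).trans ?_) (norm_nonneg _)
    · rw [abs_of_pos (by linarith)]; linarith
    · exact mul_le_mul_of_nonneg_right (le_max_left _ _) (norm_nonneg _)
  · have e : upperContinuation A d s W z - 1 - firstCoeff A D s W * z⁻¹ = σ *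
        (cauchyLine (fun x => reflected A W (x + I * ((-d : ℝ) : ℂ))) (-d) z +
          (∫ x : ℝ, reflected A W (x + I * ((-d : ℝ) : ℂ))) * z⁻¹) := by
      rw [upperContinuation, firstCoeff, ← hσ, hW.integral_line_eq]
      ring
    rw [e, norm_mul, mul_assoc]
    refine mul_le_mul_of_nonneg_left ((h₂ z hz0 ?_).trans ?_) (norm_nonneg _)
    · rw [abs_of_neg (by linarith)]; linarith
    · exact mul_le_mul_of_nonneg_right (le_max_right _ _) (norm_nonneg _)

lemma norm_firstCoeff_le (hW : IsScalarSolution A d D s W) (hs : ‖s‖ = 1) :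
    ‖firstCoeff A D s W‖ ≤ ∫ x : ℝ, ‖A (x + I * D)‖ := by
  have h2 : ‖∫ x : ℝ, reflected A W (x + I * D)‖ ≤ ∫ x : ℝ, ‖A (x + I * D)‖ * 2 := by
    refine norm_integral_le_of_norm_le (hW.datum.integrable_line.norm.mul_const 2)
      (Eventually.of_forall fun x => ?_)
    rw [reflected, norm_mul]
    exact mul_le_mul_of_nonneg_left (hW.line_bound x) (norm_nonneg _)
  have hcs : ‖s / (2 * Real.pi * I)‖ ≤ 1 / 2 := by
    rw [norm_div, hs]
    have : (2 : ℝ) ≤ ‖(2 * Real.pi * I : ℂ)‖ := by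
      simp [abs_of_pos Real.pi_pos]
      linarith [Real.pi_gt_three]
    exact div_le_div_of_nonneg_left zero_le_one two_pos this
  rw [integral_mul_const] at h2
  rw [firstCoeff, norm_neg, norm_mul]
  calc _ ≤ 1 / 2 * ((∫ x : ℝ, ‖A (x + I * D)‖) * 2) :=
        mul_le_mul hcs h2 (norm_nonneg _) (by norm_num)
    _ = _ := by ring

end IsScalarSolution

/-! ### The function `h` in a strip -/

lemma exists_exp_neg_mul_sq_le {c : ℝ} (hc : 0 < c) :
    ∃ K, 0 ≤ K ∧ ∀ x : ℝ, Real.exp (-(c * x ^ 2)) ≤ K * (1 + x ^ 2)⁻¹ ^ 2 := by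
  refine ⟨1 + 2 / c + 2 / c ^ 2, by positivity, fun x => ?_⟩
  have h1 := Real.quadratic_le_exp_of_nonneg (x := c * x ^ 2) (by positivity)
  rw [Real.exp_neg, inv_pow, ← div_eq_mul_inv, inv_eq_one_div, div_le_div_iff₀ (Real.exp_pos _)
    (by positivity)]
  refine le_trans ?_ (mul_le_mul_of_nonneg_left h1 (by positivity))
  have e : (1 + 2 / c + 2 / c ^ 2) * (1 + c * x ^ 2 + (c * x ^ 2) ^ 2 / 2) =
      (1 + x ^ 2) ^ 2 + (c * x ^ 2 + (c * x ^ 2) ^ 2 / 2 + 2 / c + c * (x ^ 2) ^ 2 + 2 / c ^ 2 +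
        2 / c * x ^ 2) := by
    field_simp
    ring
  rw [e]
  have : 0 ≤ c * x ^ 2 + (c * x ^ 2) ^ 2 / 2 + 2 / c + c * (x ^ 2) ^ 2 + 2 / c ^ 2 +
        2 / c * x ^ 2 := by positivity
  linarith

section

variable {t γ : ℝ}

lemma delta_pos (ht : t ≠ 0) (hγ0 : 0 < γ) (hγ1 : γ < 1) : 0 < delta t γ := by
  have : 0 < -Real.log γ := by linarith [Real.log_neg hγ0 hγ1]
  exact lt_min (div_pos (Real.sqrt_pos.2 this) (abs_pos.2 ht)) (by norm_num)

lemma delta_le_half : delta t γ ≤ 1 / 2 := min_le_right _ _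

lemma sq_mul_delta_sq_le (ht : t ≠ 0) (hγ0 : 0 < γ) (hγ1 : γ < 1) :
    t ^ 2 * delta t γ ^ 2 ≤ -Real.log γ := by
  have h1 : 0 ≤ -Real.log γ := by linarith [Real.log_neg hγ0 hγ1]
  have h2 : delta t γ * |t| ≤ Real.sqrt (-Real.log γ) := by
    rw [← le_div_iff₀ (abs_pos.2 ht)]
    exact min_le_left _ _
  have h3 : 0 ≤ delta t γ * |t| := mul_nonneg (delta_pos ht hγ0 hγ1).le (abs_nonneg t)
  have h4 := pow_le_pow_left₀ h3 h2 2
  rw [mul_pow, sq_abs, Real.sq_sqrt h1] at h4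
  linarith

lemma gamma_mul_exp_le (ht : t ≠ 0) (hγ0 : 0 < γ) (hγ1 : γ < 1) {k y : ℝ}
    (hy : |y| ≤ k * delta t γ) :
    γ * Real.exp (t ^ 2 * y ^ 2 / 2) ≤ Real.exp ((1 - k ^ 2 / 2) * Real.log γ) := by
  have h1 := sq_mul_delta_sq_le ht hγ0 hγ1
  have h2 : y ^ 2 ≤ k ^ 2 * delta t γ ^ 2 := by
    rw [← sq_abs, ← mul_pow]
    exact pow_le_pow_left₀ (abs_nonneg _) hy 2
  have h3 : t ^ 2 * y ^ 2 ≤ k ^ 2 * (t ^ 2 * delta t γ ^ 2) := by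
    nlinarith [mul_le_mul_of_nonneg_left h2 (sq_nonneg t)]
  have h4 := mul_le_mul_of_nonneg_left h1 (sq_nonneg k)
  calc γ * Real.exp (t ^ 2 * y ^ 2 / 2) = Real.exp (Real.log γ + t ^ 2 * y ^ 2 / 2) := by
        rw [Real.exp_add, Real.exp_log hγ0]
    _ ≤ _ := Real.exp_le_exp.2 (by nlinarith)

/-- The strip `|Im z| ≤ (7/5) δ` is free of zeros of `1 - γ e^{-t² z² / 2}`, as `7/5 < √2`. -/
lemma gamma_mul_exp_lt_one (ht : t ≠ 0) (hγ0 : 0 < γ) (hγ1 : γ < 1) {y : ℝ}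
    (hy : |y| ≤ 7 / 5 * delta t γ) : γ * Real.exp (t ^ 2 * y ^ 2 / 2) < 1 := by
  refine (gamma_mul_exp_le ht hγ0 hγ1 hy).trans_lt ?_
  rw [Real.exp_lt_one_iff]
  have := Real.log_neg hγ0 hγ1
  norm_num
  linarith

/-- In the strip `|Im z| ≤ (6/5) δ` the quantity `1 - |γ e^{-t² z² / 2}|` is not much smaller than
`1 - γ`: the exponent `1 - (6/5)² / 2` of `γ` in `gamma_mul_exp_le` is larger than `1/4`, and
`1 - γ ≤ 4 (1 - γ^{1/4})`. -/
lemma inv_one_sub_gamma_mul_exp_le (ht : t ≠ 0) (hγ0 : 0 < γ) (hγ1 : γ < 1) {y : ℝ}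
    (hy : |y| ≤ 6 / 5 * delta t γ) :
    (1 - γ * Real.exp (t ^ 2 * y ^ 2 / 2))⁻¹ ≤ 4 / (1 - γ) := by
  have hl := Real.log_neg hγ0 hγ1
  set u := Real.exp (Real.log γ / 4) with hu
  have hu0 : 0 < u := Real.exp_pos _
  have hu1 : u < 1 := Real.exp_lt_one_iff.2 (by linarith)
  have hu4 : u ^ 4 = γ := by
    rw [hu, ← Real.exp_nat_mul]
    push_cast
    rw [mul_div_cancel₀ _ (by norm_num), Real.exp_log hγ0]
  have h1 : γ * Real.exp (t ^ 2 * y ^ 2 / 2) ≤ u := by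
    refine (gamma_mul_exp_le ht hγ0 hγ1 hy).trans (Real.exp_le_exp.2 ?_)
    norm_num
    linarith
  have h2 : 0 < 1 - u := by linarith
  refine (inv_anti₀ h2 (by linarith : 1 - u ≤ _)).trans ?_
  rw [inv_eq_one_div, div_le_div_iff₀ h2 (by linarith), ← hu4]
  nlinarith [mul_pos hu0 hu0, mul_pos hu0 (mul_pos hu0 hu0), pow_pos hu0 3,
    mul_nonneg h2.le (sq_nonneg (1 - u)), mul_pos h2 hu0, mul_pos h2 (mul_pos hu0 hu0)]

/-- The argument `q(z) = γ e^{-t² z² / 2}` of `h = -ln (1 - q)`. -/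
noncomputable def gaussianTerm (t γ : ℝ) (z : ℂ) : ℂ :=
  (γ : ℂ) * Complex.exp (-((t : ℂ) ^ 2 * z ^ 2) / 2)

lemma norm_gaussianTerm (hγ0 : 0 < γ) (x y : ℝ) : ‖gaussianTerm t γ (x + I * y)‖ =
    γ * Real.exp (t ^ 2 * y ^ 2 / 2) * Real.exp (-(t ^ 2 / 2 * x ^ 2)) := by
  rw [gaussianTerm, norm_mul, Complex.norm_real, Real.norm_eq_abs, abs_of_pos hγ0,
    Complex.norm_exp, mul_assoc, ← Real.exp_add]
  congr 2
  have e : (-((t : ℂ) ^ 2 * (x + I * y) ^ 2) / 2) =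
      ((-(t ^ 2 * (x ^ 2 - y ^ 2)) / 2 : ℝ) : ℂ) + I * ((-(t ^ 2 * (2 * x * y)) / 2 : ℝ) : ℂ) := by
    push_cast
    linear_combination (-(t : ℂ) ^ 2 * y ^ 2 / 2) * Complex.I_sq
  rw [e, Complex.add_re, Complex.re_mul_ofReal, Complex.ofReal_re]
  simp
  ring

lemma norm_gaussianTerm_lt_one (ht : t ≠ 0) (hγ0 : 0 < γ) (hγ1 : γ < 1) {z : ℂ}
    (hz : |z.im| ≤ 7 / 5 * delta t γ) : ‖gaussianTerm t γ z‖ < 1 := by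
  have hzeq : z = (z.re : ℂ) + I * z.im := by
    rw [mul_comm]; exact (Complex.re_add_im z).symm
  rw [hzeq, norm_gaussianTerm hγ0]
  have h1 : Real.exp (-(t ^ 2 / 2 * z.re ^ 2)) ≤ 1 :=
    Real.exp_le_one_iff.2 (by nlinarith [mul_nonneg (sq_nonneg t) (sq_nonneg z.re)])
  have h2 := gamma_mul_exp_lt_one ht hγ0 hγ1 hz
  exact (mul_le_of_le_one_right (by positivity) h1).trans_lt h2

lemma one_sub_mem_slitPlane {q : ℂ} (hq : ‖q‖ < 1) : 1 - q ∈ Complex.slitPlane := by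
  left
  have := (Complex.re_le_norm q).trans_lt hq
  simp
  exact this

lemma differentiableAt_h (ht : t ≠ 0) (hγ0 : 0 < γ) (hγ1 : γ < 1) {z : ℂ}
    (hz : |z.im| ≤ 7 / 5 * delta t γ) : DifferentiableAt ℂ (h t γ) z := by
  have h1 := one_sub_mem_slitPlane (norm_gaussianTerm_lt_one ht hγ0 hγ1 hz)
  have h2 : DifferentiableAt ℂ (fun z => 1 - gaussianTerm t γ z) z := by
    unfold gaussianTerm
    fun_prop
  exact (h2.clog h1).neg

lemma exp_h (ht : t ≠ 0) (hγ0 : 0 < γ) (hγ1 : γ < 1) {z : ℂ}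
    (hz : |z.im| ≤ 7 / 5 * delta t γ) :
    Complex.exp (h t γ z) = (1 - gaussianTerm t γ z)⁻¹ := by
  have h1 := one_sub_mem_slitPlane (norm_gaussianTerm_lt_one ht hγ0 hγ1 hz)
  rw [h, Complex.exp_neg]
  congr 1
  exact Complex.exp_log (Complex.slitPlane_ne_zero h1)

lemma norm_exp_h_le (ht : t ≠ 0) (hγ0 : 0 < γ) (hγ1 : γ < 1) {z : ℂ}
    (hz : |z.im| ≤ 6 / 5 * delta t γ) : ‖Complex.exp (h t γ z)‖ ≤ 4 / (1 - γ) := by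
  have hd := delta_pos ht hγ0 hγ1
  have hz' : |z.im| ≤ 7 / 5 * delta t γ := by linarith
  have hzeq : z = (z.re : ℂ) + I * z.im := by
    rw [mul_comm]; exact (Complex.re_add_im z).symm
  rw [exp_h ht hγ0 hγ1 hz', norm_inv]
  refine le_trans ?_ (inv_one_sub_gamma_mul_exp_le ht hγ0 hγ1 hz)
  refine inv_anti₀ (by linarith [gamma_mul_exp_lt_one ht hγ0 hγ1 hz']) ?_
  have h1 : ‖gaussianTerm t γ z‖ ≤ γ * Real.exp (t ^ 2 * z.im ^ 2 / 2) := by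
    conv_lhs => rw [hzeq]
    rw [norm_gaussianTerm hγ0]
    exact mul_le_of_le_one_right (by positivity)
      (Real.exp_le_one_iff.2 (by nlinarith [mul_nonneg (sq_nonneg t) (sq_nonneg z.re)]))
  have h2 := norm_sub_norm_le (1 : ℂ) (gaussianTerm t γ z)
  rw [norm_one] at h2
  linarith

lemma exists_norm_h_le (ht : t ≠ 0) (hγ0 : 0 < γ) (hγ1 : γ < 1) : ∃ C, 0 ≤ C ∧ ∀ x v : ℝ,
    |v| ≤ 6 / 5 * delta t γ → ‖h t γ (x + I * v)‖ ≤ C * (1 + x ^ 2)⁻¹ ^ 2 := by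
  have hd := delta_pos ht hγ0 hγ1
  obtain ⟨K, hK0, hK⟩ := exists_exp_neg_mul_sq_le (c := t ^ 2 / 2) (by positivity)
  have hγ' : 0 < 1 - γ := by linarith
  refine ⟨(4 / (1 - γ) / 2 + 1) * K, by positivity, fun x v hv => ?_⟩
  have hv' : |v| ≤ 7 / 5 * delta t γ := by linarith
  have him : ((x : ℂ) + I * v).im = v := by simp
  have hlt := norm_gaussianTerm_lt_one ht hγ0 hγ1 (z := x + I * v) (by rwa [him])
  set q := gaussianTerm t γ (x + I * v) with hq
  have hqn : ‖q‖ ≤ Real.exp (-(t ^ 2 / 2 * x ^ 2)) := by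
    rw [hq, norm_gaussianTerm hγ0]
    exact mul_le_of_le_one_left (Real.exp_pos _).le (gamma_mul_exp_lt_one ht hγ0 hγ1 hv').le
  have hinv : (1 - ‖q‖)⁻¹ ≤ 4 / (1 - γ) := by
    refine le_trans ?_ (inv_one_sub_gamma_mul_exp_le ht hγ0 hγ1 hv)
    refine inv_anti₀ (by linarith [gamma_mul_exp_lt_one ht hγ0 hγ1 hv']) ?_
    have : ‖q‖ ≤ γ * Real.exp (t ^ 2 * v ^ 2 / 2) := by
      rw [hq, norm_gaussianTerm hγ0]
      exact mul_le_of_le_one_right (by positivity)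
        (Real.exp_le_one_iff.2 (by nlinarith [mul_nonneg (sq_nonneg t) (sq_nonneg x)]))
    linarith
  have e : h t γ (x + I * v) = -Complex.log (1 + -q) := by
    rw [← sub_eq_add_neg]; rfl
  have h1 := Complex.norm_log_one_add_le (z := -q) (by rwa [norm_neg])
  rw [norm_neg] at h1
  rw [e, norm_neg]
  refine h1.trans ?_
  have h2 : ‖q‖ ^ 2 * (1 - ‖q‖)⁻¹ / 2 ≤ ‖q‖ * (4 / (1 - γ)) / 2 := by
    have h3 : ‖q‖ ^ 2 ≤ ‖q‖ := by nlinarith [norm_nonneg q]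
    have h4 : 0 ≤ (1 - ‖q‖)⁻¹ := inv_nonneg.2 (by linarith)
    have := mul_le_mul h3 hinv h4 (norm_nonneg q)
    linarith
  calc _ ≤ (4 / (1 - γ) / 2 + 1) * ‖q‖ := by linarith
    _ ≤ (4 / (1 - γ) / 2 + 1) * (K * (1 + x ^ 2)⁻¹ ^ 2) :=
        mul_le_mul_of_nonneg_left (hqn.trans (hK x)) (by positivity)
    _ = _ := by ring

lemma h_neg (z : ℂ) : h t γ (-z) = h t γ z := by
  rw [h, h, neg_sq]

/-- On the real line `h` is real and nonnegative. -/
lemma h_ofReal (hγ0 : 0 < γ) (hγ1 : γ < 1) (s : ℝ) : ∃ a : ℝ, 0 ≤ a ∧ h t γ s = a := by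
  have h1 : γ * Real.exp (-(t ^ 2 * s ^ 2) / 2) ≤ γ :=
    mul_le_of_le_one_right hγ0.le
      (Real.exp_le_one_iff.2 (by nlinarith [mul_nonneg (sq_nonneg t) (sq_nonneg s)]))
  have h2 : 0 < γ * Real.exp (-(t ^ 2 * s ^ 2) / 2) := by positivity
  refine ⟨-Real.log (1 - γ * Real.exp (-(t ^ 2 * s ^ 2) / 2)), ?_, ?_⟩
  · linarith [Real.log_nonpos (x := 1 - γ * Real.exp (-(t ^ 2 * s ^ 2) / 2)) (by linarith)
      (by linarith)]
  · rw [h, Complex.ofReal_neg, Complex.ofReal_log (by linarith)]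
    push_cast
    rfl

end

/-! ### Principal values -/

/-- The difference between the truncated kernel `1_{|v| > 1} / v` and the kernel `v / (v² + 1)`
of the mean of the two one-sided Cauchy integrals. -/
noncomputable def truncationKernel (v : ℝ) : ℝ :=
  Set.indicator {v : ℝ | 1 < |v|} (fun v => v⁻¹) v - v / (v ^ 2 + 1)

lemma abs_truncationKernel_le (v : ℝ) : |truncationKernel v| ≤ (1 + v ^ 2)⁻¹ := by
  rw [truncationKernel]
  by_cases hv : 1 < |v|
  · rw [Set.indicator_of_mem (by exact hv)]
    have hv0 : v ≠ 0 := by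
      rintro rfl
      simp at hv
      linarith
    have e : v⁻¹ - v / (v ^ 2 + 1) = v⁻¹ * (1 + v ^ 2)⁻¹ := by
      field_simp
      ring
    rw [e, abs_mul, abs_inv, abs_of_pos (by positivity : 0 < (1 + v ^ 2)⁻¹)]
    exact mul_le_of_le_one_left (by positivity) (inv_le_one_of_one_le₀ hv.le)
  · rw [Set.indicator_of_notMem (by exact hv), zero_sub, abs_neg, abs_div,
      abs_of_pos (by positivity : 0 < v ^ 2 + 1), add_comm, div_eq_mul_inv]
    exact mul_le_of_le_one_left (by positivity) (not_lt.1 hv)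

lemma measurable_truncationKernel : Measurable truncationKernel := by
  refine Measurable.sub (Measurable.indicator (by fun_prop) ?_) (by fun_prop)
  exact measurableSet_lt measurable_const (by fun_prop)

lemma integral_truncationKernel : ∫ v : ℝ, truncationKernel v = 0 := by
  have h1 := integral_neg_eq_self truncationKernel volume
  have h2 : ∀ v, truncationKernel (-v) = -truncationKernel v := by
    intro v
    have e : Set.indicator {v : ℝ | 1 < |v|} (fun v => v⁻¹) (-v) =
        -Set.indicator {v : ℝ | 1 < |v|} (fun v => v⁻¹) v := by
      have hiff : -v ∈ {v : ℝ | 1 < |v|} ↔ v ∈ {v : ℝ | 1 < |v|} := by simp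
      by_cases hv : v ∈ {v : ℝ | 1 < |v|}
      · rw [Set.indicator_of_mem hv, Set.indicator_of_mem (hiff.2 hv), inv_neg]
      · rw [Set.indicator_of_notMem hv, Set.indicator_of_notMem (fun hx => hv (hiff.1 hx)),
          neg_zero]
    rw [truncationKernel, truncationKernel, e, neg_sq]
    ring
  simp only [h2, integral_neg] at h1
  linarith

lemma integrable_sub_inv {g : ℝ → ℂ} (hg : Integrable g) (x : ℝ) {r : ℝ} (hr : 0 < r) :
    Integrable fun s : ℝ => Set.indicator {s : ℝ | r < |s - x|} (fun s => g s / ((s : ℂ) - x)) s := by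
  have hms : MeasurableSet {s : ℝ | r < |s - x|} :=
    measurableSet_lt measurable_const (by fun_prop)
  have hm : Measurable fun s : ℝ => ((s : ℂ) - x)⁻¹ := by fun_prop
  refine Integrable.mono' (hg.norm.div_const r) ?_ (Eventually.of_forall fun s => ?_)
  · refine AEStronglyMeasurable.indicator ?_ hms
    exact (hg.1.mul hm.aestronglyMeasurable).congr
      (Eventually.of_forall fun s => (div_eq_mul_inv _ _).symm)
  · by_cases hs : r < |s - x|
    · rw [Set.indicator_of_mem (by exact hs), norm_div]
      refine div_le_div_of_nonneg_left (norm_nonneg _) hr ?_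
      rw [← Complex.ofReal_sub, Complex.norm_real]
      exact hs.le
    · rw [Set.indicator_of_notMem (by exact hs), norm_zero]
      positivity

/-- The principal value is the limit of the mean of the Cauchy integrals at `x + i r` and `x - i r`,
as the two differ by the convolution with an odd integrable kernel at scale `r`. -/
lemma pvCauchy_eq {g : ℝ → ℂ} (hg : Integrable g) (hc : Continuous g) {M : ℝ}
    (hM : ∀ x, ‖g x‖ ≤ M) (x : ℝ) {l : ℂ}
    (hl : Tendsto (fun r : ℝ => (cauchyLine g 0 (x + I * r) + cauchyLine g 0 (x - I * r)) / 2)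
      (𝓝[>] 0) (𝓝 l)) : pvCauchy g x = l := by
  refine Tendsto.limUnder_eq ?_
  have hms : ∀ r : ℝ, MeasurableSet {s : ℝ | r < |s - x|} := fun r =>
    measurableSet_lt measurable_const (by fun_prop)
  have hdiff : ∀ r : ℝ, 0 < r → (∫ s in {s : ℝ | r < |s - x|}, g s / ((s : ℂ) - (x : ℂ))) -
      (cauchyLine g 0 (x + I * r) + cauchyLine g 0 (x - I * r)) / 2 =
      ∫ v : ℝ, g (x + r * v) * (truncationKernel v : ℂ) := by
    intro r hr
    have i1 : Integrable fun s : ℝ => g s / (s + I * (0 : ℝ) - (x + I * r)) :=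
      integrable_div_line hg (by simp [hr.ne'])
    have i2 : Integrable fun s : ℝ => g s / (s + I * (0 : ℝ) - (x - I * r)) :=
      integrable_div_line hg (by simp [hr.ne'])
    have i3 : Integrable fun s : ℝ => (g s / (s + I * (0 : ℝ) - (x + I * r)) +
        g s / (s + I * (0 : ℝ) - (x - I * r))) / 2 := (i1.add i2).div_const 2
    rw [cauchyLine, cauchyLine, ← integral_add i1 i2, ← integral_div,
      ← integral_indicator (hms r), ← integral_sub (integrable_sub_inv hg x hr) i3]
    have h1 := integral_add_left_eq_self (μ := volume) (fun s : ℝ => Set.indicator {s : ℝ | r < |s - x|}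
      (fun s => g s / ((s : ℂ) - x)) s - (g s / (s + I * (0 : ℝ) - (x + I * r)) +
        g s / (s + I * (0 : ℝ) - (x - I * r))) / 2) x
    rw [← h1]
    have h2 := Measure.integral_comp_mul_left (fun u : ℝ => Set.indicator {s : ℝ | r < |s - x|}
      (fun s => g s / ((s : ℂ) - x)) (x + u) - (g (x + u) / ((x + u : ℝ) + I * (0 : ℝ) - (x + I * r)) +
        g (x + u) / ((x + u : ℝ) + I * (0 : ℝ) - (x - I * r))) / 2) r
    rw [abs_of_pos (inv_pos.2 hr)] at h2
    have h3 : ∀ J K : ℂ, J = r⁻¹ • K → K = r * J := by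
      rintro J K rfl
      rw [Complex.real_smul, Complex.ofReal_inv, mul_inv_cancel_left₀
        (Complex.ofReal_ne_zero.2 hr.ne')]
    rw [h3 _ _ h2, ← integral_const_mul]
    refine integral_congr_ae (Eventually.of_forall fun v => ?_)
    simp only
    have e1 : Set.indicator {s : ℝ | r < |s - x|} (fun s => g s / ((s : ℂ) - x)) (x + r * v) =
        g (x + r * v) * (((Set.indicator {v : ℝ | 1 < |v|} (fun v => v⁻¹) v : ℝ) : ℂ) / r) := by
      have hiff : x + r * v ∈ {s : ℝ | r < |s - x|} ↔ v ∈ {v : ℝ | 1 < |v|} := by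
        simp only [Set.mem_ofPred_eq, add_sub_cancel_left, abs_mul, abs_of_pos hr]
        rw [lt_mul_iff_one_lt_right hr]
      by_cases hv : v ∈ {v : ℝ | 1 < |v|}
      · rw [Set.indicator_of_mem (hiff.2 hv), Set.indicator_of_mem hv]
        push_cast
        rw [add_sub_cancel_left, div_eq_mul_inv, mul_inv_rev, div_eq_mul_inv]
      · rw [Set.indicator_of_notMem (fun hx => hv (hiff.1 hx)), Set.indicator_of_notMem hv]
        simp
    have hrc : (r : ℂ) ≠ 0 := Complex.ofReal_ne_zero.2 hr.ne'
    have hp : ((v : ℂ) + I) ≠ 0 := by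
      intro h0
      have := congrArg Complex.im h0
      simp at this
    have hm : ((v : ℂ) - I) ≠ 0 := by
      intro h0
      have := congrArg Complex.im h0
      simp at this
    have e2 : (v : ℂ) ^ 2 + 1 = (v + I) * (v - I) := by
      linear_combination Complex.I_sq
    have e3 : ((x + r * v : ℝ) : ℂ) + I * (0 : ℝ) - (x + I * r) = r * (v - I) := by
      push_cast; ring
    have e4 : ((x + r * v : ℝ) : ℂ) + I * (0 : ℝ) - (x - I * r) = r * (v + I) := by
      push_cast; ring
    rw [e1, e3, e4, truncationKernel]
    push_cast
    rw [e2]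
    field_simp
    ring
  have hzero : Tendsto (fun r : ℝ => ∫ v : ℝ, g (x + r * v) * (truncationKernel v : ℂ))
      (𝓝[>] 0) (𝓝 0) := by
    have h0 : (0 : ℂ) = ∫ v : ℝ, g x * (truncationKernel v : ℂ) := by
      rw [integral_const_mul, integral_complex_ofReal, integral_truncationKernel]
      simp
    rw [h0]
    refine tendsto_integral_filter_of_dominated_convergence (fun v => M * (1 + v ^ 2)⁻¹)
      (Eventually.of_forall fun r => ?_) (Eventually.of_forall fun r => ?_)
      (integrable_inv_one_add_sq.const_mul M) ?_
    · have h1 : Continuous fun v : ℝ => g (x + r * v) := by fun_prop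
      have h2 : Measurable fun v : ℝ => (truncationKernel v : ℂ) :=
        Complex.measurable_ofReal.comp measurable_truncationKernel
      exact h1.aestronglyMeasurable.mul h2.aestronglyMeasurable
    · refine Eventually.of_forall fun v => ?_
      rw [norm_mul, Complex.norm_real, Real.norm_eq_abs]
      exact mul_le_mul (hM _) (abs_truncationKernel_le v) (abs_nonneg _)
        ((norm_nonneg _).trans (hM 0))
    · refine Eventually.of_forall fun v => Tendsto.mul_const _ ?_
      have h1 : Continuous fun r : ℝ => g (x + r * v) := by fun_prop
      have h2 := h1.tendsto 0
      simp only [zero_mul, add_zero] at h2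
      exact h2.mono_left nhdsWithin_le_nhds
  have := hzero.add hl
  rw [zero_add] at this
  refine this.congr' ?_
  filter_upwards [self_mem_nhdsWithin] with r hr
  rw [← hdiff r hr, sub_add_cancel]

/-! ### The off-diagonal jump entry -/

section

variable {t γ : ℝ}

/-- The Cauchy integral of `h` over the line `Im = -(6/5) δ`, which continues the one over the real
line from the upper half-plane. -/
noncomputable def lowerCauchy (t γ : ℝ) (z : ℂ) : ℂ :=
  cauchyLine (fun x => h t γ (x + I * ((-(6 / 5 * delta t γ) : ℝ) : ℂ))) (-(6 / 5 * delta t γ)) z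

/-- The Cauchy integral of `h` over the line `Im = (6/5) δ`, which continues the one over the real
line from the lower half-plane. -/
noncomputable def upperCauchy (t γ : ℝ) (z : ℂ) : ℂ :=
  cauchyLine (fun x => h t γ (x + I * ((6 / 5 * delta t γ : ℝ) : ℂ))) (6 / 5 * delta t γ) z

/-- The holomorphic continuation to a strip of the upper right entry `-i √γ e^{-t² φ}` of the jump
matrix; it has the value `-i √γ e^{-t² φ₊}` on the real line. -/
noncomputable def upperEntry (t γ : ℝ) (z : ℂ) : ℂ :=
  -I * (Real.sqrt γ : ℂ) * Complex.exp (-(t : ℂ) ^ 2 * ((z ^ 2 - 4 * I * z) / 4) -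
    1 / (I * (Real.pi : ℂ)) * lowerCauchy t γ z + h t γ z)

lemma isOpen_strip (a b : ℝ) : IsOpen {z : ℂ | a < z.im ∧ z.im < b} :=
  (isOpen_lt continuous_const Complex.continuous_im).inter
    (isOpen_lt Complex.continuous_im continuous_const)

lemma differentiableOn_h (ht : t ≠ 0) (hγ0 : 0 < γ) (hγ1 : γ < 1) :
    DifferentiableOn ℂ (h t γ) {z | -(7 / 5 * delta t γ) < z.im ∧ z.im < 7 / 5 * delta t γ} :=
  fun _ hz => (differentiableAt_h ht hγ0 hγ1 (abs_le.2 ⟨hz.1.le, hz.2.le⟩)).differentiableWithinAt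

lemma exists_norm_h_le' (ht : t ≠ 0) (hγ0 : 0 < γ) (hγ1 : γ < 1) : ∃ C, 0 ≤ C ∧ ∀ x v : ℝ,
    v ∈ Set.Icc (-(6 / 5 * delta t γ)) (6 / 5 * delta t γ) →
      ‖h t γ (x + I * v)‖ ≤ C * (1 + x ^ 2)⁻¹ := by
  obtain ⟨C, hC0, hC⟩ := exists_norm_h_le ht hγ0 hγ1
  exact ⟨C, hC0, fun x v hv => (hC x v (abs_le.2 hv)).trans
    (mul_le_mul_of_nonneg_left (sq_inv_one_add_sq_le x) hC0)⟩

lemma continuous_h_line (ht : t ≠ 0) (hγ0 : 0 < γ) (hγ1 : γ < 1) {v : ℝ}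
    (hv : v ∈ Set.Icc (-(6 / 5 * delta t γ)) (6 / 5 * delta t γ)) :
    Continuous fun x : ℝ => h t γ (x + I * v) := by
  have hd := delta_pos ht hγ0 hγ1
  rw [← continuousOn_univ]
  refine (differentiableOn_h ht hγ0 hγ1).continuousOn.comp (by fun_prop) fun x _ => ?_
  simp
  constructor <;> linarith [hv.1, hv.2]

lemma integrable_h_line (ht : t ≠ 0) (hγ0 : 0 < γ) (hγ1 : γ < 1) {v : ℝ}
    (hv : v ∈ Set.Icc (-(6 / 5 * delta t γ)) (6 / 5 * delta t γ)) :
    Integrable fun x : ℝ => h t γ (x + I * v) := by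
  obtain ⟨C, -, hC⟩ := exists_norm_h_le' ht hγ0 hγ1
  rw [← integrableOn_univ]
  exact integrableOn_of_le_inv_one_add_sq MeasurableSet.univ (C := C)
    (continuous_h_line ht hγ0 hγ1 hv).continuousOn fun x _ => hC x v hv

lemma cauchyLine_h_eq (ht : t ≠ 0) (hγ0 : 0 < γ) (hγ1 : γ < 1) {v y : ℝ}
    (hv : v ∈ Set.Icc (-(6 / 5 * delta t γ)) (6 / 5 * delta t γ))
    (hy : y ∈ Set.Icc (-(6 / 5 * delta t γ)) (6 / 5 * delta t γ)) {z : ℂ}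
    (hz : z.im ∉ Set.uIcc v y) :
    cauchyLine (fun x => h t γ (x + I * y)) y z = cauchyLine (fun x => h t γ (x + I * v)) v z := by
  obtain ⟨C, -, hC⟩ := exists_norm_h_le' ht hγ0 hγ1
  have hd := delta_pos ht hγ0 hγ1
  have hsub := Set.uIcc_subset_Icc hv hy
  refine cauchyLine_eq_of_notMem (isOpen_strip _ _) (differentiableOn_h ht hγ0 hγ1) (C := C) ?_
    (fun x w hw => hC x w (hsub hw)) hz
  intro x w hw
  have := hsub hw
  simp
  constructor <;> linarith [this.1, this.2]

lemma cauchyLine_ofReal (f : ℂ → ℂ) :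
    cauchyLine (fun x => f (x + I * ((0 : ℝ) : ℂ))) 0 = cauchyLine (fun x => f x) 0 := by
  simp

lemma lowerCauchy_eq (ht : t ≠ 0) (hγ0 : 0 < γ) (hγ1 : γ < 1) {z : ℂ} (hz : 0 < z.im) :
    cauchyLine (fun x => h t γ x) 0 z = lowerCauchy t γ z := by
  have hd := delta_pos ht hγ0 hγ1
  rw [← cauchyLine_ofReal]
  refine cauchyLine_h_eq ht hγ0 hγ1 ⟨le_rfl, by linarith⟩ ⟨by linarith, by linarith⟩ fun hm => ?_
  rw [Set.uIcc_of_le (by linarith)] at hm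
  linarith [hm.2]

lemma upperCauchy_eq (ht : t ≠ 0) (hγ0 : 0 < γ) (hγ1 : γ < 1) {z : ℂ} (hz : z.im < 0) :
    cauchyLine (fun x => h t γ x) 0 z = upperCauchy t γ z := by
  have hd := delta_pos ht hγ0 hγ1
  rw [← cauchyLine_ofReal]
  refine cauchyLine_h_eq ht hγ0 hγ1 ⟨by linarith, le_rfl⟩ ⟨by linarith, by linarith⟩ fun hm => ?_
  rw [Set.uIcc_of_ge (by linarith)] at hm
  linarith [hm.1]

/-- The Sokhotski-Plemelj formula for the jump of the Cauchy integral of `h`. -/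
lemma lowerCauchy_sub_upperCauchy (ht : t ≠ 0) (hγ0 : 0 < γ) (hγ1 : γ < 1) (x : ℝ) :
    lowerCauchy t γ x - upperCauchy t γ x = 2 * Real.pi * I * h t γ x := by
  obtain ⟨C, -, hC⟩ := exists_norm_h_le' ht hγ0 hγ1
  have hd := delta_pos ht hγ0 hγ1
  refine cauchyLine_sub_cauchyLine (isOpen_strip _ _) (differentiableOn_h ht hγ0 hγ1) (C := C) ?_
    hC ?_
  · intro x w hw
    simp
    constructor <;> linarith [hw.1, hw.2]
  · simp
    exact hd

lemma zero_mem_strip (ht : t ≠ 0) (hγ0 : 0 < γ) (hγ1 : γ < 1) :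
    (0 : ℝ) ∈ Set.Icc (-(6 / 5 * delta t γ)) (6 / 5 * delta t γ) := by
  have hd := delta_pos ht hγ0 hγ1
  constructor <;> linarith

lemma differentiableAt_lowerCauchy (ht : t ≠ 0) (hγ0 : 0 < γ) (hγ1 : γ < 1) {z : ℂ}
    (hz : -(6 / 5 * delta t γ) < z.im) : DifferentiableAt ℂ (lowerCauchy t γ) z := by
  have hd := delta_pos ht hγ0 hγ1
  exact differentiableAt_cauchyLine (integrable_h_line ht hγ0 hγ1 ⟨le_rfl, by linarith⟩) hz.ne'

lemma differentiableAt_upperCauchy (ht : t ≠ 0) (hγ0 : 0 < γ) (hγ1 : γ < 1) {z : ℂ}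
    (hz : z.im < 6 / 5 * delta t γ) : DifferentiableAt ℂ (upperCauchy t γ) z := by
  have hd := delta_pos ht hγ0 hγ1
  exact differentiableAt_cauchyLine (integrable_h_line ht hγ0 hγ1 ⟨by linarith, le_rfl⟩) hz.ne

lemma tendsto_ofReal_add (x : ℝ) :
    Tendsto (fun r : ℝ => (x : ℂ) + I * r) (𝓝[>] 0) (𝓝 (x : ℂ)) := by
  have h1 : Continuous fun r : ℝ => (x : ℂ) + I * r := by fun_prop
  have := h1.tendsto 0
  simp only [Complex.ofReal_zero, mul_zero, add_zero] at this
  exact this.mono_left nhdsWithin_le_nhds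

lemma tendsto_ofReal_sub (x : ℝ) :
    Tendsto (fun r : ℝ => (x : ℂ) - I * r) (𝓝[>] 0) (𝓝 (x : ℂ)) := by
  have h1 : Continuous fun r : ℝ => (x : ℂ) - I * r := by fun_prop
  have := h1.tendsto 0
  simp only [Complex.ofReal_zero, mul_zero, sub_zero] at this
  exact this.mono_left nhdsWithin_le_nhds

/-- The Sokhotski-Plemelj formula for the principal value. -/
lemma pvCauchy_h (ht : t ≠ 0) (hγ0 : 0 < γ) (hγ1 : γ < 1) (x : ℝ) :
    pvCauchy (fun s => h t γ s / (t : ℂ) ^ 2) x =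
      (lowerCauchy t γ x + upperCauchy t γ x) / 2 / (t : ℂ) ^ 2 := by
  have hd := delta_pos ht hγ0 hγ1
  have h0 := zero_mem_strip ht hγ0 hγ1
  have hc : Continuous fun s : ℝ => h t γ s := by
    simpa using continuous_h_line ht hγ0 hγ1 h0
  have hi : Integrable fun s : ℝ => h t γ s := by
    simpa using integrable_h_line ht hγ0 hγ1 h0
  obtain ⟨C, hC0, hC⟩ := exists_norm_h_le' ht hγ0 hγ1
  have hscale : ∀ z, cauchyLine (fun s : ℝ => h t γ s / (t : ℂ) ^ 2) 0 z =
      cauchyLine (fun s : ℝ => h t γ s) 0 z / (t : ℂ) ^ 2 := by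
    intro z
    rw [cauchyLine, cauchyLine, ← integral_div]
    refine integral_congr_ae (Eventually.of_forall fun s => ?_)
    simp only
    rw [div_right_comm]
  refine pvCauchy_eq (hi.div_const _) (hc.div_const _) (M := C / ‖(t : ℂ) ^ 2‖) ?_ x ?_
  · intro s
    rw [norm_div]
    refine div_le_div_of_nonneg_right ?_ (norm_nonneg _)
    have h1 := hC s 0 h0
    simp only [Complex.ofReal_zero, mul_zero, add_zero] at h1
    refine h1.trans (mul_le_of_le_one_right hC0 ?_)
    exact inv_le_one_of_one_le₀ (by nlinarith [sq_nonneg s])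
  · have l1 : Tendsto (fun r : ℝ => lowerCauchy t γ (x + I * r)) (𝓝[>] 0)
        (𝓝 (lowerCauchy t γ x)) :=
      (differentiableAt_lowerCauchy ht hγ0 hγ1 (z := x) (by simp; linarith)).continuousAt.tendsto.comp
        (tendsto_ofReal_add x)
    have l2 : Tendsto (fun r : ℝ => upperCauchy t γ (x - I * r)) (𝓝[>] 0)
        (𝓝 (upperCauchy t γ x)) :=
      (differentiableAt_upperCauchy ht hγ0 hγ1 (z := x) (by simp; linarith)).continuousAt.tendsto.comp
        (tendsto_ofReal_sub x)
    refine (((l1.add l2).div_const 2).div_const ((t : ℂ) ^ 2)).congr' ?_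
    filter_upwards [self_mem_nhdsWithin] with r hr
    have hr' : 0 < r := hr
    rw [hscale, hscale, lowerCauchy_eq ht hγ0 hγ1 (by simpa using hr'),
      upperCauchy_eq ht hγ0 hγ1 (by simpa using hr')]
    ring

lemma sqrt_mul_entry_of_pos (ht : t ≠ 0) (hγ0 : 0 < γ) (hγ1 : γ < 1) {z : ℂ} (hz : 0 < z.im) :
    -I * (Real.sqrt γ : ℂ) * Complex.exp (-(t : ℂ) ^ 2 * phase t γ z) = upperEntry t γ z := by
  have htc : (t : ℂ) ≠ 0 := Complex.ofReal_ne_zero.2 ht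
  rw [upperEntry, phase, Real.sign_of_pos hz, ← lowerCauchy_eq ht hγ0 hγ1 hz]
  have e : ∫ s : ℝ, h t γ s / ((t : ℂ) ^ 2 * (s - z)) =
      cauchyLine (fun x => h t γ x) 0 z / (t : ℂ) ^ 2 := by
    rw [cauchyLine, ← integral_div]
    refine integral_congr_ae (Eventually.of_forall fun s => ?_)
    simp only [Complex.ofReal_zero, mul_zero, add_zero]
    rw [div_div, mul_comm]
  rw [e]
  congr 2
  push_cast
  field_simp
  ring

lemma phase_neg (z : ℂ) : phase t γ (-z) = phase t γ z := by
  have e : ∫ s : ℝ, h t γ s / ((t : ℂ) ^ 2 * (s - -z)) =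
      -∫ s : ℝ, h t γ s / ((t : ℂ) ^ 2 * (s - z)) := by
    rw [← integral_neg_eq_self, ← integral_neg]
    refine integral_congr_ae (Eventually.of_forall fun s => ?_)
    simp only [Complex.ofReal_neg]
    rw [h_neg, ← div_neg]
    congr 1
    ring
  rw [phase, phase, e, h_neg, Complex.neg_im, Real.sign_neg, neg_sq]
  push_cast
  ring

lemma sqrt_mul_entry_of_neg (ht : t ≠ 0) (hγ0 : 0 < γ) (hγ1 : γ < 1) {z : ℂ} (hz : z.im < 0) :
    -I * (Real.sqrt γ : ℂ) * Complex.exp (-(t : ℂ) ^ 2 * phase t γ z) = upperEntry t γ (-z) := by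
  rw [← phase_neg, sqrt_mul_entry_of_pos ht hγ0 hγ1 (by simpa using hz)]

lemma phaseReal_one (ht : t ≠ 0) (hγ0 : 0 < γ) (hγ1 : γ < 1) (x : ℝ) :
    -I * (Real.sqrt γ : ℂ) * Complex.exp (-(t : ℂ) ^ 2 * phaseReal t γ 1 x) =
      upperEntry t γ x := by
  have htc : (t : ℂ) ≠ 0 := Complex.ofReal_ne_zero.2 ht
  have hpi : (Real.pi : ℂ) ≠ 0 := Complex.ofReal_ne_zero.2 Real.pi_ne_zero
  have hI := Complex.I_ne_zero
  have e1 := lowerCauchy_sub_upperCauchy ht hγ0 hγ1 x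
  have e2 : h t γ x = (lowerCauchy t γ x - upperCauchy t γ x) / (2 * Real.pi * I) := by
    rw [e1]
    field_simp
  rw [upperEntry, phaseReal, pvCauchy_h ht hγ0 hγ1, e2]
  congr 2
  push_cast
  field_simp
  ring

lemma lowerCauchy_neg (x : ℂ) : lowerCauchy t γ (-x) = -upperCauchy t γ x := by
  rw [lowerCauchy, upperCauchy, cauchyLine, cauchyLine, ← integral_neg_eq_self, ← integral_neg]
  refine integral_congr_ae (Eventually.of_forall fun s => ?_)
  simp only [Complex.ofReal_neg]
  rw [← h_neg, ← div_neg]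
  congr 2 <;> ring

lemma phaseReal_neg_one (ht : t ≠ 0) (hγ0 : 0 < γ) (hγ1 : γ < 1) (x : ℝ) :
    -I * (Real.sqrt γ : ℂ) * Complex.exp (-(t : ℂ) ^ 2 * phaseReal t γ (-1) x) =
      upperEntry t γ (-x) := by
  have htc : (t : ℂ) ≠ 0 := Complex.ofReal_ne_zero.2 ht
  have hpi : (Real.pi : ℂ) ≠ 0 := Complex.ofReal_ne_zero.2 Real.pi_ne_zero
  have hI := Complex.I_ne_zero
  have e1 := lowerCauchy_sub_upperCauchy ht hγ0 hγ1 x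
  have e2 : h t γ x = (lowerCauchy t γ x - upperCauchy t γ x) / (2 * Real.pi * I) := by
    rw [e1]
    field_simp
  rw [upperEntry, phaseReal, pvCauchy_h ht hγ0 hγ1, lowerCauchy_neg, h_neg, e2]
  congr 2
  push_cast
  field_simp
  ring

/-- The two off-diagonal entries on the real line determine the lower right entry, so that the jump
matrix there is the product of a lower and an upper triangular matrix. -/
lemma upperEntry_mul_upperEntry_neg (ht : t ≠ 0) (hγ0 : 0 < γ) (hγ1 : γ < 1) (x : ℝ) :
    upperEntry t γ x * upperEntry t γ (-x) =
      -((γ : ℂ) * Complex.exp (-((t : ℂ) ^ 2 * (x : ℂ) ^ 2) / 2)) := by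
  rw [← phaseReal_one ht hγ0 hγ1, ← phaseReal_neg_one ht hγ0 hγ1]
  have e1 : (Real.sqrt γ : ℂ) * Real.sqrt γ = γ := by
    rw [← Complex.ofReal_mul, Real.mul_self_sqrt hγ0.le]
  have e2 : Complex.exp (-(t : ℂ) ^ 2 * phaseReal t γ 1 x) *
      Complex.exp (-(t : ℂ) ^ 2 * phaseReal t γ (-1) x) =
      Complex.exp (-((t : ℂ) ^ 2 * (x : ℂ) ^ 2) / 2) := by
    rw [← Complex.exp_add, phaseReal, phaseReal]
    congr 1
    push_cast
    ring
  calc _ = I ^ 2 * ((Real.sqrt γ : ℂ) * Real.sqrt γ) *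
        (Complex.exp (-(t : ℂ) ^ 2 * phaseReal t γ 1 x) *
      Complex.exp (-(t : ℂ) ^ 2 * phaseReal t γ (-1) x)) := by ring
    _ = _ := by rw [e1, e2, Complex.I_sq]; ring

end

/-! ### Bounds for the jump entry -/

section

variable {t γ : ℝ}

lemma differentiableOn_upperEntry (ht : t ≠ 0) (hγ0 : 0 < γ) (hγ1 : γ < 1) :
    DifferentiableOn ℂ (upperEntry t γ)
      {z | -(6 / 5 * delta t γ) < z.im ∧ z.im < 7 / 5 * delta t γ} := by
  have hd := delta_pos ht hγ0 hγ1
  have h1 : DifferentiableOn ℂ (lowerCauchy t γ)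
      {z | -(6 / 5 * delta t γ) < z.im ∧ z.im < 7 / 5 * delta t γ} := fun z hz =>
    (differentiableAt_lowerCauchy ht hγ0 hγ1 hz.1).differentiableWithinAt
  have h2 : DifferentiableOn ℂ (h t γ)
      {z | -(6 / 5 * delta t γ) < z.im ∧ z.im < 7 / 5 * delta t γ} :=
    (differentiableOn_h ht hγ0 hγ1).mono fun z hz => ⟨by linarith [hz.1], hz.2⟩
  have h3 : DifferentiableOn ℂ (fun z : ℂ => -(t : ℂ) ^ 2 * ((z ^ 2 - 4 * I * z) / 4))
      {z | -(6 / 5 * delta t γ) < z.im ∧ z.im < 7 / 5 * delta t γ} := by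
    have : Differentiable ℂ (fun z : ℂ => -(t : ℂ) ^ 2 * ((z ^ 2 - 4 * I * z) / 4)) := by fun_prop
    exact this.differentiableOn
  exact (((h3.sub (h1.const_mul _)).add h2).cexp).const_mul _

lemma norm_exp_quadratic (x y : ℝ) :
    ‖Complex.exp (-(t : ℂ) ^ 2 * (((x + I * y) ^ 2 - 4 * I * (x + I * y)) / 4))‖ =
      Real.exp (t ^ 2 * y ^ 2 / 4) * Real.exp (-(t ^ 2 / 4 * x ^ 2 + t ^ 2 * y)) := by
  rw [Complex.norm_exp, ← Real.exp_add]
  congr 1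
  have e : (-(t : ℂ) ^ 2 * (((x + I * y) ^ 2 - 4 * I * (x + I * y)) / 4)) =
      ((-(t ^ 2 * ((x ^ 2 - y ^ 2) / 4 + y)) : ℝ) : ℂ) +
        I * ((-(t ^ 2 * (x * y / 2 - x)) : ℝ) : ℂ) := by
    push_cast
    linear_combination (-(t : ℂ) ^ 2 * y ^ 2 / 4 + (t : ℂ) ^ 2 * y) * Complex.I_sq
  rw [e, Complex.add_re, Complex.re_mul_ofReal, Complex.ofReal_re]
  simp
  ring

lemma norm_upperEntry (x y : ℝ) : ‖upperEntry t γ (x + I * y)‖ =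
    Real.sqrt γ * (Real.exp (t ^ 2 * y ^ 2 / 4) * Real.exp (-(t ^ 2 / 4 * x ^ 2 + t ^ 2 * y))) *
      ‖Complex.exp (-(1 / (I * (Real.pi : ℂ)) * lowerCauchy t γ (x + I * y)))‖ *
      ‖Complex.exp (h t γ (x + I * y))‖ := by
  rw [upperEntry, sub_eq_add_neg, Complex.exp_add, Complex.exp_add, norm_mul, norm_mul, norm_mul,
    norm_mul, norm_exp_quadratic, Complex.norm_real, Real.norm_eq_abs,
    abs_of_nonneg (Real.sqrt_nonneg _), norm_neg, Complex.norm_I]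
  ring

lemma sqrt_mul_exp_le_one (ht : t ≠ 0) (hγ0 : 0 < γ) (hγ1 : γ < 1) {y : ℝ}
    (hy : |y| ≤ 6 / 5 * delta t γ) : Real.sqrt γ * Real.exp (t ^ 2 * y ^ 2 / 4) ≤ 1 := by
  have hd := delta_pos ht hγ0 hγ1
  have h1 := gamma_mul_exp_lt_one ht hγ0 hγ1 (y := y) (by linarith)
  have e : γ * Real.exp (t ^ 2 * y ^ 2 / 2) =
      (Real.sqrt γ * Real.exp (t ^ 2 * y ^ 2 / 4)) ^ 2 := by
    rw [mul_pow, Real.sq_sqrt hγ0.le, ← Real.exp_nat_mul]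
    congr 2
    push_cast
    ring
  rw [e] at h1
  have h2 : 0 ≤ Real.sqrt γ * Real.exp (t ^ 2 * y ^ 2 / 4) := by positivity
  nlinarith

/-- Positivity of the Poisson integral of `h ≥ 0` bounds the Cauchy integral in the exponent of the
jump entry. -/
lemma norm_exp_lowerCauchy_le_one (ht : t ≠ 0) (hγ0 : 0 < γ) (hγ1 : γ < 1) {z : ℂ}
    (hz : 0 < z.im) :
    ‖Complex.exp (-(1 / (I * (Real.pi : ℂ)) * lowerCauchy t γ z))‖ ≤ 1 := by
  rw [Complex.norm_exp, Real.exp_le_one_iff, ← lowerCauchy_eq ht hγ0 hγ1 hz]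
  have hi : Integrable fun s : ℝ => h t γ s := by
    simpa using integrable_h_line ht hγ0 hγ1 (zero_mem_strip ht hγ0 hγ1)
  have him : 0 ≤ (cauchyLine (fun x => h t γ x) 0 z).im := by
    have e : (cauchyLine (fun x => h t γ x) 0 z).im =
        ∫ s : ℝ, (h t γ s / (s + I * ((0 : ℝ) : ℂ) - z)).im :=
      (Complex.imCLM.integral_comp_comm (integrable_div_line hi hz.ne')).symm
    rw [e]
    refine integral_nonneg fun s => ?_
    obtain ⟨a, ha0, ha⟩ := h_ofReal (t := t) hγ0 hγ1 s
    simp only [ha, Complex.ofReal_zero, mul_zero, add_zero, Pi.zero_apply]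
    rw [div_eq_mul_inv, Complex.im_ofReal_mul, Complex.inv_im]
    refine mul_nonneg ha0 (div_nonneg ?_ (Complex.normSq_nonneg _))
    simp
    exact hz.le
  set c := cauchyLine (fun x => h t γ x) 0 z
  have e : -(1 / (I * (Real.pi : ℂ)) * c) = ((Real.pi⁻¹ : ℝ) : ℂ) * (I * c) := by
    have hpi : (Real.pi : ℂ) ≠ 0 := Complex.ofReal_ne_zero.2 Real.pi_ne_zero
    have hI := Complex.I_ne_zero
    push_cast
    field_simp
    linear_combination (-c) * Complex.I_sq
  rw [e, Complex.re_ofReal_mul, Complex.I_mul_re, mul_neg, neg_nonpos]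
  exact mul_nonneg (inv_nonneg.2 Real.pi_pos.le) him

lemma norm_upperEntry_le_of_pos (ht : t ≠ 0) (hγ0 : 0 < γ) (hγ1 : γ < 1) (x : ℝ) {y : ℝ}
    (hy0 : 0 < y) (hy : y ≤ 6 / 5 * delta t γ) : ‖upperEntry t γ (x + I * y)‖ ≤
      4 / (1 - γ) * Real.exp (-(t ^ 2 / 4 * x ^ 2 + t ^ 2 * y)) := by
  have him : ((x : ℂ) + I * y).im = y := by simp
  have hy' : |y| ≤ 6 / 5 * delta t γ := by rwa [abs_of_pos hy0]
  have h1 := sqrt_mul_exp_le_one ht hγ0 hγ1 hy'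
  have h2 := norm_exp_lowerCauchy_le_one ht hγ0 hγ1 (z := x + I * y) (by rwa [him])
  have h3 := norm_exp_h_le ht hγ0 hγ1 (z := x + I * y) (by rwa [him])
  rw [norm_upperEntry, ← mul_assoc (Real.sqrt γ)]
  set E := Real.exp (-(t ^ 2 / 4 * x ^ 2 + t ^ 2 * y))
  have hE : 0 < E := Real.exp_pos _
  calc _ ≤ 1 * E * 1 * (4 / (1 - γ)) := by gcongr
    _ = _ := by ring

lemma norm_upperEntry_le (ht : t ≠ 0) (hγ0 : 0 < γ) (hγ1 : γ < 1) (x : ℝ) {y : ℝ}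
    (hy0 : 0 ≤ y) (hy : y ≤ 6 / 5 * delta t γ) : ‖upperEntry t γ (x + I * y)‖ ≤
      4 / (1 - γ) * Real.exp (-(t ^ 2 / 4 * x ^ 2 + t ^ 2 * y)) := by
  rcases hy0.eq_or_lt with rfl | hy0
  · have hd := delta_pos ht hγ0 hγ1
    have hc : ContinuousAt (upperEntry t γ) (x : ℂ) := by
      refine (differentiableOn_upperEntry ht hγ0 hγ1).continuousOn.continuousAt
        ((isOpen_strip _ _).mem_nhds ?_)
      simp
      exact hd
    have l1 := (hc.tendsto.comp (tendsto_ofReal_add x)).norm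
    have l2 : Tendsto (fun y : ℝ => 4 / (1 - γ) * Real.exp (-(t ^ 2 / 4 * x ^ 2 + t ^ 2 * y)))
        (𝓝[>] 0) (𝓝 (4 / (1 - γ) * Real.exp (-(t ^ 2 / 4 * x ^ 2 + t ^ 2 * 0)))) := by
      have : Continuous fun y : ℝ =>
        4 / (1 - γ) * Real.exp (-(t ^ 2 / 4 * x ^ 2 + t ^ 2 * y)) := by fun_prop
      exact (this.tendsto 0).mono_left nhdsWithin_le_nhds
    have := le_of_tendsto_of_tendsto l1 l2 ?_
    · simpa using this
    · filter_upwards [Ioo_mem_nhdsGT (show (0 : ℝ) < 6 / 5 * delta t γ by linarith)] with y hy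
      exact norm_upperEntry_le_of_pos ht hγ0 hγ1 x hy.1 hy.2.le
  · exact norm_upperEntry_le_of_pos ht hγ0 hγ1 x hy0 hy

lemma isStripDatum_upperEntry (ht : t ≠ 0) (hγ0 : 0 < γ) (hγ1 : γ < 1) :
    IsStripDatum (upperEntry t γ) (delta t γ) (6 / 5 * delta t γ) where
  d_pos := delta_pos ht hγ0 hγ1
  d_lt := by linarith [delta_pos ht hγ0 hγ1]
  diff := ⟨7 / 5 * delta t γ, by linarith [delta_pos ht hγ0 hγ1],
    differentiableOn_upperEntry ht hγ0 hγ1⟩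
  bound := by
    have hd := delta_pos ht hγ0 hγ1
    have hγ' : 0 < 1 - γ := by linarith
    obtain ⟨K, hK0, hK⟩ := exists_exp_neg_mul_sq_le (c := t ^ 2 / 4) (by positivity)
    set J := ∫ x : ℝ, ‖h t γ (x + I * ((-(6 / 5 * delta t γ) : ℝ) : ℂ))‖
    set P := Real.exp (1 / Real.pi * (J / (6 / 5 * delta t γ - delta t γ)))
    refine ⟨Real.exp (t ^ 2 * delta t γ) * P * (4 / (1 - γ)) * K, fun x v hv => ?_⟩
    have him : ((x : ℂ) + I * v).im = v := by simp
    have hv' : |v| ≤ 6 / 5 * delta t γ := abs_le.2 ⟨by linarith [hv.1], hv.2⟩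
    have h1 := sqrt_mul_exp_le_one ht hγ0 hγ1 hv'
    have h3 := norm_exp_h_le ht hγ0 hγ1 (z := x + I * v) (by rwa [him])
    have h2 : ‖Complex.exp (-(1 / (I * (Real.pi : ℂ)) * lowerCauchy t γ (x + I * v)))‖ ≤ P := by
      refine (Complex.norm_exp_le_exp_norm _).trans (Real.exp_le_exp.2 ?_)
      rw [norm_neg, norm_mul, norm_div, norm_one, norm_mul, Complex.norm_I, one_mul,
        Complex.norm_real, Real.norm_eq_abs, abs_of_pos Real.pi_pos]
      refine mul_le_mul_of_nonneg_left ?_ (by positivity)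
      refine norm_cauchyLine_le (integrable_h_line ht hγ0 hγ1 ⟨le_rfl, by linarith⟩)
        (by linarith) ?_
      rw [him, abs_of_neg (by linarith [hv.1])]
      linarith [hv.1]
    have h4 : Real.exp (-(t ^ 2 / 4 * x ^ 2 + t ^ 2 * v)) ≤
        Real.exp (t ^ 2 * delta t γ) * (K * (1 + x ^ 2)⁻¹ ^ 2) := by
      rw [neg_add, Real.exp_add, mul_comm]
      refine mul_le_mul (Real.exp_le_exp.2 ?_) (hK x) (Real.exp_pos _).le (Real.exp_pos _).le
      nlinarith [mul_le_mul_of_nonneg_left hv.1 (sq_nonneg t)]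
    rw [norm_upperEntry, ← mul_assoc (Real.sqrt γ)]
    calc _ ≤ 1 * (Real.exp (t ^ 2 * delta t γ) * (K * (1 + x ^ 2)⁻¹ ^ 2)) * P *
          (4 / (1 - γ)) := by gcongr
      _ = _ := by ring

lemma integral_norm_upperEntry_le (ht : t ≠ 0) (hγ0 : 0 < γ) (hγ1 : γ < 1) :
    ∫ x : ℝ, ‖upperEntry t γ (x + I * ((6 / 5 * delta t γ : ℝ) : ℂ))‖ ≤
      16 / (1 - γ) / |t| * Real.exp (-(t ^ 2 * delta t γ)) := by
  have hd := delta_pos ht hγ0 hγ1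
  have hγ' : 0 < 1 - γ := by linarith
  have ht2 : 0 < t ^ 2 / 4 := by positivity
  have hint := (integrable_exp_neg_mul_sq ht2).const_mul
    (4 / (1 - γ) * Real.exp (-(t ^ 2 * delta t γ)))
  calc _ ≤ ∫ x : ℝ, 4 / (1 - γ) * Real.exp (-(t ^ 2 * delta t γ)) *
        Real.exp (-(t ^ 2 / 4) * x ^ 2) := by
        refine integral_mono (isStripDatum_upperEntry ht hγ0 hγ1).integrable_line.norm hint
          fun x => (norm_upperEntry_le ht hγ0 hγ1 x (by linarith) le_rfl).trans ?_
        rw [mul_assoc, ← Real.exp_add]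
        refine mul_le_mul_of_nonneg_left (Real.exp_le_exp.2 ?_) (by positivity)
        nlinarith [sq_nonneg t, mul_nonneg (sq_nonneg t) hd.le]
    _ = 4 / (1 - γ) * Real.exp (-(t ^ 2 * delta t γ)) * Real.sqrt (Real.pi / (t ^ 2 / 4)) := by
        rw [integral_const_mul, integral_gaussian]
    _ ≤ 4 / (1 - γ) * Real.exp (-(t ^ 2 * delta t γ)) * (4 / |t|) := by
        refine mul_le_mul_of_nonneg_left ?_ (by positivity)
        refine Real.sqrt_le_iff.2 ⟨by positivity, ?_⟩
        rw [div_pow, sq_abs, div_div_eq_mul_div]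
        exact div_le_div_of_nonneg_right (by linarith [Real.pi_lt_four]) (by positivity)
    _ = _ := by ring

end

/-! ### Geometry of the contour -/

/-- The height of the upper half of the contour, consisting of the two half-lines and the three
upper edges of the hexagon, as a function on the real line. The lower half is its image under `z ↦
-z`. -/
noncomputable def upperHeight (d x : ℝ) : ℝ := d * max 0 (min 1 (2 - |x|))

section

variable {d : ℝ}

lemma upperHeight_neg (x : ℝ) : upperHeight d (-x) = upperHeight d x := by
  rw [upperHeight, upperHeight, abs_neg]

lemma continuous_upperHeight : Continuous (upperHeight d) := by
  unfold upperHeight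
  fun_prop

lemma upperHeight_nonneg (hd : 0 ≤ d) (x : ℝ) : 0 ≤ upperHeight d x :=
  mul_nonneg hd (le_max_left _ _)

lemma upperHeight_le (hd : 0 ≤ d) (x : ℝ) : upperHeight d x ≤ d :=
  mul_le_of_le_one_right hd (max_le zero_le_one (min_le_left _ _))

lemma upperHeight_of_two_le {x : ℝ} (hx : 2 ≤ |x|) : upperHeight d x = 0 := by
  rw [upperHeight, max_eq_left ((min_le_right _ _).trans (by linarith)), mul_zero]

lemma upperHeight_of_le_one {x : ℝ} (hx : |x| ≤ 1) : upperHeight d x = d := by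
  rw [upperHeight, min_eq_left (by linarith), max_eq_right zero_le_one, mul_one]

lemma upperHeight_of_mem {x : ℝ} (h1 : 1 ≤ |x|) (h2 : |x| ≤ 2) :
    upperHeight d x = d * (2 - |x|) := by
  rw [upperHeight, min_eq_right (by linarith), max_eq_right (by linarith)]

lemma upperHeight_pos (hd : 0 < d) {x : ℝ} (hx : |x| < 2) : 0 < upperHeight d x :=
  mul_pos hd (lt_max_of_lt_right (lt_min one_pos (by linarith)))

/-- The pieces of the contour whose union is the upper half of the contour. -/
def upperPieces : Finset (Fin 8) := {0, 1, 3, 5, 7}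

lemma height_of_mem_upperPieces {j : Fin 8} (hj : j ∈ upperPieces) {x : ℝ}
    (hx : x ∈ interval j) : height d j x = upperHeight d x := by
  simp only [upperPieces, Finset.mem_insert, Finset.mem_singleton] at hj
  rcases hj with rfl | rfl | rfl | rfl | rfl <;> simp [interval, height] at hx ⊢
  · rw [upperHeight_of_two_le (by rw [abs_of_nonpos (by linarith)]; linarith)]
  · have e : |x| = -x := abs_of_nonpos (by linarith [hx.2])
    rw [upperHeight_of_mem (by rw [e]; linarith [hx.2]) (by rw [e]; linarith [hx.1]), e]
    ring
  · rw [upperHeight_of_le_one (abs_le.2 hx)]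
  · have e : |x| = x := abs_of_nonneg (by linarith [hx.1])
    rw [upperHeight_of_mem (by rw [e]; linarith [hx.1]) (by rw [e]; linarith [hx.2]), e]
  · rw [upperHeight_of_two_le (hx.trans (le_abs_self x))]

lemma exists_mem_upperPieces (x : ℝ) : ∃ j ∈ upperPieces, x ∈ interval j := by
  rcases le_total x (-2) with h1 | h1
  · exact ⟨0, by simp [upperPieces], h1⟩
  rcases le_total x (-1) with h2 | h2
  · exact ⟨1, by simp [upperPieces], h1, h2⟩
  rcases le_total x 1 with h3 | h3
  · exact ⟨3, by simp [upperPieces], h2, h3⟩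
  rcases le_total x 2 with h4 | h4
  · exact ⟨5, by simp [upperPieces], h3, h4⟩
  · exact ⟨7, by simp [upperPieces], h4⟩

lemma neg_mem_interval_rev {j : Fin 8} {x : ℝ} : -x ∈ interval j.rev ↔ x ∈ interval j := by
  fin_cases j <;> simp [interval, Fin.rev, and_comm, neg_le, le_neg]

lemma height_rev (j : Fin 8) (x : ℝ) : height d j.rev (-x) = -height d j x := by
  fin_cases j <;> norm_num [height, Fin.rev] <;> ring_nf <;> simp

lemma slope_rev (j : Fin 8) : slope d j.rev = slope d j := by
  fin_cases j <;> simp [slope, Fin.rev]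

lemma mem_upperPieces_or_rev (j : Fin 8) : j ∈ upperPieces ∨ j.rev ∈ upperPieces := by
  decide +revert

end

section

variable {t γ : ℝ}

lemma param_re (j : Fin 8) (x : ℝ) : (param t γ j x).re = x := by simp [param]

lemma param_im (j : Fin 8) (x : ℝ) : (param t γ j x).im = height (delta t γ) j x := by
  simp [param]

lemma param_rev (j : Fin 8) (x : ℝ) : param t γ j.rev (-x) = -param t γ j x := by
  rw [param, param, height_rev]
  push_cast
  ring

lemma continuous_height (d : ℝ) (j : Fin 8) : Continuous (height d j) := by
  have h1 : Continuous fun x : ℝ => fun k => (![0, d * (x + 2), -(d * (x + 2)), d, -d, d * (2 - x),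
      -(d * (2 - x)), 0] : Fin 8 → ℝ) k := by
    refine continuous_pi fun k => ?_
    fin_cases k <;> simp <;> fun_prop
  exact (continuous_pi_iff.1 h1) j

lemma continuous_param (j : Fin 8) : Continuous (param t γ j) := by
  have := continuous_height (delta t γ) j
  unfold param
  fun_prop

lemma measurableEmbedding_param (j : Fin 8) : MeasurableEmbedding (param t γ j) :=
  (continuous_param j).measurableEmbedding fun x y hxy => by
    have := congrArg Complex.re hxy
    rwa [param_re, param_re] at this

lemma measurableSet_interval (j : Fin 8) : MeasurableSet (interval j) := by
  fin_cases j <;> simp [interval]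

lemma mem_contour_iff {z : ℂ} : z ∈ contour t γ ↔
    z.im = upperHeight (delta t γ) z.re ∨ z.im = -upperHeight (delta t γ) z.re := by
  have key : ∀ w : ℂ, w.im = upperHeight (delta t γ) w.re →
      ∃ j, ∃ x ∈ interval j, param t γ j x = w := by
    intro w hw
    obtain ⟨j, hj, hx⟩ := exists_mem_upperPieces w.re
    refine ⟨j, w.re, hx, Complex.ext (param_re j _) ?_⟩
    rw [param_im, height_of_mem_upperPieces hj hx, hw]
  simp only [contour, Set.mem_iUnion, Set.mem_image]
  constructor
  · rintro ⟨j, x, hx, rfl⟩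
    rw [param_re, param_im]
    rcases mem_upperPieces_or_rev j with hj | hj
    · exact Or.inl (height_of_mem_upperPieces hj hx)
    · right
      have := height_of_mem_upperPieces (d := delta t γ) hj (neg_mem_interval_rev.2 hx)
      rw [height_rev, upperHeight_neg] at this
      linarith
  · rintro (hz | hz)
    · exact key z hz
    · obtain ⟨j, x, hx, he⟩ := key (-z) (by
        rw [Complex.neg_im, Complex.neg_re, upperHeight_neg, hz, neg_neg])
      refine ⟨j.rev, -x, neg_mem_interval_rev.2 hx, ?_⟩
      rw [param_rev, he, neg_neg]

lemma neg_mem_contour {z : ℂ} : -z ∈ contour t γ ↔ z ∈ contour t γ := by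
  rw [mem_contour_iff, mem_contour_iff, Complex.neg_im, Complex.neg_re, upperHeight_neg,
    neg_inj, neg_eq_iff_eq_neg, or_comm]

lemma lineIntegral_comp_neg (φ : ℂ → ℂ) :
    lineIntegral t γ (fun w => φ (-w)) = lineIntegral t γ φ := by
  have key : ∀ j : Fin 8, ∫ x in interval j, φ (-param t γ j x) * tangent t γ j =
      ∫ x in interval j.rev, φ (param t γ j.rev x) * tangent t γ j.rev := by
    intro j
    have hpre : interval j = Neg.neg ⁻¹' interval j.rev := by
      ext x
      exact neg_mem_interval_rev.symm
    have := (MeasureTheory.Measure.measurePreserving_neg (volume : Measure ℝ)).setIntegral_preimage_emb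
      (MeasurableEquiv.neg ℝ).measurableEmbedding
      (fun x => φ (param t γ j.rev x) * tangent t γ j.rev) (interval j.rev)
    rw [← this, ← hpre]
    refine integral_congr_ae (Eventually.of_forall fun x => ?_)
    simp only
    rw [param_rev, tangent, tangent, slope_rev]
  rw [lineIntegral, lineIntegral, Finset.sum_congr rfl fun j _ => key j]
  exact Equiv.sum_comp Fin.revPerm fun j => ∫ x in interval j, φ (param t γ j x) * tangent t γ j

lemma ae_arcLength_iff {p : ℂ → Prop} : (∀ᵐ z ∂(arcLength t γ), p z) ↔
    ∀ j, ∀ᵐ x ∂(volume.restrict (interval j)), p (param t γ j x) := by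
  have hne : ∀ j, ENNReal.ofReal ‖tangent t γ j‖ ≠ 0 := by
    intro j
    rw [Ne, ENNReal.ofReal_eq_zero, not_le, norm_pos_iff]
    intro h0
    have := congrArg Complex.re h0
    simp [tangent] at this
  rw [arcLength, ae_finsetSum_measure_iff]
  simp only [Finset.mem_univ, true_imp_iff]
  refine forall_congr' fun j => ?_
  rw [Measure.ae_ennreal_smul_measure_iff (hne j), (measurableEmbedding_param j).ae_map_iff]

lemma memLp_arcLength_iff {g : ℂ → ℂ} : MemLp g 2 (arcLength t γ) ↔
    ∀ j, MemLp (fun x => g (param t γ j x)) 2 (volume.restrict (interval j)) := by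
  have hne : ∀ j, ENNReal.ofReal ‖tangent t γ j‖ ≠ 0 := by
    intro j
    rw [Ne, ENNReal.ofReal_eq_zero, not_le, norm_pos_iff]
    intro h0
    have := congrArg Complex.re h0
    simp [tangent] at this
  have hm : AEStronglyMeasurable g (arcLength t γ) ↔ ∀ j, AEStronglyMeasurable
      (fun x => g (param t γ j x)) (volume.restrict (interval j)) := by
    rw [arcLength, ← Measure.sum_fintype, aestronglyMeasurable_sum_measure_iff]
    refine forall_congr' fun j => ?_
    rw [aestronglyMeasurable_iff_aemeasurable, aemeasurable_smul_measure_iff (hne j),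
      (measurableEmbedding_param j).aemeasurable_map_iff, aestronglyMeasurable_iff_aemeasurable]
    rfl
  have hi : ∀ j, Integrable (fun z => ‖g z‖ ^ 2)
      (ENNReal.ofReal ‖tangent t γ j‖ • Measure.map (param t γ j) (volume.restrict (interval j))) ↔
      Integrable (fun x => ‖g (param t γ j x)‖ ^ 2) (volume.restrict (interval j)) := by
    intro j
    rw [integrable_smul_measure (hne j) ENNReal.ofReal_ne_top,
      (measurableEmbedding_param j).integrable_map_iff]
    rfl
  constructor
  · intro hg j
    rw [memLp_two_iff_integrable_sq_norm (hm.1 hg.1 j), ← hi]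
    have := (memLp_two_iff_integrable_sq_norm hg.1).1 hg
    rw [arcLength, integrable_finsetSum_measure] at this
    exact this j (Finset.mem_univ j)
  · intro hg
    have hgm := hm.2 fun j => (hg j).1
    rw [memLp_two_iff_integrable_sq_norm hgm, arcLength, integrable_finsetSum_measure]
    intro j _
    rw [hi, ← memLp_two_iff_integrable_sq_norm (hg j).1]
    exact hg j

end

/-! ### Deformation of the upper half of the contour to a line -/

section

variable {t γ : ℝ}

lemma ae_abs_ne (j : Fin 8) (a : ℝ) : ∀ᵐ x ∂(volume.restrict (interval j)), |x| ≠ a := by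
  refine ae_restrict_of_ae ?_
  have h1 : ∀ᵐ x : ℝ, x ∉ ({a, -a} : Set ℝ) :=
    (Set.toFinite _).countable.ae_notMem volume
  filter_upwards [h1] with x hx h0
  apply hx
  rcases abs_choice x with h2 | h2
  · left; rw [← h0, h2]
  · right; rw [Set.mem_singleton_iff, ← h0, h2, neg_neg]

lemma param_im_of_mem {j : Fin 8} (hj : j ∈ upperPieces) {x : ℝ} (hx : x ∈ interval j) :
    (param t γ j x).im = upperHeight (delta t γ) x := by
  rw [param_im, height_of_mem_upperPieces hj hx]

lemma param_im_of_notMem {j : Fin 8} (hj : j ∉ upperPieces) {x : ℝ} (hx : x ∈ interval j) :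
    (param t γ j x).im = -upperHeight (delta t γ) x := by
  have := height_of_mem_upperPieces (d := delta t γ) ((mem_upperPieces_or_rev j).resolve_left hj)
    (neg_mem_interval_rev.2 hx)
  rw [height_rev, upperHeight_neg] at this
  rw [param_im]
  linarith

lemma abs_le_two_of_notMem {j : Fin 8} (hj : j ∉ upperPieces) {x : ℝ} (hx : x ∈ interval j) :
    |x| ≤ 2 := by
  rw [abs_le]
  fin_cases j <;> simp [upperPieces, interval] at hj hx ⊢ <;> constructor <;> linarith [hx.1, hx.2]

/-- Almost everywhere on the pieces that belong to the lower half only, the imaginary part is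
negative. -/
lemma ae_param_im_neg (hd : 0 < delta t γ) {j : Fin 8} (hj : j ∉ upperPieces) :
    ∀ᵐ x ∂(volume.restrict (interval j)), (param t γ j x).im < 0 := by
  filter_upwards [ae_restrict_mem (measurableSet_interval j), ae_abs_ne j 2] with x hx h2
  rw [param_im_of_notMem hj hx, neg_lt_zero]
  exact upperHeight_pos hd (lt_of_le_of_ne (abs_le_two_of_notMem hj hx) h2)

lemma segment_mem_Icc {a b s y σ : ℝ} (hs : s ∈ Set.Icc a b) (hy : y ∈ Set.Icc a b)
    (hσ : σ ∈ Set.Icc (0 : ℝ) 1) : s + σ * (y - s) ∈ Set.Icc a b := by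
  have := (convex_Icc a b) hs hy (sub_nonneg.2 hσ.2) hσ.1 (by ring)
  simp only [smul_eq_mul] at this
  convert this using 1
  ring

lemma integrable_of_bound {F : ℂ → ℂ} {U : Set ℂ} (hF : DifferentiableOn ℂ F U) {s C : ℝ}
    (hsub : ∀ x : ℝ, (x : ℂ) + I * s ∈ U)
    (hb : ∀ x : ℝ, ‖F (x + I * s)‖ ≤ C * (1 + x ^ 2)⁻¹) :
    Integrable fun x : ℝ => F (x + I * s) := by
  rw [← integrableOn_univ]
  exact integrableOn_of_le_inv_one_add_sq MeasurableSet.univ (C := C)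
    (hF.continuousOn.comp (by fun_prop) fun x _ => hsub x) fun x _ => hb x

lemma sum_upperPieces_eq_integral_line {U : Set ℂ} {F : ℂ → ℂ} {s C : ℝ} (hU : IsOpen U)
    (hF : DifferentiableOn ℂ F U)
    (hsub : ∀ x : ℝ, ∀ σ ∈ Set.Icc (0 : ℝ) 1,
      (x : ℂ) + I * ((s + σ * (upperHeight (delta t γ) x - s) : ℝ) : ℂ) ∈ U)
    (hb : ∀ x : ℝ, ∀ σ ∈ Set.Icc (0 : ℝ) 1,
      ‖F (x + I * ((s + σ * (upperHeight (delta t γ) x - s) : ℝ) : ℂ))‖ ≤ C * (1 + x ^ 2)⁻¹) :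
    ∑ j ∈ upperPieces, ∫ x in interval j, F (param t γ j x) * tangent t γ j =
      ∫ x : ℝ, F (x + I * s) := by
  set d := delta t γ with hd
  have hsub' : ∀ x y : ℝ, y = upperHeight d x → ∀ σ ∈ Set.Icc (0 : ℝ) 1,
      (x : ℂ) + I * ((s : ℂ) + σ * (y - s)) ∈ U := by
    rintro x y rfl σ hσ
    simpa using hsub x σ hσ
  have hb' : ∀ x y : ℝ, y = upperHeight d x → ∀ σ ∈ Set.Icc (0 : ℝ) 1,
      ‖F (x + I * ((s : ℂ) + σ * (y - s)))‖ ≤ C * (1 + x ^ 2)⁻¹ := by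
    rintro x y rfl σ hσ
    simpa using hb x σ hσ
  have hu : ∀ j ∈ upperPieces, ∀ x ∈ interval j, height d j x = upperHeight d x := fun j hj x hx =>
    height_of_mem_upperPieces hj hx
  have hint : Integrable fun x : ℝ => F (x + I * s) := by
    refine integrable_of_bound hF (C := C) (fun x => ?_) fun x => ?_
    · simpa using hsub x 0 (by simp)
    · simpa using hb x 0 (by simp)
  have e0 := setIntegral_Iic_sub_setIntegral_horizontal (C := C) (s := s) hU hF 0 (-2)
    (fun x hx => hsub' x 0 (hu 0 (by simp [upperPieces]) x hx))
    (fun x hx => hb' x 0 (hu 0 (by simp [upperPieces]) x hx))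
  have e7 := setIntegral_Ici_sub_setIntegral_horizontal (C := C) (s := s) hU hF 0 2
    (fun x hx => hsub' x 0 (hu 7 (by simp [upperPieces]) x hx))
    (fun x hx => hb' x 0 (hu 7 (by simp [upperPieces]) x hx))
  have e1 := setIntegral_Icc_sub_setIntegral_horizontal (s := s) hU hF d (2 * d)
    (by norm_num : (-2 : ℝ) ≤ -1) (fun x hx => hsub' x (d * x + 2 * d) (by
      rw [← hu 1 (by simp [upperPieces]) x hx]; simp [height]; ring))
  have e3 := setIntegral_Icc_sub_setIntegral_horizontal (s := s) hU hF 0 d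
    (by norm_num : (-1 : ℝ) ≤ 1) (fun x hx => hsub' x (0 * x + d) (by
      rw [← hu 3 (by simp [upperPieces]) x hx]; simp [height]))
  have e5 := setIntegral_Icc_sub_setIntegral_horizontal (s := s) hU hF (-d) (2 * d)
    (by norm_num : (1 : ℝ) ≤ 2) (fun x hx => hsub' x (-d * x + 2 * d) (by
      rw [← hu 5 (by simp [upperPieces]) x hx]; simp [height]; ring))
  have p0 : ∫ x in interval 0, F (param t γ 0 x) * tangent t γ 0 =
      ∫ x : ℝ in Set.Iic (-2), F (x + I * ((0 : ℝ) : ℂ)) := by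
    simp [interval, param, height, tangent, slope]
  have p7 : ∫ x in interval 7, F (param t γ 7 x) * tangent t γ 7 =
      ∫ x : ℝ in Set.Ici 2, F (x + I * ((0 : ℝ) : ℂ)) := by
    simp [interval, param, height, tangent, slope]
  have p1 : ∫ x in interval 1, F (param t γ 1 x) * tangent t γ 1 =
      ∫ x in Set.Icc (-2) (-1), F (x + I * ((d * x + 2 * d : ℝ) : ℂ)) * (1 + I * d) := by
    simp [interval, param, height, tangent, slope, mul_add, ← hd, mul_comm]
  have p3 : ∫ x in interval 3, F (param t γ 3 x) * tangent t γ 3 =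
      ∫ x in Set.Icc (-1) 1, F (x + I * ((0 * x + d : ℝ) : ℂ)) * (1 + I * ((0 : ℝ) : ℂ)) := by
    simp [interval, param, height, tangent, slope, ← hd]
  have p5 : ∫ x in interval 5, F (param t γ 5 x) * tangent t γ 5 =
      ∫ x in Set.Icc 1 2, F (x + I * ((-d * x + 2 * d : ℝ) : ℂ)) * (1 + I * ((-d : ℝ) : ℂ)) := by
    have : ∀ x : ℝ, -((d : ℂ) * x) + 2 * d = d * (2 - x) := fun x => by ring
    simp [interval, param, height, tangent, slope, ← hd, this]
  have v1 : d * (-2) + 2 * d = 0 := by ring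
  have v2 : d * (-1) + 2 * d = d := by ring
  have v3 : -d * 2 + 2 * d = 0 := by ring
  have v4 : -d * 1 + 2 * d = d := by ring
  rw [v1, v2] at e1
  rw [v3, v4] at e5
  rw [zero_mul, zero_mul, zero_add] at e3
  have hsum : ∑ j ∈ upperPieces, ∫ x in interval j, F (param t γ j x) * tangent t γ j =
      (∫ x in interval 0, F (param t γ 0 x) * tangent t γ 0) +
      ((∫ x in interval 1, F (param t γ 1 x) * tangent t γ 1) +
      ((∫ x in interval 3, F (param t γ 3 x) * tangent t γ 3) +
      ((∫ x in interval 5, F (param t γ 5 x) * tangent t γ 5) +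
      ∫ x in interval 7, F (param t γ 7 x) * tangent t γ 7))) := by
    rw [upperPieces, Finset.sum_insert (by decide), Finset.sum_insert (by decide),
      Finset.sum_insert (by decide), Finset.sum_insert (by decide), Finset.sum_singleton]
  have hline : ∫ x : ℝ, F (x + I * s) = (∫ x : ℝ in Set.Iic (-2), F (x + I * s)) +
      ((∫ x in Set.Icc (-2 : ℝ) (-1), F (x + I * s)) + ((∫ x in Set.Icc (-1 : ℝ) 1, F (x + I * s)) +
      ((∫ x in Set.Icc (1 : ℝ) 2, F (x + I * s)) + ∫ x : ℝ in Set.Ici 2, F (x + I * s)))) := by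
    have hii : ∀ a b : ℝ, IntervalIntegrable (fun x : ℝ => F (x + I * s)) volume a b := fun a b =>
      hint.intervalIntegrable
    rw [integral_Icc_eq_integral_Ioc, integral_Icc_eq_integral_Ioc, integral_Icc_eq_integral_Ioc,
      integral_Ici_eq_integral_Ioi, ← intervalIntegral.integral_of_le (by norm_num),
      ← intervalIntegral.integral_of_le (by norm_num),
      ← intervalIntegral.integral_of_le (by norm_num),
      ← intervalIntegral.integral_Iic_add_Ioi (b := 2) hint.integrableOn hint.integrableOn]
    have a1 := intervalIntegral.integral_Iic_sub_Iic (a := (-2 : ℝ)) (b := 2)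
      hint.integrableOn hint.integrableOn
    have a2 := intervalIntegral.integral_add_adjacent_intervals (hii (-2) (-1)) (hii (-1) 2)
    have a3 := intervalIntegral.integral_add_adjacent_intervals (hii (-1) 1) (hii 1 2)
    linear_combination a1 - a2 - a3
  rw [hsum, p0, p1, p3, p5, p7, hline]
  linear_combination e0 + e1 + e3 + e5 + e7

lemma lineIntegral_cutoff (hd : 0 < delta t γ) (G : ℂ → ℂ) (z : ℂ) :
    lineIntegral t γ (fun w => (if w.im < 0 then 0 else G w) / (w - z)) =
      ∑ j ∈ upperPieces, ∫ x in interval j, G (param t γ j x) / (param t γ j x - z) *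
        tangent t γ j := by
  rw [lineIntegral, ← Finset.sum_subset (Finset.subset_univ upperPieces)]
  · refine Finset.sum_congr rfl fun j hj => ?_
    refine setIntegral_congr_fun (measurableSet_interval j) fun x hx => ?_
    have : ¬ (param t γ j x).im < 0 := by
      rw [param_im_of_mem hj hx, not_lt]
      exact upperHeight_nonneg hd.le x
    simp only [this, if_false]
  · intro j _ hj
    refine integral_eq_zero_of_ae ?_
    filter_upwards [ae_param_im_neg hd hj] with x hx
    simp [hx]

/-- The line integral of a Cauchy kernel over the upper half of the contour equals the one over a
horizontal line `Im = s`, if the region `K` between the two does not contain the pole. -/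
lemma lineIntegral_cutoff_eq (hd : 0 < delta t γ) {G : ℂ → ℂ} {D₀ D₁ D C s : ℝ}
    (hD₀ : delta t γ < D₀) (hD₁ : D < D₁) (hdD : delta t γ < D)
    (hG : DifferentiableOn ℂ G {z | -D₀ < z.im ∧ z.im < D₁})
    (hb : ∀ x v : ℝ, v ∈ Set.Icc (-delta t γ) D → ‖G (x + I * v)‖ ≤ C * (1 + x ^ 2)⁻¹)
    (hs : s ∈ Set.Icc (-delta t γ) D) {z : ℂ} {K : Set ℂ} (hK : IsClosed K) (hz : z ∉ K)
    (hsub : ∀ x : ℝ, ∀ σ ∈ Set.Icc (0 : ℝ) 1,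
      (x : ℂ) + I * ((s + σ * (upperHeight (delta t γ) x - s) : ℝ) : ℂ) ∈ K) :
    lineIntegral t γ (fun w => (if w.im < 0 then 0 else G w) / (w - z)) =
      cauchyLine (fun x => G (x + I * s)) s z := by
  obtain ⟨r, hr0, hr⟩ : ∃ r > 0, ∀ w ∈ K, r ≤ ‖w - z‖ := by
    obtain ⟨r, hr, hball⟩ := Metric.isOpen_iff.1 hK.isOpen_compl z hz
    refine ⟨r, hr, fun w hw => not_lt.1 fun hlt => hball ?_ hw⟩
    rwa [Metric.mem_ball, dist_eq_norm]
  have hmem : ∀ x : ℝ, ∀ σ ∈ Set.Icc (0 : ℝ) 1,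
      s + σ * (upperHeight (delta t γ) x - s) ∈ Set.Icc (-delta t γ) D := fun x σ hσ =>
    segment_mem_Icc hs ⟨by linarith [upperHeight_nonneg hd.le x],
      (upperHeight_le hd.le x).trans hdD.le⟩ hσ
  rw [lineIntegral_cutoff hd]
  have := sum_upperPieces_eq_integral_line (t := t) (γ := γ) (s := s) (C := C / r)
    (U := {z | -D₀ < z.im ∧ z.im < D₁} \ {z}) (F := fun w => G w / (w - z))
    ((isOpen_strip _ _).sdiff isClosed_singleton)
    ((hG.mono Set.sdiff_subset).div (by fun_prop) fun w hw => sub_ne_zero.2 hw.2) ?_ ?_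
  · exact this
  · intro x σ hσ
    have h1 := hmem x σ hσ
    refine ⟨?_, fun h0 => ?_⟩
    · rw [Set.mem_ofPred_eq]
      simp only [Complex.add_im, Complex.ofReal_im, Complex.I_mul_im, Complex.ofReal_re, zero_add]
      constructor <;> linarith [h1.1, h1.2]
    · have h2 := hr _ (hsub x σ hσ)
      rw [Set.mem_singleton_iff] at h0
      rw [h0, sub_self, norm_zero] at h2
      linarith
  · intro x σ hσ
    have h1 := hb x _ (hmem x σ hσ)
    rw [norm_div, div_mul_eq_mul_div]
    exact div_le_div₀ ((norm_nonneg _).trans h1) h1 hr0 (hr _ (hsub x σ hσ))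

lemma lineIntegral_cutoff_of_above (hd : 0 < delta t γ) {G : ℂ → ℂ} {D₀ D₁ D C : ℝ}
    (hD₀ : delta t γ < D₀) (hD₁ : D < D₁) (hdD : delta t γ < D)
    (hG : DifferentiableOn ℂ G {z | -D₀ < z.im ∧ z.im < D₁})
    (hb : ∀ x v : ℝ, v ∈ Set.Icc (-delta t γ) D → ‖G (x + I * v)‖ ≤ C * (1 + x ^ 2)⁻¹) {z : ℂ}
    (hz : upperHeight (delta t γ) z.re < z.im) :
    lineIntegral t γ (fun w => (if w.im < 0 then 0 else G w) / (w - z)) =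
      cauchyLine (fun x => G (x + I * ((-delta t γ : ℝ) : ℂ))) (-delta t γ) z := by
  refine lineIntegral_cutoff_eq hd hD₀ hD₁ hdD hG hb ⟨le_rfl, by linarith⟩
    (K := {w | w.im ≤ upperHeight (delta t γ) w.re})
    (isClosed_le Complex.continuous_im (continuous_upperHeight.comp Complex.continuous_re))
    (not_le.2 hz) fun x σ hσ => ?_
  have h0 := upperHeight_nonneg hd.le x
  have := segment_mem_Icc (a := -delta t γ) (b := upperHeight (delta t γ) x)
    ⟨le_rfl, by linarith⟩ ⟨by linarith, le_rfl⟩ hσ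
  rw [Set.mem_ofPred_eq]
  simpa only [Complex.add_im, Complex.ofReal_im, Complex.I_mul_im, Complex.ofReal_re, zero_add,
    Complex.add_re, Complex.I_mul_re, neg_zero, add_zero] using this.2

lemma lineIntegral_cutoff_of_below (hd : 0 < delta t γ) {G : ℂ → ℂ} {D₀ D₁ D C : ℝ}
    (hD₀ : delta t γ < D₀) (hD₁ : D < D₁) (hdD : delta t γ < D)
    (hG : DifferentiableOn ℂ G {z | -D₀ < z.im ∧ z.im < D₁})
    (hb : ∀ x v : ℝ, v ∈ Set.Icc (-delta t γ) D → ‖G (x + I * v)‖ ≤ C * (1 + x ^ 2)⁻¹) {z : ℂ}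
    (hz : z.im < upperHeight (delta t γ) z.re) :
    lineIntegral t γ (fun w => (if w.im < 0 then 0 else G w) / (w - z)) =
      cauchyLine (fun x => G (x + I * D)) D z := by
  refine lineIntegral_cutoff_eq hd hD₀ hD₁ hdD hG hb ⟨by linarith, le_rfl⟩
    (K := {w | upperHeight (delta t γ) w.re ≤ w.im})
    (isClosed_le (continuous_upperHeight.comp Complex.continuous_re) Complex.continuous_im)
    (not_le.2 hz) fun x σ hσ => ?_
  have h0 := upperHeight_le hd.le x
  have := segment_mem_Icc (a := upperHeight (delta t γ) x) (b := D)
    ⟨by linarith, le_rfl⟩ ⟨le_rfl, by linarith⟩ hσ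
  rw [Set.mem_ofPred_eq]
  simpa only [Complex.add_im, Complex.ofReal_im, Complex.I_mul_im, Complex.ofReal_re, zero_add,
    Complex.add_re, Complex.I_mul_re, neg_zero, add_zero] using this.1

/-! ### Square integrability on the contour -/

lemma measurePreserving_neg_interval (j : Fin 8) : MeasurePreserving (fun x : ℝ => -x)
    (volume.restrict (interval j)) (volume.restrict (interval j.rev)) := by
  have hpre : interval j = (fun x : ℝ => -x) ⁻¹' interval j.rev := by
    ext x
    exact neg_mem_interval_rev.symm
  rw [hpre]
  exact (Measure.measurePreserving_neg (volume : Measure ℝ)).restrict_preimage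
    (measurableSet_interval _)

lemma memLp_comp_neg {g : ℂ → ℂ} (hg : MemLp g 2 (arcLength t γ)) :
    MemLp (fun w => g (-w)) 2 (arcLength t γ) := by
  rw [memLp_arcLength_iff] at hg ⊢
  intro j
  have := (hg j.rev).comp_measurePreserving (measurePreserving_neg_interval j)
  simpa only [Function.comp_def, param_rev] using this

lemma memLp_two_of_sq_le {f : ℝ → ℂ} {S : Set ℝ} (hS : MeasurableSet S) {C : ℝ}
    (hf : ContinuousOn f S) (hb : ∀ x ∈ S, ‖f x‖ ^ 2 ≤ C * (1 + x ^ 2)⁻¹) :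
    MemLp f 2 (volume.restrict S) := by
  have hm := hf.aestronglyMeasurable (μ := volume) hS
  rw [memLp_two_iff_integrable_sq_norm hm]
  refine Integrable.mono' ((integrable_inv_one_add_sq.const_mul C).integrableOn (s := S))
    (hm.norm.pow 2) ?_
  filter_upwards [ae_restrict_mem hS] with x hx
  rw [Real.norm_eq_abs, abs_of_nonneg (by positivity)]
  exact hb x hx

/-- A function with different expressions on the upper and the lower half of the contour is square
integrable if both decay at least like `x⁻¹`. -/
lemma memLp_ite (hd : 0 < delta t γ) {f g : ℂ → ℂ} {C : ℝ}
    (hf : ∀ w : ℂ, w.im ≤ 0 → |w.im| ≤ delta t γ → ContinuousAt f w)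
    (hg : ∀ w : ℂ, 0 ≤ w.im → |w.im| ≤ delta t γ → ContinuousAt g w)
    (hfb : ∀ w : ℂ, w ∈ contour t γ → w.im ≤ 0 → ‖f w‖ ^ 2 ≤ C * (1 + w.re ^ 2)⁻¹)
    (hgb : ∀ w : ℂ, w ∈ contour t γ → 0 ≤ w.im → ‖g w‖ ^ 2 ≤ C * (1 + w.re ^ 2)⁻¹) :
    MemLp (fun w => if w.im < 0 then f w else g w) 2 (arcLength t γ) := by
  rw [memLp_arcLength_iff]
  intro j
  have hmem : ∀ x ∈ interval j, param t γ j x ∈ contour t γ := fun x hx =>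
    Set.mem_iUnion.2 ⟨j, x, hx, rfl⟩
  have hcont : ∀ φ : ℂ → ℂ, (∀ x ∈ interval j, ContinuousAt φ (param t γ j x)) →
      ContinuousOn (fun x => φ (param t γ j x)) (interval j) := fun φ hφ x hx =>
    (ContinuousAt.comp (f := param t γ j) (hφ x hx)
      (continuous_param j).continuousAt).continuousWithinAt
  by_cases hj : j ∈ upperPieces
  · have h0 : ∀ x ∈ interval j, 0 ≤ (param t γ j x).im ∧ |(param t γ j x).im| ≤ delta t γ := by
      intro x hx
      rw [param_im_of_mem hj hx, abs_of_nonneg (upperHeight_nonneg hd.le x)]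
      exact ⟨upperHeight_nonneg hd.le x, upperHeight_le hd.le x⟩
    have := memLp_two_of_sq_le (measurableSet_interval j) (C := C)
      (hcont g fun x hx => hg _ (h0 x hx).1 (h0 x hx).2) fun x hx => by
        simpa only [param_re] using hgb _ (hmem x hx) (h0 x hx).1
    refine this.ae_eq ?_
    filter_upwards [ae_restrict_mem (measurableSet_interval j)] with x hx
    rw [if_neg (not_lt.2 (h0 x hx).1)]
  · have h0 : ∀ x ∈ interval j, (param t γ j x).im ≤ 0 ∧ |(param t γ j x).im| ≤ delta t γ := by
      intro x hx
      rw [param_im_of_notMem hj hx, abs_neg, abs_of_nonneg (upperHeight_nonneg hd.le x)]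
      exact ⟨by linarith [upperHeight_nonneg hd.le x], upperHeight_le hd.le x⟩
    have := memLp_two_of_sq_le (measurableSet_interval j) (C := C)
      (hcont f fun x hx => hf _ (h0 x hx).1 (h0 x hx).2) fun x hx => by
        simpa only [param_re] using hfb _ (hmem x hx) (h0 x hx).1
    refine this.ae_eq ?_
    filter_upwards [ae_param_im_neg hd hj] with x hx
    rw [if_pos hx]

end

/-! ### Construction of the solution -/

/-- The scalar solution off the upper half of the contour: the continuation from above over it,
and `W` below it. -/
noncomputable def piecewiseSolution (A : ℂ → ℂ) (d : ℝ) (s : ℂ) (W : ℂ → ℂ) (z : ℂ) : ℂ :=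
  if upperHeight d z.re < z.im then upperContinuation A d s W z else W z

/-- The boundary values from above of the scalar solution on the full contour; on the strictly
lower half there is no jump. -/
noncomputable def valueFromAbove (A : ℂ → ℂ) (d : ℝ) (s : ℂ) (W : ℂ → ℂ) (z : ℂ) : ℂ :=
  if z.im < 0 then W z else upperContinuation A d s W z

lemma abs_im_le_of_mem_contour {t γ : ℝ} (hd : 0 < delta t γ) {z : ℂ} (hz : z ∈ contour t γ) :
    |z.im| ≤ delta t γ := by
  have h1 := upperHeight_nonneg hd.le z.re
  have h2 := upperHeight_le hd.le z.re
  rw [abs_le]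
  rcases mem_contour_iff.1 hz with h0 | h0 <;> constructor <;> linarith

lemma im_eq_of_mem_contour {t γ : ℝ} (hd : 0 < delta t γ) {z : ℂ} (hz : z ∈ contour t γ)
    (h0 : 0 ≤ z.im) : z.im = upperHeight (delta t γ) z.re := by
  have h1 := upperHeight_nonneg hd.le z.re
  rcases mem_contour_iff.1 hz with h2 | h2 <;> linarith

lemma tendsto_add_I_mul (z : ℂ) : Tendsto (fun η : ℝ => z + I * η) (𝓝[>] 0) (𝓝 z) := by
  have h1 : Continuous fun r : ℝ => z + I * r := by fun_prop
  have := h1.tendsto 0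
  simp only [Complex.ofReal_zero, mul_zero, add_zero] at this
  exact this.mono_left nhdsWithin_le_nhds

lemma tendsto_sub_I_mul (z : ℂ) : Tendsto (fun η : ℝ => z - I * η) (𝓝[>] 0) (𝓝 z) := by
  have h1 : Continuous fun r : ℝ => z - I * r := by fun_prop
  have := h1.tendsto 0
  simp only [Complex.ofReal_zero, mul_zero, sub_zero] at this
  exact this.mono_left nhdsWithin_le_nhds

namespace IsScalarSolution

variable {A W : ℂ → ℂ} {t γ D : ℝ} {s : ℂ}

lemma differentiableAt_piecewise (hW : IsScalarSolution A (delta t γ) D s W) {z : ℂ}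
    (hz : z.im ≠ upperHeight (delta t γ) z.re) :
    DifferentiableAt ℂ (piecewiseSolution A (delta t γ) s W) z := by
  have hd := hW.datum.d_pos
  have hc : Continuous fun w : ℂ => upperHeight (delta t γ) w.re :=
    continuous_upperHeight.comp Complex.continuous_re
  rcases lt_or_gt_of_ne hz with h0 | h0
  · have h1 : DifferentiableAt ℂ W z :=
      hW.differentiableAt (h0.trans_le ((upperHeight_le hd.le _).trans hW.datum.d_lt.le))
    refine h1.congr_of_eventuallyEq ?_
    filter_upwards [(isOpen_lt Complex.continuous_im hc).mem_nhds h0] with w hw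
    exact if_neg (not_lt.2 (le_of_lt hw))
  · have h1 : DifferentiableAt ℂ (upperContinuation A (delta t γ) s W) z :=
      hW.differentiableAt_upper (by linarith [upperHeight_nonneg hd.le z.re])
    refine h1.congr_of_eventuallyEq ?_
    filter_upwards [(isOpen_lt hc Complex.continuous_im).mem_nhds h0] with w hw
    exact if_pos hw

lemma tendsto_from_above (hW : IsScalarSolution A (delta t γ) D s W) {z : ℂ}
    (hz : z ∈ contour t γ) :
    Tendsto (fun η : ℝ => piecewiseSolution A (delta t γ) s W (z + I * η)) (𝓝[>] 0)
      (𝓝 (valueFromAbove A (delta t γ) s W z)) := by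
  have hd := hW.datum.d_pos
  have him := abs_im_le_of_mem_contour hd hz
  have hpr : ∀ η : ℝ, (z + I * η).re = z.re ∧ (z + I * η).im = z.im + η := fun η => by simp
  by_cases h0 : z.im < 0
  · rw [valueFromAbove, if_pos h0]
    have hc : ContinuousAt W z := (hW.differentiableAt (h0.trans hW.D_pos)).continuousAt
    refine (hc.tendsto.comp (tendsto_add_I_mul z)).congr' ?_
    filter_upwards [Ioo_mem_nhdsGT (show (0 : ℝ) < -z.im by linarith)] with η hη
    refine (if_neg ?_).symm
    rw [(hpr η).1, (hpr η).2, not_lt]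
    linarith [upperHeight_nonneg hd.le z.re, hη.2]
  · rw [valueFromAbove, if_neg h0]
    have h1 := im_eq_of_mem_contour hd hz (not_lt.1 h0)
    have hc : ContinuousAt (upperContinuation A (delta t γ) s W) z :=
      (hW.differentiableAt_upper (by linarith)).continuousAt
    refine (hc.tendsto.comp (tendsto_add_I_mul z)).congr' ?_
    filter_upwards [self_mem_nhdsWithin] with η hη
    refine (if_pos ?_).symm
    rw [(hpr η).1, (hpr η).2, h1]
    linarith [show (0 : ℝ) < η from hη]

lemma tendsto_from_below (hW : IsScalarSolution A (delta t γ) D s W) {z : ℂ}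
    (hz : z ∈ contour t γ) :
    Tendsto (fun η : ℝ => piecewiseSolution A (delta t γ) s W (z - I * η)) (𝓝[>] 0)
      (𝓝 (W z)) := by
  have hd := hW.datum.d_pos
  have him := abs_le.1 (abs_im_le_of_mem_contour hd hz)
  have hpr : ∀ η : ℝ, (z - I * η).re = z.re ∧ (z - I * η).im = z.im - η := fun η => by simp
  have hc : ContinuousAt W z :=
    (hW.differentiableAt (him.2.trans_lt hW.datum.d_lt)).continuousAt
  refine (hc.tendsto.comp (tendsto_sub_I_mul z)).congr' ?_
  filter_upwards [self_mem_nhdsWithin] with η hη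
  refine (if_neg ?_).symm
  rw [(hpr η).1, (hpr η).2, not_lt]
  have h1 := upperHeight_nonneg hd.le z.re
  have h2 : (0 : ℝ) < η := hη
  rcases mem_contour_iff.1 hz with h0 | h0 <;> linarith

lemma exists_bound_upper {d : ℝ} (hW : IsScalarSolution A d D s W) :
    ∃ K, ∀ z : ℂ, 0 ≤ z.im → ‖upperContinuation A d s W z‖ ≤ K := by
  have hd := hW.datum.d_pos
  refine ⟨1 + ‖s / (2 * Real.pi * I)‖ *
    ((∫ x : ℝ, ‖reflected A W (x + I * ((-d : ℝ) : ℂ))‖) / d), fun z hz => ?_⟩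
  rw [upperContinuation]
  refine (norm_add_le _ _).trans ?_
  rw [norm_one, norm_mul]
  refine add_le_add le_rfl (mul_le_mul_of_nonneg_left ?_ (norm_nonneg _))
  refine norm_cauchyLine_le (hW.integrable_reflected hW.neg_d_mem) hd ?_
  rw [abs_of_neg (by linarith)]
  linarith

/-- Square decay on the contour, from boundedness near the hexagon and the expansion at infinity on
the half-lines. -/
lemma exists_sq_bound_contour (hW : IsScalarSolution A (delta t γ) D s W) : ∃ C : ℝ, ∀ w : ℂ,
    w ∈ contour t γ → ‖W w - 1‖ ^ 2 ≤ C * (1 + w.re ^ 2)⁻¹ ∧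
      (0 ≤ w.im → ‖upperContinuation A (delta t γ) s W w - 1‖ ^ 2 ≤ C * (1 + w.re ^ 2)⁻¹) := by
  have hd := hW.datum.d_pos
  obtain ⟨K₁, hK₁⟩ := hW.exists_bound
  obtain ⟨K₂, hK₂⟩ := hW.exists_bound_upper
  obtain ⟨K₃, hK₃⟩ := hW.exists_asymptotics
  set c := ‖firstCoeff A D s W‖
  have key : ∀ (v w : ℂ), w ∈ contour t γ → ‖v‖ ≤ max K₁ K₂ →
      (w ≠ 0 → w.im = 0 → ‖v - 1 - firstCoeff A D s W * w⁻¹‖ ≤ K₃ * ‖w⁻¹ ^ 2‖) →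
      ‖v - 1‖ ^ 2 ≤ (5 * (max K₁ K₂ + 1) ^ 2 + 2 * (c + |K₃|) ^ 2) * (1 + w.re ^ 2)⁻¹ := by
    intro v w hw hv hasy
    rw [← div_eq_mul_inv, le_div_iff₀ (by positivity)]
    by_cases h2 : |w.re| ≤ 2
    · have h3 : ‖v - 1‖ ≤ max K₁ K₂ + 1 := by
        refine (norm_sub_le _ _).trans ?_
        rw [norm_one]
        linarith
      have h4 : ‖v - 1‖ ^ 2 ≤ (max K₁ K₂ + 1) ^ 2 := pow_le_pow_left₀ (norm_nonneg _) h3 2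
      have h5 : w.re ^ 2 ≤ 4 := by
        have := sq_le_sq' (by linarith [abs_nonneg w.re]) h2
        rw [sq_abs] at this
        linarith
      nlinarith [sq_nonneg (c + |K₃|), sq_nonneg ‖v - 1‖]
    · have h2' : 2 < |w.re| := not_le.1 h2
      have him : w.im = 0 := by
        have := mem_contour_iff.1 hw
        rw [upperHeight_of_two_le h2'.le] at this
        simpa using this
      have hwn : ‖w‖ = |w.re| := (Complex.abs_re_eq_norm.2 him).symm
      have hw0 : w ≠ 0 := by
        intro h0
        rw [h0] at h2'
        simp at h2'
        linarith
      have h3 := hasy hw0 him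
      rw [norm_pow, norm_inv, hwn] at h3
      have hx1 : |w.re|⁻¹ ≤ 1 := inv_le_one_of_one_le₀ (by linarith)
      have hx0 : 0 < |w.re|⁻¹ := inv_pos.2 (by linarith)
      have h4 : ‖v - 1‖ ≤ (c + |K₃|) * |w.re|⁻¹ := by
        have h5 : ‖v - 1‖ ≤ ‖v - 1 - firstCoeff A D s W * w⁻¹‖ + ‖firstCoeff A D s W * w⁻¹‖ := by
          have := norm_add_le (v - 1 - firstCoeff A D s W * w⁻¹) (firstCoeff A D s W * w⁻¹)
          rwa [sub_add_cancel] at this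
        rw [norm_mul, norm_inv, hwn] at h5
        have h6 : K₃ * |w.re|⁻¹ ^ 2 ≤ |K₃| * |w.re|⁻¹ := by
          calc K₃ * |w.re|⁻¹ ^ 2 ≤ |K₃| * |w.re|⁻¹ ^ 2 :=
                mul_le_mul_of_nonneg_right (le_abs_self _) (by positivity)
            _ ≤ |K₃| * |w.re|⁻¹ := mul_le_mul_of_nonneg_left (by nlinarith) (abs_nonneg _)
        calc ‖v - 1‖ ≤ _ := h5
          _ ≤ |K₃| * |w.re|⁻¹ + c * |w.re|⁻¹ := add_le_add (h3.trans h6) le_rfl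
          _ = _ := by ring
      have h7 := pow_le_pow_left₀ (norm_nonneg _) h4 2
      rw [mul_pow, inv_pow, sq_abs] at h7
      have h8 : 4 ≤ w.re ^ 2 := by
        rw [← sq_abs]
        nlinarith
      have h9 : (w.re ^ 2)⁻¹ * (1 + w.re ^ 2) ≤ 2 := by
        rw [inv_mul_le_iff₀ (by linarith)]
        linarith
      calc ‖v - 1‖ ^ 2 * (1 + w.re ^ 2) ≤ (c + |K₃|) ^ 2 * (w.re ^ 2)⁻¹ * (1 + w.re ^ 2) :=
            mul_le_mul_of_nonneg_right h7 (by positivity)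
        _ = (c + |K₃|) ^ 2 * ((w.re ^ 2)⁻¹ * (1 + w.re ^ 2)) := by ring
        _ ≤ (c + |K₃|) ^ 2 * 2 := mul_le_mul_of_nonneg_left h9 (sq_nonneg _)
        _ ≤ _ := by nlinarith [sq_nonneg (max K₁ K₂ + 1)]
  refine ⟨_, fun w hw => ⟨key _ w hw ?_ fun hw0 him => (hK₃ w hw0).1 him.le, fun h0 =>
    key _ w hw ((hK₂ w h0).trans (le_max_right _ _)) fun hw0 him => (hK₃ w hw0).2 him.ge⟩⟩
  exact (hK₁ w (abs_le.1 (abs_im_le_of_mem_contour hd hw)).2).trans (le_max_left _ _)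

lemma memLp_sub_one (hW : IsScalarSolution A (delta t γ) D s W) :
    MemLp (fun w => W w - 1) 2 (arcLength t γ) := by
  obtain ⟨C, hC⟩ := hW.exists_sq_bound_contour
  have hc : ∀ w : ℂ, |w.im| ≤ delta t γ → ContinuousAt (fun w => W w - 1) w := fun w hw =>
    (hW.differentiableAt ((abs_le.1 hw).2.trans_lt hW.datum.d_lt)).continuousAt.sub
      continuousAt_const
  have := memLp_ite hW.datum.d_pos (f := fun w => W w - 1) (g := fun w => W w - 1) (C := C)
    (fun w _ => hc w) (fun w _ => hc w) (fun w hw _ => (hC w hw).1) (fun w hw _ => (hC w hw).1)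
  simpa only [ite_self] using this

lemma memLp_valueFromAbove_sub_one (hW : IsScalarSolution A (delta t γ) D s W) :
    MemLp (fun w => valueFromAbove A (delta t γ) s W w - 1) 2 (arcLength t γ) := by
  obtain ⟨C, hC⟩ := hW.exists_sq_bound_contour
  have hd := hW.datum.d_pos
  have := memLp_ite hd (f := fun w => W w - 1)
    (g := fun w => upperContinuation A (delta t γ) s W w - 1) (C := C)
    (fun w _ hw => (hW.differentiableAt
      ((abs_le.1 hw).2.trans_lt hW.datum.d_lt)).continuousAt.sub continuousAt_const)
    (fun w hw _ => (hW.differentiableAt_upper (by linarith)).continuousAt.sub continuousAt_const)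
    (fun w hw _ => (hC w hw).1) (fun w hw h0 => (hC w hw).2 h0)
  refine this.congr_norm this.1 ?_ |>.ae_eq ?_
  · exact Eventually.of_forall fun w => rfl
  · refine Eventually.of_forall fun w => ?_
    simp only [valueFromAbove]
    split_ifs <;> rfl

lemma exists_piecewise_asymptotics (hW : IsScalarSolution A (delta t γ) D s W) : ∃ K : ℝ,
    ∀ z : ℂ, 3 ≤ ‖z‖ → ‖piecewiseSolution A (delta t γ) s W z - 1 - firstCoeff A D s W * z⁻¹‖ ≤
      K * ‖z⁻¹ ^ 2‖ := by
  obtain ⟨K, hK⟩ := hW.exists_asymptotics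
  have hd := hW.datum.d_pos
  refine ⟨K, fun z hz => ?_⟩
  have hz0 : z ≠ 0 := by
    rintro rfl
    rw [norm_zero] at hz
    linarith
  rw [piecewiseSolution]
  split_ifs with h0
  · exact (hK z hz0).2 ((upperHeight_nonneg hd.le _).trans h0.le)
  · refine (hK z hz0).1 (not_lt.1 fun h1 => ?_)
    have h2 := not_lt.1 h0
    have h3 : |z.re| ≤ 2 := by
      by_contra h3
      rw [upperHeight_of_two_le (not_le.1 h3).le] at h2
      linarith
    have h4 : |z.im| ≤ 1 / 2 := by
      rw [abs_of_pos h1]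
      exact h2.trans ((upperHeight_le hd.le _).trans delta_le_half)
    linarith [Complex.norm_le_abs_re_add_abs_im z]

end IsScalarSolution

section

variable {A Wp Wm : ℂ → ℂ} {t γ D : ℝ}

/-- The density, on the upper half of the contour, of a combination of the two scalar solutions with
`s = i` and `s = -i`. -/
noncomputable def combinedDensity (A Wp Wm : ℂ → ℂ) (P Q : ℂ) (w : ℂ) : ℂ :=
  if w.im < 0 then 0 else I * P * reflected A Wp w - I * Q * reflected A Wm w

lemma exists_combined (hp : IsScalarSolution A (delta t γ) D I Wp)
    (hm : IsScalarSolution A (delta t γ) D (-I) Wm) (P Q : ℂ) :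
    (∃ D₁ > D, DifferentiableOn ℂ (fun w => I * P * reflected A Wp w - I * Q * reflected A Wm w)
      {z | -D < z.im ∧ z.im < D₁}) ∧
    ∃ C, 0 ≤ C ∧ ∀ x v : ℝ, v ∈ Set.Icc (-delta t γ) D →
      ‖I * P * reflected A Wp (x + I * v) - I * Q * reflected A Wm (x + I * v)‖ ≤
        C * (1 + x ^ 2)⁻¹ := by
  obtain ⟨D₁, hD₁, hdp⟩ := hp.exists_differentiableOn
  obtain ⟨D₂, hD₂, hdm⟩ := hm.exists_differentiableOn
  obtain ⟨C₁, hC₁0, hC₁⟩ := hp.exists_reflected_bound'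
  obtain ⟨C₂, hC₂0, hC₂⟩ := hm.exists_reflected_bound'
  refine ⟨⟨min D₁ D₂, lt_min hD₁ hD₂, ?_⟩, ‖P‖ * C₁ + ‖Q‖ * C₂, by positivity, ?_⟩
  · exact ((hdp.mono fun z hz => ⟨hz.1, hz.2.trans_le (min_le_left _ _)⟩).const_mul _).sub
      ((hdm.mono fun z hz => ⟨hz.1, hz.2.trans_le (min_le_right _ _)⟩).const_mul _)
  · intro x v hv
    refine (norm_sub_le _ _).trans ?_
    rw [norm_mul, norm_mul, norm_mul, norm_mul, Complex.norm_I, one_mul, one_mul, add_mul,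
      mul_assoc, mul_assoc]
    exact add_le_add (mul_le_mul_of_nonneg_left (hC₁ x v hv) (norm_nonneg _))
      (mul_le_mul_of_nonneg_left (hC₂ x v hv) (norm_nonneg _))

lemma cauchyLine_combined {G₁ G₂ : ℝ → ℂ} (h₁ : Integrable G₁) (h₂ : Integrable G₂) (a b : ℂ)
    {s : ℝ} {z : ℂ} (hz : z.im ≠ s) : cauchyLine (fun x => a * G₁ x - b * G₂ x) s z =
      a * cauchyLine G₁ s z - b * cauchyLine G₂ s z := by
  rw [cauchyLine, cauchyLine, cauchyLine, ← integral_const_mul, ← integral_const_mul,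
    ← integral_sub ((integrable_div_line h₁ hz).const_mul _)
      ((integrable_div_line h₂ hz).const_mul _)]
  refine integral_congr_ae (Eventually.of_forall fun x => ?_)
  simp only
  ring

lemma combined_eq_lineIntegral (hp : IsScalarSolution A (delta t γ) D I Wp)
    (hm : IsScalarSolution A (delta t γ) D (-I) Wm) (P Q : ℂ) {z : ℂ}
    (hz : z.im ≠ upperHeight (delta t γ) z.re) :
    P * piecewiseSolution A (delta t γ) I Wp z + Q * piecewiseSolution A (delta t γ) (-I) Wm z =
      P + Q + (2 * (Real.pi : ℂ) * I)⁻¹ *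
        lineIntegral t γ (fun w => combinedDensity A Wp Wm P Q w / (w - z)) := by
  have hd := hp.datum.d_pos
  have hdD := hp.datum.d_lt
  obtain ⟨⟨D₁, hD₁, hdiff⟩, C, -, hC⟩ := exists_combined hp hm P Q
  rcases lt_or_gt_of_ne hz with h0 | h0
  · have hzD : z.im < D := h0.trans_le ((upperHeight_le hd.le _).trans hdD.le)
    have e := lineIntegral_cutoff_of_below hd hdD hD₁ hdD hdiff hC h0
    simp only [combinedDensity]
    rw [e, cauchyLine_combined (hp.integrable_reflected hp.D_mem)
      (hm.integrable_reflected hm.D_mem) _ _ hzD.ne, piecewiseSolution, piecewiseSolution,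
      if_neg (not_lt.2 h0.le), if_neg (not_lt.2 h0.le), hp.eqn z hzD, hm.eqn z hzD]
    ring
  · have hzD : -delta t γ < z.im := by linarith [upperHeight_nonneg hd.le z.re]
    have e := lineIntegral_cutoff_of_above hd hdD hD₁ hdD hdiff hC h0
    simp only [combinedDensity]
    rw [e, cauchyLine_combined (hp.integrable_reflected hp.neg_d_mem)
      (hm.integrable_reflected hm.neg_d_mem) _ _ hzD.ne', piecewiseSolution, piecewiseSolution,
      if_pos h0, if_pos h0, upperContinuation, upperContinuation]
    ring

lemma memLp_combinedDensity (hp : IsScalarSolution A (delta t γ) D I Wp)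
    (hm : IsScalarSolution A (delta t γ) D (-I) Wm) (P Q : ℂ) :
    MemLp (combinedDensity A Wp Wm P Q) 2 (arcLength t γ) := by
  have hd := hp.datum.d_pos
  have hdD := hp.datum.d_lt
  obtain ⟨⟨D₁, hD₁, hdiff⟩, C, hC0, hC⟩ := exists_combined hp hm P Q
  refine memLp_ite hd (C := C ^ 2) (fun w _ _ => continuousAt_const) (fun w _ hw => ?_)
    (fun w hw h0 => ?_) (fun w hw h0 => ?_)
  · obtain ⟨h1, h2⟩ := abs_le.1 hw
    exact hdiff.continuousOn.continuousAt ((isOpen_strip _ _).mem_nhds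
      ⟨by linarith, by linarith⟩)
  · rw [norm_zero, zero_pow two_ne_zero]
    positivity
  · have him := (abs_le.1 (abs_im_le_of_mem_contour hd hw)).2
    have h1 := hC w.re w.im ⟨by linarith, him.trans hdD.le⟩
    have hweq : (w.re : ℂ) + I * w.im = w := by
      rw [mul_comm]; exact Complex.re_add_im w
    rw [hweq] at h1
    have h2 := pow_le_pow_left₀ (norm_nonneg _) h1 2
    rw [mul_pow] at h2
    exact h2.trans (mul_le_mul_of_nonneg_left (sq_inv_one_add_sq_le _) (sq_nonneg _))

end

/-- The coefficients `p`, in the two rows, of the scalar solution with `s = i` in the second column.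
The normalization at infinity determines `p` and `q = coeffMinus`: the columns of the identity
matrix are `i (p - q)` and `p + q`. -/
noncomputable def coeffPlus : Fin 2 → ℂ := ![-I / 2, 1 / 2]

/-- The coefficients `q`, in the two rows, of the scalar solution with `s = -i` in the second
column. -/
noncomputable def coeffMinus : Fin 2 → ℂ := ![I / 2, 1 / 2]

lemma coeff_add (i : Fin 2) : coeffPlus i + coeffMinus i = (1 : Mat) i 1 := by
  revert i
  rw [Fin.forall_fin_two]
  constructor <;> simp [coeffPlus, coeffMinus] <;> ring

lemma I_mul_coeff_add (i : Fin 2) : I * coeffPlus i + -I * coeffMinus i = (1 : Mat) i 0 := by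
  revert i
  rw [Fin.forall_fin_two]
  constructor
  · simp [coeffPlus, coeffMinus]
    linear_combination -Complex.I_sq
  · simp [coeffPlus, coeffMinus]

/-- Assembles a matrix from scalar functions `a` and `b`, which multiply the coefficients for
`s = i` and `s = -i`: the second column takes them at `z`, and the first column takes `a'` and `b'`
at `-z`. -/
noncomputable def assemble (a b a' b' : ℂ → ℂ) (z : ℂ) : Mat :=
  Matrix.of fun i k => ![I * coeffPlus i * a' (-z) + -I * coeffMinus i * b' (-z),
    coeffPlus i * a z + coeffMinus i * b z] k

/-- The solution of the Riemann-Hilbert problem in terms of the two scalar solutions `W±`: the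
second column combines `W±(z)`, and the first column combines `±i W±(-z)`. -/
noncomputable def matrixSolution (A : ℂ → ℂ) (d : ℝ) (Wp Wm : ℂ → ℂ) : ℂ → Mat :=
  assemble (piecewiseSolution A d I Wp) (piecewiseSolution A d (-I) Wm)
    (piecewiseSolution A d I Wp) (piecewiseSolution A d (-I) Wm)

/-- The coefficient of `z⁻¹` in the expansion of the solution at infinity. -/
noncomputable def matrixCoeff (A : ℂ → ℂ) (D : ℝ) (Wp Wm : ℂ → ℂ) : Mat :=
  Matrix.of fun i k => ![-(I * coeffPlus i * firstCoeff A D I Wp +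
      -I * coeffMinus i * firstCoeff A D (-I) Wm),
    coeffPlus i * firstCoeff A D I Wp + coeffMinus i * firstCoeff A D (-I) Wm] k

lemma isL2_assemble {t γ : ℝ} {a b a' b' : ℂ → ℂ}
    (ha : MemLp (fun w => a w - 1) 2 (arcLength t γ))
    (hb : MemLp (fun w => b w - 1) 2 (arcLength t γ))
    (ha' : MemLp (fun w => a' w - 1) 2 (arcLength t γ))
    (hb' : MemLp (fun w => b' w - 1) 2 (arcLength t γ)) :
    IsL2 t γ (fun z => assemble a b a' b' z - 1) := by
  intro i k
  fin_cases k
  · refine (((memLp_comp_neg ha').const_mul (I * coeffPlus i)).add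
      ((memLp_comp_neg hb').const_mul (-I * coeffMinus i))).ae_eq
      (Eventually.of_forall fun z => ?_)
    simp only [Pi.add_apply, Matrix.sub_apply, Fin.zero_eta, assemble, Matrix.of_apply,
      Matrix.cons_val_zero]
    linear_combination -I_mul_coeff_add i
  · refine ((ha.const_mul (coeffPlus i)).add (hb.const_mul (coeffMinus i))).ae_eq
      (Eventually.of_forall fun z => ?_)
    simp only [Pi.add_apply, Matrix.sub_apply, Fin.mk_one, assemble, Matrix.of_apply,
      Matrix.cons_val_one, Matrix.cons_val_fin_one]
    linear_combination -coeff_add i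

section

variable {Wp Wm : ℂ → ℂ} {t γ : ℝ}

/-- The boundary values of the matrix solution on the contour satisfy the jump relation. -/
lemma jump_relation (ht : t ≠ 0) (hγ0 : 0 < γ) (hγ1 : γ < 1)
    (hp : IsScalarSolution (upperEntry t γ) (delta t γ) (6 / 5 * delta t γ) I Wp)
    (hm : IsScalarSolution (upperEntry t γ) (delta t γ) (6 / 5 * delta t γ) (-I) Wm) {z : ℂ}
    (hz : z ∈ contour t γ) :
    assemble (valueFromAbove (upperEntry t γ) (delta t γ) I Wp)
      (valueFromAbove (upperEntry t γ) (delta t γ) (-I) Wm) Wp Wm z =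
    assemble Wp Wm (valueFromAbove (upperEntry t γ) (delta t γ) I Wp)
      (valueFromAbove (upperEntry t γ) (delta t γ) (-I) Wm) z * jump t γ z := by
  have hd := hp.datum.d_pos
  have hdD := hp.datum.d_lt
  obtain ⟨h1, h2⟩ := abs_le.1 (abs_im_le_of_mem_contour hd hz)
  have up : ∀ w : ℂ, 0 ≤ w.im → w.im ≤ delta t γ →
      valueFromAbove (upperEntry t γ) (delta t γ) I Wp w =
        Wp w + I * (upperEntry t γ w * Wp (-w)) ∧
      valueFromAbove (upperEntry t γ) (delta t γ) (-I) Wm w =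
        Wm w + -I * (upperEntry t γ w * Wm (-w)) := by
    intro w hw0 hw
    have hmem : w.im ∈ Set.Ioo (-delta t γ) (6 / 5 * delta t γ) := ⟨by linarith, by linarith⟩
    rw [valueFromAbove, valueFromAbove, if_neg (not_lt.2 hw0), if_neg (not_lt.2 hw0),
      hp.upper_eq hmem, hm.upper_eq hmem]
    exact ⟨rfl, rfl⟩
  have down : ∀ w : ℂ, w.im < 0 →
      valueFromAbove (upperEntry t γ) (delta t γ) I Wp w = Wp w ∧
      valueFromAbove (upperEntry t γ) (delta t γ) (-I) Wm w = Wm w := fun w hw =>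
    ⟨if_pos hw, if_pos hw⟩
  rcases lt_trichotomy z.im 0 with h0 | h0 | h0
  · rw [jump, if_neg (not_lt.2 h0.le), if_pos h0, sqrt_mul_entry_of_neg ht hγ0 hγ1 h0]
    obtain ⟨e1, e2⟩ := up (-z) (by simp; linarith) (by simp; linarith)
    obtain ⟨e3, e4⟩ := down z h0
    rw [neg_neg] at e1 e2
    ext i k
    fin_cases k
    · simp only [assemble, Fin.zero_eta, Matrix.of_apply, Matrix.cons_val_zero, Matrix.mul_apply,
        Fin.sum_univ_two, Matrix.cons_val_one, Matrix.cons_val_fin_one, e1, e2]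
      linear_combination (-(coeffPlus i * upperEntry t γ (-z) * Wp z) -
        coeffMinus i * upperEntry t γ (-z) * Wm z) * Complex.I_sq
    · simp only [assemble, Fin.mk_one, Matrix.of_apply, Matrix.cons_val_zero, Matrix.mul_apply,
        Fin.sum_univ_two, Matrix.cons_val_one, Matrix.cons_val_fin_one, e3, e4]
      ring
  · have hzr : z = (z.re : ℂ) := by
      apply Complex.ext <;> simp [h0]
    rw [jump, if_neg h0.not_gt, if_neg h0.not_lt, phaseReal_one ht hγ0 hγ1,
      phaseReal_neg_one ht hγ0 hγ1]
    have e5 := upperEntry_mul_upperEntry_neg ht hγ0 hγ1 z.re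
    rw [← hzr] at e5 ⊢
    obtain ⟨e1, e2⟩ := up z h0.ge (by linarith)
    obtain ⟨e3, e4⟩ := up (-z) (by simp [h0]) (by simp; linarith)
    rw [neg_neg] at e3 e4
    ext i k
    fin_cases k
    · simp only [assemble, Fin.zero_eta, Matrix.of_apply, Matrix.cons_val_zero, Matrix.mul_apply,
        Fin.sum_univ_two, Matrix.cons_val_one, Matrix.cons_val_fin_one, e3, e4]
      linear_combination (-(coeffPlus i * upperEntry t γ (-z) * Wp z) -
        coeffMinus i * upperEntry t γ (-z) * Wm z) * Complex.I_sq
    · simp only [assemble, Fin.mk_one, Matrix.of_apply, Matrix.cons_val_zero, Matrix.mul_apply,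
        Fin.sum_univ_two, Matrix.cons_val_one, Matrix.cons_val_fin_one, e1, e2, e3, e4]
      linear_combination (coeffPlus i * Wp z + coeffMinus i * Wm z) * e5 -
        (coeffPlus i * Wp z + coeffMinus i * Wm z) * upperEntry t γ z * upperEntry t γ (-z) *
          Complex.I_sq
  · rw [jump, if_pos h0, sqrt_mul_entry_of_pos ht hγ0 hγ1 h0]
    obtain ⟨e1, e2⟩ := up z h0.le (by linarith)
    obtain ⟨e3, e4⟩ := down (-z) (by simpa using h0)
    ext i k
    fin_cases k
    · simp only [assemble, Fin.zero_eta, Matrix.of_apply, Matrix.cons_val_zero, Matrix.mul_apply,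
        Fin.sum_univ_two, Matrix.cons_val_one, Matrix.cons_val_fin_one, e3, e4]
      ring
    · simp only [assemble, Fin.mk_one, Matrix.of_apply, Matrix.cons_val_zero, Matrix.mul_apply,
        Fin.sum_univ_two, Matrix.cons_val_one, Matrix.cons_val_fin_one, e1, e2, e3, e4]
      ring

lemma exists_matrix_asymptotics {A : ℂ → ℂ} {D : ℝ}
    (hp : IsScalarSolution A (delta t γ) D I Wp)
    (hm : IsScalarSolution A (delta t γ) D (-I) Wm) : ∃ K : ℝ, ∀ i k : Fin 2, ∀ z : ℂ, 3 ≤ ‖z‖ →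
      ‖(matrixSolution A (delta t γ) Wp Wm z - 1 - z⁻¹ • matrixCoeff A D Wp Wm) i k‖ ≤
        K * ‖z⁻¹ ^ 2‖ := by
  obtain ⟨K₁, h₁⟩ := hp.exists_piecewise_asymptotics
  obtain ⟨K₂, h₂⟩ := hm.exists_piecewise_asymptotics
  have hcp : ∀ i, ‖coeffPlus i‖ = 1 / 2 := fun i => by fin_cases i <;> simp [coeffPlus]
  have hcm : ∀ i, ‖coeffMinus i‖ = 1 / 2 := fun i => by fin_cases i <;> simp [coeffMinus]
  have key : ∀ (P Q u v : ℂ) (r : ℝ), ‖P‖ = 1 / 2 → ‖Q‖ = 1 / 2 → ‖u‖ ≤ K₁ * r → ‖v‖ ≤ K₂ * r →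
      ‖P * u + Q * v‖ ≤ (1 / 2 * K₁ + 1 / 2 * K₂) * r := by
    intro P Q u v r hP hQ hu hv
    refine (norm_add_le _ _).trans ?_
    rw [norm_mul, norm_mul, hP, hQ]
    linarith
  refine ⟨1 / 2 * K₁ + 1 / 2 * K₂, fun i k z hz => ?_⟩
  fin_cases k
  · have hz' : 3 ≤ ‖-z‖ := by rwa [norm_neg]
    have a1 := h₁ (-z) hz'
    have a2 := h₂ (-z) hz'
    rw [inv_neg, neg_sq] at a1 a2
    have := key (I * coeffPlus i) (-I * coeffMinus i) _ _ _
      (by rw [norm_mul, Complex.norm_I, one_mul, hcp])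
      (by rw [norm_mul, norm_neg, Complex.norm_I, one_mul, hcm]) a1 a2
    refine le_trans (le_of_eq (congrArg norm ?_)) this
    simp only [matrixSolution, assemble, matrixCoeff, Matrix.sub_apply, Matrix.smul_apply,
      Fin.zero_eta, Matrix.of_apply, Matrix.cons_val_zero, smul_eq_mul]
    linear_combination I_mul_coeff_add i
  · have := key (coeffPlus i) (coeffMinus i) _ _ _ (hcp i) (hcm i) (h₁ z hz) (h₂ z hz)
    refine le_trans (le_of_eq (congrArg norm ?_)) this
    simp only [matrixSolution, assemble, matrixCoeff, Matrix.sub_apply, Matrix.smul_apply,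
      Fin.mk_one, Matrix.of_apply, Matrix.cons_val_one, Matrix.cons_val_fin_one, smul_eq_mul]
    linear_combination coeff_add i

lemma eventually_atInfinity_norm_ge (R : ℝ) : ∀ᶠ z in atInfinity t γ, R ≤ ‖z‖ := by
  have h1 : Tendsto (fun z : ℂ => ‖z‖) (atInfinity t γ) atTop :=
    tendsto_norm_cobounded_atTop.mono_left inf_le_left
  exact h1.eventually_ge_atTop R

theorem isSolution_matrixSolution (ht : t ≠ 0) (hγ0 : 0 < γ) (hγ1 : γ < 1)
    (hp : IsScalarSolution (upperEntry t γ) (delta t γ) (6 / 5 * delta t γ) I Wp)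
    (hm : IsScalarSolution (upperEntry t γ) (delta t γ) (6 / 5 * delta t γ) (-I) Wm) :
    IsSolution t γ (matrixSolution (upperEntry t γ) (delta t γ) Wp Wm) where
  analytic := by
    intro i k z hz
    have h1 : z.im ≠ upperHeight (delta t γ) z.re := fun h0 => hz (mem_contour_iff.2 (Or.inl h0))
    have h2 : (-z).im ≠ upperHeight (delta t γ) (-z).re := fun h0 =>
      hz (neg_mem_contour.1 (mem_contour_iff.2 (Or.inl h0)))
    refine DifferentiableAt.differentiableWithinAt ?_
    fin_cases k
    · exact (((hp.differentiableAt_piecewise h2).comp z differentiable_neg.differentiableAt).const_mul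
        _).add (((hm.differentiableAt_piecewise h2).comp z
          differentiable_neg.differentiableAt).const_mul _)
    · exact ((hp.differentiableAt_piecewise h1).const_mul _).add
        ((hm.differentiableAt_piecewise h1).const_mul _)
  cauchy_rep := by
    refine ⟨fun w => Matrix.of fun i k =>
      ![-combinedDensity (upperEntry t γ) Wp Wm (I * coeffPlus i) (-I * coeffMinus i) (-w),
        combinedDensity (upperEntry t γ) Wp Wm (coeffPlus i) (coeffMinus i) w] k, ?_, ?_⟩
    · intro i k
      fin_cases k
      · exact (memLp_comp_neg (memLp_combinedDensity hp hm _ _)).neg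
      · exact memLp_combinedDensity hp hm _ _
    · intro z hz
      have h1 : z.im ≠ upperHeight (delta t γ) z.re := fun h0 => hz (mem_contour_iff.2 (Or.inl h0))
      have h2 : (-z).im ≠ upperHeight (delta t γ) (-z).re := fun h0 =>
        hz (neg_mem_contour.1 (mem_contour_iff.2 (Or.inl h0)))
      ext i k
      fin_cases k
      · have e := combined_eq_lineIntegral hp hm (I * coeffPlus i) (-I * coeffMinus i) h2
        rw [← lineIntegral_comp_neg, I_mul_coeff_add] at e
        simp only [matrixSolution, assemble, cauchy, Matrix.add_apply, Fin.zero_eta,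
          Matrix.of_apply, Matrix.cons_val_zero]
        rw [e]
        congr 3
        funext w
        rw [neg_div, ← div_neg]
        congr 1
        ring
      · have e := combined_eq_lineIntegral hp hm (coeffPlus i) (coeffMinus i) h1
        rw [coeff_add] at e
        simp only [matrixSolution, assemble, cauchy, Matrix.add_apply, Fin.mk_one,
          Matrix.of_apply, Matrix.cons_val_one, Matrix.cons_val_fin_one]
        exact e
  jump_rel := by
    refine ⟨assemble (valueFromAbove (upperEntry t γ) (delta t γ) I Wp)
      (valueFromAbove (upperEntry t γ) (delta t γ) (-I) Wm) Wp Wm,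
      assemble Wp Wm (valueFromAbove (upperEntry t γ) (delta t γ) I Wp)
      (valueFromAbove (upperEntry t γ) (delta t γ) (-I) Wm),
      isL2_assemble hp.memLp_valueFromAbove_sub_one hm.memLp_valueFromAbove_sub_one
        hp.memLp_sub_one hm.memLp_sub_one,
      isL2_assemble hp.memLp_sub_one hm.memLp_sub_one hp.memLp_valueFromAbove_sub_one
        hm.memLp_valueFromAbove_sub_one, ?_⟩
    rw [ae_arcLength_iff]
    intro j
    filter_upwards [ae_restrict_mem (measurableSet_interval j)] with x hx
    have hz : param t γ j x ∈ contour t γ := Set.mem_iUnion.2 ⟨j, x, hx, rfl⟩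
    have hz' := neg_mem_contour.2 hz
    refine ⟨?_, ?_, jump_relation ht hγ0 hγ1 hp hm hz⟩
    · refine tendsto_pi_nhds.2 fun i => tendsto_pi_nhds.2 fun k => ?_
      fin_cases k
      · have l1 := (hp.tendsto_from_below hz').const_mul (I * coeffPlus i)
        have l2 := (hm.tendsto_from_below hz').const_mul (-I * coeffMinus i)
        refine (l1.add l2).congr fun η => ?_
        simp only [matrixSolution, assemble, Fin.zero_eta, Matrix.of_apply, Matrix.cons_val_zero,
          neg_add, sub_eq_add_neg]
      · exact ((hp.tendsto_from_above hz).const_mul _).add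
          ((hm.tendsto_from_above hz).const_mul _)
    · refine tendsto_pi_nhds.2 fun i => tendsto_pi_nhds.2 fun k => ?_
      fin_cases k
      · have l1 := (hp.tendsto_from_above hz').const_mul (I * coeffPlus i)
        have l2 := (hm.tendsto_from_above hz').const_mul (-I * coeffMinus i)
        refine (l1.add l2).congr fun η => ?_
        simp only [matrixSolution, assemble, Fin.zero_eta, Matrix.of_apply, Matrix.cons_val_zero,
          neg_sub', sub_neg_eq_add]
      · exact ((hp.tendsto_from_below hz).const_mul _).add
          ((hm.tendsto_from_below hz).const_mul _)
  asymptotics := by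
    obtain ⟨K, hK⟩ := exists_matrix_asymptotics hp hm
    refine ⟨matrixCoeff (upperEntry t γ) (6 / 5 * delta t γ) Wp Wm, fun i k => ?_⟩
    refine Asymptotics.IsBigO.of_bound K ?_
    filter_upwards [eventually_atInfinity_norm_ge 3] with z hz using hK i k z hz

theorem tendsto_matrixSolution {A : ℂ → ℂ} {D : ℝ}
    (hp : IsScalarSolution A (delta t γ) D I Wp)
    (hm : IsScalarSolution A (delta t γ) D (-I) Wm) :
    Tendsto (fun z : ℂ => z • (matrixSolution A (delta t γ) Wp Wm z - 1)) (atInfinity t γ)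
      (𝓝 (matrixCoeff A D Wp Wm)) := by
  obtain ⟨K, hK⟩ := exists_matrix_asymptotics hp hm
  refine tendsto_pi_nhds.2 fun i => tendsto_pi_nhds.2 fun k => ?_
  rw [tendsto_iff_norm_sub_tendsto_zero]
  have h1 : Tendsto (fun z : ℂ => K * ‖z‖⁻¹) (atInfinity t γ) (𝓝 0) := by
    have h2 : Tendsto (fun z : ℂ => ‖z‖) (atInfinity t γ) atTop :=
      tendsto_norm_cobounded_atTop.mono_left inf_le_left
    simpa using (tendsto_inv_atTop_zero.comp h2).const_mul K
  refine squeeze_zero' (Eventually.of_forall fun z => norm_nonneg _) ?_ h1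
  filter_upwards [eventually_atInfinity_norm_ge 3] with z hz
  have hz0 : z ≠ 0 := by
    rintro rfl
    rw [norm_zero] at hz
    linarith
  have h3 := mul_le_mul_of_nonneg_left (hK i k z hz) (norm_nonneg z)
  rw [← norm_mul] at h3
  have hzn : ‖z‖ ≠ 0 := norm_ne_zero_iff.2 hz0
  calc _ = ‖z * (matrixSolution A (delta t γ) Wp Wm z - 1 - z⁻¹ • matrixCoeff A D Wp Wm) i k‖ := by
        congr 1
        simp only [Matrix.sub_apply, Matrix.smul_apply, smul_eq_mul]
        field_simp
    _ ≤ ‖z‖ * (K * ‖z⁻¹ ^ 2‖) := h3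
    _ = K * ‖z‖⁻¹ := by
        rw [norm_pow, norm_inv]
        field_simp

lemma norm_matrixCoeff_le {A : ℂ → ℂ} {D : ℝ} (hp : IsScalarSolution A (delta t γ) D I Wp)
    (hm : IsScalarSolution A (delta t γ) D (-I) Wm) (i k : Fin 2) :
    ‖matrixCoeff A D Wp Wm i k‖ ≤ ∫ x : ℝ, ‖A (x + I * D)‖ := by
  have hcp : ∀ i, ‖coeffPlus i‖ = 1 / 2 := fun i => by fin_cases i <;> simp [coeffPlus]
  have hcm : ∀ i, ‖coeffMinus i‖ = 1 / 2 := fun i => by fin_cases i <;> simp [coeffMinus]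
  have h1 := hp.norm_firstCoeff_le Complex.norm_I
  have h2 := hm.norm_firstCoeff_le (by rw [norm_neg, Complex.norm_I])
  have key : ∀ (P Q : ℂ), ‖P‖ = 1 / 2 → ‖Q‖ = 1 / 2 →
      ‖P * firstCoeff A D I Wp + Q * firstCoeff A D (-I) Wm‖ ≤ ∫ x : ℝ, ‖A (x + I * D)‖ := by
    intro P Q hP hQ
    refine (norm_add_le _ _).trans ?_
    rw [norm_mul, norm_mul, hP, hQ]
    linarith
  fin_cases k
  · simp only [matrixCoeff, Fin.zero_eta, Matrix.of_apply, Matrix.cons_val_zero]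
    rw [norm_neg]
    exact key _ _ (by rw [norm_mul, Complex.norm_I, one_mul, hcp])
      (by rw [norm_mul, norm_neg, Complex.norm_I, one_mul, hcm])
  · exact key _ _ (hcp i) (hcm i)

end

/-! ### Schur's test -/

section

variable {α : Type*} [MeasurableSpace α] {μ : Measure α}

lemma sq_lintegral_mul_le {k p v : α → ENNReal} (hk : AEMeasurable k μ) (hp : AEMeasurable p μ)
    (hv : AEMeasurable v μ) (hp0 : ∀ᵐ y ∂μ, p y ≠ 0) (hpt : ∀ᵐ y ∂μ, p y ≠ ⊤) :
    (∫⁻ y, k y * v y ∂μ) ^ 2 ≤ (∫⁻ y, k y * p y ∂μ) * ∫⁻ y, k y * (v y ^ 2 / p y) ∂μ := by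
  have h1 := ENNReal.lintegral_mul_norm_pow_le (hk.mul hp) (hk.mul ((hv.pow_const 2).div hp))
    (p := 1 / 2) (q := 1 / 2) (by norm_num) (by norm_num) (by norm_num)
  have h2 : ∫⁻ y, k y * v y ∂μ = ∫⁻ y, ((k * p) y) ^ (1 / 2 : ℝ) *
      ((k * (fun y => v y ^ 2) / p) y) ^ (1 / 2 : ℝ) ∂μ := by
    refine lintegral_congr_ae ?_
    filter_upwards [hp0, hpt] with y h0 ht
    rw [← ENNReal.mul_rpow_of_nonneg _ _ (by norm_num)]
    have : (k * p) y * (k * (fun y => v y ^ 2) / p) y = (k y * v y) ^ (2 : ℝ) := by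
      simp only [Pi.mul_apply, Pi.div_apply]
      rw [div_eq_mul_inv]
      calc k y * p y * (k y * v y ^ 2 * (p y)⁻¹) = (k y * v y) ^ 2 * (p y * (p y)⁻¹) := by ring
        _ = (k y * v y) ^ (2 : ℝ) := by
          rw [ENNReal.mul_inv_cancel h0 ht, mul_one, ENNReal.rpow_two]
    rw [this, ← ENNReal.rpow_mul]
    norm_num
  have h3 : ∀ a b : ENNReal, (a ^ (1 / 2 : ℝ) * b ^ (1 / 2 : ℝ)) ^ 2 = a * b := by
    intro a b
    rw [← ENNReal.mul_rpow_of_nonneg _ _ (by norm_num), ← ENNReal.rpow_two, ← ENNReal.rpow_mul]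
    norm_num
  rw [← h3]
  refine pow_le_pow_left' ?_ 2
  rw [h2]
  refine le_trans (le_of_eq ?_) h1
  refine lintegral_congr fun y => ?_
  simp only [Pi.mul_apply, Pi.div_apply, mul_div_assoc]

/-- Schur's test for a nonnegative kernel, with the same weight in both variables. -/
lemma lintegral_sq_lintegral_le [SFinite μ] {k : α → α → ENNReal} {p v : α → ENNReal}
    {A : ENNReal} (hk : Measurable (Function.uncurry k)) (hp : Measurable p)
    (hv : AEMeasurable v μ) (hp0 : ∀ᵐ y ∂μ, p y ≠ 0) (hpt : ∀ᵐ y ∂μ, p y ≠ ⊤)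
    (h₁ : ∀ᵐ x ∂μ, ∫⁻ y, k x y * p y ∂μ ≤ A * p x) (h₂ : ∀ᵐ y ∂μ, ∫⁻ x, k x y * p x ∂μ ≤ A * p y) :
    ∫⁻ x, (∫⁻ y, k x y * v y ∂μ) ^ 2 ∂μ ≤ A ^ 2 * ∫⁻ y, v y ^ 2 ∂μ := by
  wlog hv' : Measurable v generalizing v
  · have e1 : ∀ x, ∫⁻ y, k x y * v y ∂μ = ∫⁻ y, k x y * hv.mk v y ∂μ := fun x =>
      lintegral_congr_ae (hv.ae_eq_mk.mono fun y hy => by simp only [hy])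
    have e2 : ∫⁻ y, v y ^ 2 ∂μ = ∫⁻ y, hv.mk v y ^ 2 ∂μ :=
      lintegral_congr_ae (hv.ae_eq_mk.mono fun y hy => by simp only [hy])
    simp only [e1, e2]
    exact this hv.measurable_mk.aemeasurable hv.measurable_mk
  have hkx : ∀ x, Measurable (k x) := fun x => hk.comp measurable_prodMk_left
  have hky : ∀ y, Measurable fun x => k x y := fun y => hk.comp measurable_prodMk_right
  have hq : Measurable fun y => v y ^ 2 / p y := (hv'.pow_const 2).div hp
  calc ∫⁻ x, (∫⁻ y, k x y * v y ∂μ) ^ 2 ∂μ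
      ≤ ∫⁻ x, ∫⁻ y, A * p x * (k x y * (v y ^ 2 / p y)) ∂μ ∂μ := by
        refine lintegral_mono_ae ?_
        filter_upwards [h₁] with x hx
        rw [lintegral_const_mul (f := fun y => k x y * (v y ^ 2 / p y)) _ ((hkx x).mul hq)]
        exact (sq_lintegral_mul_le (hkx x).aemeasurable hp.aemeasurable hv hp0 hpt).trans
          (by gcongr)
    _ = ∫⁻ y, ∫⁻ x, A * p x * (k x y * (v y ^ 2 / p y)) ∂μ ∂μ := by
        refine lintegral_lintegral_swap (Measurable.aemeasurable ?_)
        exact ((hp.comp measurable_fst).const_mul A).mul (hk.mul (hq.comp measurable_snd))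
    _ = ∫⁻ y, A * (v y ^ 2 / p y) * ∫⁻ x, k x y * p x ∂μ ∂μ := by
        refine lintegral_congr fun y => ?_
        rw [← lintegral_const_mul (f := fun x => k x y * p x) _ ((hky y).mul hp)]
        refine lintegral_congr fun x => ?_
        ring
    _ ≤ ∫⁻ y, A ^ 2 * v y ^ 2 ∂μ := by
        refine lintegral_mono_ae ?_
        filter_upwards [h₂, hp0, hpt] with y hy h0 ht
        calc A * (v y ^ 2 / p y) * ∫⁻ x, k x y * p x ∂μ
            ≤ A * (v y ^ 2 / p y) * (A * p y) := by gcongr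
          _ = A ^ 2 * v y ^ 2 * ((p y)⁻¹ * p y) := by rw [div_eq_mul_inv]; ring
          _ = A ^ 2 * v y ^ 2 := by rw [ENNReal.inv_mul_cancel h0 ht, mul_one]
    _ = A ^ 2 * ∫⁻ y, v y ^ 2 ∂μ := lintegral_const_mul _ (hv'.pow_const 2)

end

lemma integral_Ioi_inv_sqrt_div {X : ℝ} (hX : 0 < X) :
    IntegrableOn (fun y : ℝ => (√y)⁻¹ / (X + y)) (Set.Ioi 0) ∧
    ∫ y in Set.Ioi (0 : ℝ), (√y)⁻¹ / (X + y) = Real.pi * (√X)⁻¹ := by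
  have hsX : 0 < √X := Real.sqrt_pos.2 hX
  have hc : ContinuousWithinAt (fun y : ℝ => 2 * (√X)⁻¹ * Real.arctan (√y / √X)) (Set.Ici 0) 0 := by
    refine Continuous.continuousWithinAt ?_
    have : Continuous fun y : ℝ => √y / √X := Real.continuous_sqrt.div_const _
    exact (Real.continuous_arctan.comp this).const_mul _
  have hderiv : ∀ y ∈ Set.Ioi (0 : ℝ), HasDerivAt
      (fun y : ℝ => 2 * (√X)⁻¹ * Real.arctan (√y / √X)) ((√y)⁻¹ / (X + y)) y := by
    intro y hy
    have hy0 : (0 : ℝ) < y := hy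
    have hsy : 0 < √y := Real.sqrt_pos.2 hy0
    have h1 := (((Real.hasDerivAt_sqrt hy0.ne').div_const (√X)).arctan).const_mul (2 * (√X)⁻¹)
    refine h1.congr_deriv ?_
    have e1 : √X ^ 2 = X := Real.sq_sqrt hX.le
    have e2 : √y ^ 2 = y := Real.sq_sqrt hy0.le
    have h3 : X + y ≠ 0 := by positivity
    rw [div_pow, e1, e2]
    have h4 : 1 + y / X = (X + y) / X := by field_simp
    rw [h4]
    field_simp
    linear_combination -e1
  have hpos : ∀ y ∈ Set.Ioi (0 : ℝ), 0 ≤ (√y)⁻¹ / (X + y) := by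
    intro y hy
    have hy0 : (0 : ℝ) < y := hy
    positivity
  have hlim : Tendsto (fun y : ℝ => 2 * (√X)⁻¹ * Real.arctan (√y / √X)) atTop
      (𝓝 (2 * (√X)⁻¹ * (Real.pi / 2))) := by
    refine Tendsto.const_mul _ ?_
    refine (tendsto_nhds_of_tendsto_nhdsWithin Real.tendsto_arctan_atTop).comp ?_
    exact Real.tendsto_sqrt_atTop.atTop_div_const hsX
  refine ⟨integrableOn_Ioi_deriv_of_nonneg hc hderiv hpos hlim, ?_⟩
  rw [integral_Ioi_of_hasDerivAt_of_nonneg hc hderiv hpos hlim]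
  simp
  ring

lemma lintegral_inv_sqrt_div_le {x c : ℝ} (hx : x ≠ c) :
    ∫⁻ y : ℝ, ENNReal.ofReal (|x - c| + |y - c|)⁻¹ * ENNReal.ofReal (√|y - c|)⁻¹ ≤
      ENNReal.ofReal (2 * Real.pi) * ENNReal.ofReal (√|x - c|)⁻¹ := by
  have hX : 0 < |x - c| := abs_pos.2 (sub_ne_zero.2 hx)
  set X := |x - c|
  rw [lintegral_sub_right_eq_self (fun y => ENNReal.ofReal (X + |y|)⁻¹ * ENNReal.ofReal (√|y|)⁻¹) c]
  obtain ⟨hi, he⟩ := integral_Ioi_inv_sqrt_div hX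
  have h1 : ∫⁻ y in Set.Ioi (0 : ℝ), ENNReal.ofReal (X + |y|)⁻¹ * ENNReal.ofReal (√|y|)⁻¹ =
      ENNReal.ofReal (Real.pi * (√X)⁻¹) := by
    rw [← he, ofReal_integral_eq_lintegral_ofReal hi]
    · refine setLIntegral_congr_fun measurableSet_Ioi fun y hy => ?_
      have hy0 : (0 : ℝ) < y := hy
      rw [abs_of_pos hy0, ← ENNReal.ofReal_mul (by positivity), div_eq_inv_mul]
    · filter_upwards [ae_restrict_mem measurableSet_Ioi] with y hy
      have hy0 : (0 : ℝ) < y := hy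
      simp only [Pi.zero_apply]
      positivity
  have h2 : ∫⁻ y in Set.Iio (0 : ℝ), ENNReal.ofReal (X + |y|)⁻¹ * ENNReal.ofReal (√|y|)⁻¹ =
      ENNReal.ofReal (Real.pi * (√X)⁻¹) := by
    rw [← h1]
    have := (Measure.measurePreserving_neg (volume : Measure ℝ)).setLIntegral_comp_preimage_emb
      (MeasurableEquiv.neg ℝ).measurableEmbedding
      (fun y => ENNReal.ofReal (X + |y|)⁻¹ * ENNReal.ofReal (√|y|)⁻¹) (Set.Ioi 0)
    rw [← this]
    simp [abs_neg]
  rw [← lintegral_add_compl _ (measurableSet_Iio (a := (0 : ℝ))), Set.compl_Iio,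
    setLIntegral_congr Ioi_ae_eq_Ici.symm, h1, h2,
    ← ENNReal.ofReal_add (by positivity) (by positivity),
    ← ENNReal.ofReal_mul (by positivity)]
  exact le_of_eq (by ring_nf)

/-- The Hilbert-type kernel `(|x - c| + |y - c|)⁻¹` is bounded on `L²`: Schur's test with the weight
`|x - c| ^ (-1/2)`. -/
lemma lintegral_sq_hilbert_le (c : ℝ) {v : ℝ → ENNReal} (hv : AEMeasurable v) :
    ∫⁻ x : ℝ, (∫⁻ y : ℝ, ENNReal.ofReal (|x - c| + |y - c|)⁻¹ * v y) ^ 2 ≤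
      ENNReal.ofReal (2 * Real.pi) ^ 2 * ∫⁻ y, v y ^ 2 := by
  have hne : ∀ᵐ x : ℝ, x ≠ c := by
    have : ∀ᵐ x : ℝ, x ∉ ({c} : Set ℝ) := (Set.countable_singleton c).ae_notMem volume
    exact this
  refine lintegral_sq_lintegral_le (p := fun y => ENNReal.ofReal (√|y - c|)⁻¹) ?_ ?_ hv ?_ ?_ ?_ ?_
  · unfold Function.uncurry
    fun_prop
  · fun_prop
  · filter_upwards [hne] with y hy
    have : 0 < |y - c| := abs_pos.2 (sub_ne_zero.2 hy)
    rw [Ne, ENNReal.ofReal_eq_zero, not_le]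
    positivity
  · exact Eventually.of_forall fun y => ENNReal.ofReal_ne_top
  · filter_upwards [hne] with x hx using lintegral_inv_sqrt_div_le hx
  · filter_upwards [hne] with y hy
    refine le_trans (le_of_eq ?_) (lintegral_inv_sqrt_div_le hy)
    simp only [add_comm]

/-! ### Partial fractions on the real line -/

lemma norm_inv_sub_sq (α : ℂ) (x : ℝ) :
    ‖((x : ℂ) - α)⁻¹‖ ^ 2 = 1 / ((x - α.re) ^ 2 + α.im ^ 2) := by
  rw [norm_inv, inv_pow, ← Complex.normSq_eq_norm_sq, Complex.normSq_apply]
  simp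
  ring

lemma ofReal_sub_ne_zero {α : ℂ} (hα : α.im ≠ 0) (x : ℝ) : (x : ℂ) - α ≠ 0 := by
  intro h0
  have := congrArg Complex.im h0
  simp at this
  exact hα this

lemma integral_norm_inv_sub_sq {α : ℂ} (hα : α.im ≠ 0) :
    Integrable (fun x : ℝ => ‖((x : ℂ) - α)⁻¹‖ ^ 2) ∧
    ∫ x : ℝ, ‖((x : ℂ) - α)⁻¹‖ ^ 2 = Real.pi / |α.im| := by
  have hc : 0 < |α.im| := abs_pos.2 hα
  have e : ∀ x : ℝ, ‖((x : ℂ) - α)⁻¹‖ ^ 2 =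
      |α.im| / ((x - α.re) ^ 2 + |α.im| ^ 2) / |α.im| := by
    intro x
    rw [norm_inv_sub_sq, sq_abs, div_right_comm, div_self hc.ne']
  simp only [e]
  refine ⟨((integrable_div_sq_add_sq hc).comp_sub_right α.re).div_const _, ?_⟩
  rw [integral_div, integral_sub_right_eq_self (fun x => |α.im| / (x ^ 2 + |α.im| ^ 2)),
    integral_div_sq_add_sq hc]

lemma continuous_inv_sub {α : ℂ} (hα : α.im ≠ 0) : Continuous fun x : ℝ => ((x : ℂ) - α)⁻¹ :=
  Continuous.inv₀ (by fun_prop) (ofReal_sub_ne_zero hα)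

lemma memLp_inv_sub {α : ℂ} (hα : α.im ≠ 0) : MemLp (fun x : ℝ => ((x : ℂ) - α)⁻¹) 2 := by
  rw [memLp_two_iff_integrable_sq_norm (continuous_inv_sub hα).aestronglyMeasurable]
  exact (integral_norm_inv_sub_sq hα).1

lemma integrable_inv_sub_mul_inv_sub {α β : ℂ} (hα : α.im ≠ 0) (hβ : β.im ≠ 0) :
    Integrable fun x : ℝ => ((x : ℂ) - α)⁻¹ * ((x : ℂ) - β)⁻¹ :=
  (memLp_inv_sub hα).integrable_mul (memLp_inv_sub hβ)

lemma tendsto_div_atTop (w : ℂ) : Tendsto (fun v : ℝ => w / v) atTop (𝓝 0) := by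
  have h1 : Tendsto (fun v : ℝ => ((v⁻¹ : ℝ) : ℂ)) atTop (𝓝 ((0 : ℝ) : ℂ)) :=
    (Complex.continuous_ofReal.tendsto 0).comp tendsto_inv_atTop_zero
  have h2 := h1.const_mul w
  rw [Complex.ofReal_zero, mul_zero] at h2
  refine h2.congr fun v => ?_
  rw [Complex.ofReal_inv, div_eq_mul_inv]

lemma tendsto_log_sub_log_atTop {α : ℂ} (hα : α.im ≠ 0) :
    Tendsto (fun v : ℝ => Complex.log (v - α) - Complex.log v) atTop (𝓝 0) := by
  have h1 : Tendsto (fun v : ℝ => Complex.log (1 - α / v)) atTop (𝓝 0) := by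
    have h2 := (tendsto_div_atTop α).const_sub 1
    rw [sub_zero] at h2
    have h3 := (continuousAt_clog Complex.one_mem_slitPlane).tendsto.comp h2
    rwa [Complex.log_one] at h3
  refine h1.congr' ?_
  filter_upwards [eventually_gt_atTop 0] with v hv
  have hv0 : (v : ℂ) ≠ 0 := Complex.ofReal_ne_zero.2 hv.ne'
  have e : (v : ℂ) - α = v * (1 - α / v) := by field_simp
  have hne : 1 - α / v ≠ 0 := fun h0 => by
    rw [h0, mul_zero] at e
    exact ofReal_sub_ne_zero hα v e
  rw [e, Complex.log_ofReal_mul hv hne, Complex.ofReal_log hv.le]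
  ring

lemma tendsto_log_sub_log_atBot_of_pos {α : ℂ} (hα : 0 < α.im) :
    Tendsto (fun v : ℝ => Complex.log (-v - α) - Complex.log v) atTop (𝓝 (-(Real.pi * I))) := by
  have h1 : Tendsto (fun v : ℝ => Complex.log (-1 - α / v)) atTop (𝓝 (-(Real.pi * I))) := by
    have h2 := (tendsto_div_atTop α).const_sub (-1)
    rw [sub_zero] at h2
    have h3 := Complex.tendsto_log_nhdsWithin_im_neg_of_re_neg_of_im_zero (z := -1) (by simp)
      (by simp)
    simp only [norm_neg, norm_one, Real.log_one, Complex.ofReal_zero, zero_sub] at h3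
    refine h3.comp (tendsto_nhdsWithin_iff.2 ⟨h2, ?_⟩)
    filter_upwards [eventually_gt_atTop 0] with v hv
    simp [Complex.div_ofReal_im]
    positivity
  refine h1.congr' ?_
  filter_upwards [eventually_gt_atTop 0] with v hv
  have hv0 : (v : ℂ) ≠ 0 := Complex.ofReal_ne_zero.2 hv.ne'
  have e : -(v : ℂ) - α = v * (-1 - α / v) := by field_simp
  have hne : -1 - α / v ≠ 0 := fun h0 => by
    rw [h0, mul_zero] at e
    have := ofReal_sub_ne_zero hα.ne' (-v)
    rw [Complex.ofReal_neg] at this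
    exact this e
  rw [e, Complex.log_ofReal_mul hv hne, Complex.ofReal_log hv.le]
  ring

lemma tendsto_log_sub_log_atBot_of_neg {β : ℂ} (hβ : β.im < 0) :
    Tendsto (fun v : ℝ => Complex.log (-v - β) - Complex.log v) atTop (𝓝 (Real.pi * I)) := by
  have h1 : Tendsto (fun v : ℝ => Complex.log (-1 - β / v)) atTop (𝓝 (Real.pi * I)) := by
    have h2 := (tendsto_div_atTop β).const_sub (-1)
    rw [sub_zero] at h2
    have h3 := Complex.tendsto_log_nhdsWithin_im_nonneg_of_re_neg_of_im_zero (z := -1) (by simp)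
      (by simp)
    simp only [norm_neg, norm_one, Real.log_one, Complex.ofReal_zero, zero_add] at h3
    refine h3.comp (tendsto_nhdsWithin_iff.2 ⟨h2, ?_⟩)
    filter_upwards [eventually_gt_atTop 0] with v hv
    simp [Complex.div_ofReal_im]
    exact div_nonpos_of_nonpos_of_nonneg hβ.le hv.le
  refine h1.congr' ?_
  filter_upwards [eventually_gt_atTop 0] with v hv
  have hv0 : (v : ℂ) ≠ 0 := Complex.ofReal_ne_zero.2 hv.ne'
  have e : -(v : ℂ) - β = v * (-1 - β / v) := by field_simp
  have hne : -1 - β / v ≠ 0 := fun h0 => by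
    rw [h0, mul_zero] at e
    have := ofReal_sub_ne_zero hβ.ne (-v)
    rw [Complex.ofReal_neg] at this
    exact this e
  rw [e, Complex.log_ofReal_mul hv hne, Complex.ofReal_log hv.le]
  ring

lemma integral_inv_sub_sub_inv_sub {α β : ℂ} (hα : 0 < α.im) (hβ : β.im < 0) :
    ∫ x : ℝ, (((x : ℂ) - α)⁻¹ - ((x : ℂ) - β)⁻¹) = 2 * Real.pi * I := by
  have hd : ∀ (δ : ℂ), δ.im ≠ 0 → ∀ x : ℝ,
      HasDerivAt (fun x : ℝ => Complex.log ((x : ℂ) - δ)) ((x : ℂ) - δ)⁻¹ x := by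
    intro δ hδ x
    have h1 : HasDerivAt (fun x : ℝ => (x : ℂ) - δ) 1 x :=
      (Complex.ofRealCLM.hasDerivAt (x := x)).sub_const δ
    have h2 := h1.clog_real (Complex.mem_slitPlane_iff.2 (Or.inr (by simpa using hδ)))
    exact h2.congr_deriv (one_div _)
  have hint : Integrable fun x : ℝ => (((x : ℂ) - α)⁻¹ - ((x : ℂ) - β)⁻¹) := by
    refine ((integrable_inv_sub_mul_inv_sub hα.ne' hβ.ne).const_mul (α - β)).congr
      (Eventually.of_forall fun x => ?_)
    have h1 := ofReal_sub_ne_zero hα.ne' x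
    have h2 := ofReal_sub_ne_zero hβ.ne x
    simp only
    field_simp
    ring
  have htop := (tendsto_log_sub_log_atTop hα.ne').sub (tendsto_log_sub_log_atTop hβ.ne)
  have hbot := ((tendsto_log_sub_log_atBot_of_pos hα).sub
    (tendsto_log_sub_log_atBot_of_neg hβ)).comp tendsto_neg_atBot_atTop
  rw [integral_of_hasDerivAt_of_tendsto
    (f := fun x : ℝ => Complex.log ((x : ℂ) - α) - Complex.log ((x : ℂ) - β))
    (fun x => (hd α hα.ne' x).sub (hd β hβ.ne x)) hint
    (m := -(Real.pi * I) - Real.pi * I) (n := 0 - 0) ?_ ?_]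
  · ring
  · refine hbot.congr fun x => ?_
    simp
  · refine htop.congr fun x => ?_
    simp

lemma integral_inv_sub_mul_inv_sub {α β : ℂ} (hα : 0 < α.im) (hβ : β.im < 0) :
    ∫ x : ℝ, ((x : ℂ) - α)⁻¹ * ((x : ℂ) - β)⁻¹ = 2 * Real.pi * I / (α - β) := by
  have hne : α - β ≠ 0 := fun h0 => by
    have := congrArg Complex.im h0
    simp at this
    linarith
  rw [eq_div_iff hne, ← integral_inv_sub_sub_inv_sub hα hβ, mul_comm, ← integral_const_mul]
  refine integral_congr_ae (Eventually.of_forall fun x => ?_)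
  have h1 := ofReal_sub_ne_zero hα.ne' x
  have h2 := ofReal_sub_ne_zero hβ.ne x
  simp only
  field_simp
  ring

/-! ### Cauchy integrals of square integrable functions on the real line -/

/-- The Cauchy integral `∫ f(y) (y - z)⁻¹ dy`, without the factor `(2πi)⁻¹`. -/
noncomputable def cauchyReal (f : ℝ → ℂ) (z : ℂ) : ℂ := ∫ y : ℝ, f y * ((y : ℂ) - z)⁻¹

lemma integrable_mul_inv_sub {f : ℝ → ℂ} (hf : MemLp f 2) {z : ℂ} (hz : z.im ≠ 0) :
    Integrable fun y : ℝ => f y * ((y : ℂ) - z)⁻¹ :=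
  hf.integrable_mul (memLp_inv_sub hz)

lemma aestronglyMeasurable_cauchyReal {f : ℝ → ℂ} (hf : AEStronglyMeasurable f) (w : ℂ) :
    AEStronglyMeasurable fun x : ℝ => cauchyReal f (x + w) := by
  have h1 : Measurable fun p : ℝ × ℝ => ((p.2 : ℂ) - (p.1 + w))⁻¹ := by fun_prop
  have h2 : AEStronglyMeasurable (fun p : ℝ × ℝ => f p.2 * ((p.2 : ℂ) - (p.1 + w))⁻¹)
      (volume.prod volume) := hf.comp_snd.mul h1.aestronglyMeasurable
  exact h2.integral_prod_right'

lemma norm_mul_le_half_add_sq (a b : ℂ) : ‖a * b‖ ≤ 1 / 2 * (‖a‖ ^ 2 + ‖b‖ ^ 2) := by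
  rw [norm_mul]
  nlinarith [sq_nonneg (‖a‖ - ‖b‖)]

lemma integral_norm_inv_sub_mul_inv_sub_le {α β : ℂ} {η : ℝ} (hη : 0 < η) (hα : |α.im| = η)
    (hβ : |β.im| = η) : ∫ x : ℝ, ‖((x : ℂ) - α)⁻¹ * ((x : ℂ) - β)⁻¹‖ ≤ Real.pi / η := by
  have hα0 : α.im ≠ 0 := abs_pos.1 (hα ▸ hη)
  have hβ0 : β.im ≠ 0 := abs_pos.1 (hβ ▸ hη)
  obtain ⟨i1, e1⟩ := integral_norm_inv_sub_sq hα0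
  obtain ⟨i2, e2⟩ := integral_norm_inv_sub_sq hβ0
  have h1 := integral_mono (integrable_inv_sub_mul_inv_sub hα0 hβ0).norm
    ((i1.add i2).const_mul (1 / 2)) fun x => norm_mul_le_half_add_sq _ _
  refine h1.trans (le_of_eq ?_)
  have h2 := integral_add i1 i2
  simp only [Pi.add_apply]
  rw [integral_const_mul, h2, e1, e2, hα, hβ]
  ring

lemma integrable_triple {f : ℝ → ℝ} (hf : Integrable f) {η : ℝ} (hη : 0 < η) :
    Integrable (fun p : ℝ × ℝ × ℝ => (f p.2.1 * f p.2.2 : ℂ) *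
      (((p.1 : ℂ) - (p.2.1 + I * η))⁻¹ * ((p.1 : ℂ) - (p.2.2 - I * η))⁻¹))
      (volume.prod (volume.prod volume)) := by
  have hfc := hf.ofReal (𝕜 := ℂ)
  have hff : Integrable (fun q : ℝ × ℝ => (f q.1 * f q.2 : ℂ)) (volume.prod volume) :=
    hfc.mul_prod hfc
  have hk : Measurable fun p : ℝ × ℝ × ℝ =>
      ((p.1 : ℂ) - (p.2.1 + I * η))⁻¹ * ((p.1 : ℂ) - (p.2.2 - I * η))⁻¹ := by fun_prop
  have hm : AEStronglyMeasurable (fun p : ℝ × ℝ × ℝ => (f p.2.1 * f p.2.2 : ℂ) *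
      (((p.1 : ℂ) - (p.2.1 + I * η))⁻¹ * ((p.1 : ℂ) - (p.2.2 - I * η))⁻¹))
      (volume.prod (volume.prod volume)) :=
    (hff.1.comp_snd).mul hk.aestronglyMeasurable
  have him : ∀ y : ℝ, |((y : ℂ) + I * η).im| = η ∧ |((y : ℂ) - I * η).im| = η := fun y => by
    simp [abs_of_pos hη]
  rw [integrable_prod_iff' hm]
  constructor
  · refine Eventually.of_forall fun q => ?_
    have i1 : ((q.1 : ℂ) + I * η).im ≠ 0 := by simpa using hη.ne'
    have i2 : ((q.2 : ℂ) - I * η).im ≠ 0 := by simpa using hη.ne'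
    exact (integrable_inv_sub_mul_inv_sub i1 i2).const_mul (f q.1 * f q.2 : ℂ)
  · refine Integrable.mono' (hff.norm.mul_const (Real.pi / η))
      hm.norm.prod_swap.integral_prod_right' ?_
    refine Eventually.of_forall fun q => ?_
    rw [Real.norm_eq_abs, abs_of_nonneg (integral_nonneg fun _ => norm_nonneg _)]
    have e : ∀ x : ℝ, ‖(f q.1 * f q.2 : ℂ) *
        (((x : ℂ) - (q.1 + I * η))⁻¹ * ((x : ℂ) - (q.2 - I * η))⁻¹)‖ = ‖(f q.1 * f q.2 : ℂ)‖ *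
        ‖((x : ℂ) - (q.1 + I * η))⁻¹ * ((x : ℂ) - (q.2 - I * η))⁻¹‖ := fun x => norm_mul _ _
    simp only [e]
    rw [integral_const_mul]
    exact mul_le_mul_of_nonneg_left
      (integral_norm_inv_sub_mul_inv_sub_le hη (him _).1 (him _).2) (norm_nonneg _)

lemma integral_sq_mul_poisson {f : ℝ → ℝ} (hf2 : Integrable fun y => f y ^ 2) {c : ℝ}
    (hc : 0 < c) :
    Integrable (fun q : ℝ × ℝ => f q.1 ^ 2 * (c / ((q.1 - q.2) ^ 2 + c ^ 2)))
      (volume.prod volume) ∧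
    ∫ q : ℝ × ℝ, f q.1 ^ 2 * (c / ((q.1 - q.2) ^ 2 + c ^ 2)) = Real.pi * ∫ y, f y ^ 2 := by
  have hk : Measurable fun q : ℝ × ℝ => c / ((q.1 - q.2) ^ 2 + c ^ 2) := by fun_prop
  have hm : AEStronglyMeasurable (fun q : ℝ × ℝ => f q.1 ^ 2 * (c / ((q.1 - q.2) ^ 2 + c ^ 2)))
      (volume.prod volume) := hf2.1.comp_fst.mul hk.aestronglyMeasurable
  have h1 : ∀ y : ℝ, ∫ y' : ℝ, f y ^ 2 * (c / ((y - y') ^ 2 + c ^ 2)) = f y ^ 2 * Real.pi := by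
    intro y
    rw [integral_const_mul, integral_sub_left_eq_self (fun u => c / (u ^ 2 + c ^ 2)),
      integral_div_sq_add_sq hc]
  have hi : Integrable (fun q : ℝ × ℝ => f q.1 ^ 2 * (c / ((q.1 - q.2) ^ 2 + c ^ 2)))
      (volume.prod volume) := by
    rw [integrable_prod_iff hm]
    refine ⟨Eventually.of_forall fun y =>
      ((integrable_div_sq_add_sq hc).comp_sub_left y).const_mul (f y ^ 2), ?_⟩
    refine (hf2.mul_const Real.pi).congr (Eventually.of_forall fun y => ?_)
    simp only
    rw [← h1 y]
    refine integral_congr_ae (Eventually.of_forall fun y' => ?_)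
    exact (Real.norm_of_nonneg (by positivity)).symm
  refine ⟨hi, ?_⟩
  rw [Measure.volume_eq_prod, integral_prod _ hi]
  simp only [h1]
  rw [integral_mul_const, mul_comm]

/-- For a real density the square of the `L²` norm of the Cauchy integral is a quadratic form with a
Poisson kernel, since it is real and the imaginary part of the kernel is odd. -/
lemma lintegral_sq_cauchyReal_le_of_real {f : ℝ → ℝ} (hf : Integrable f)
    (hf2 : Integrable fun y => f y ^ 2) {η : ℝ} (hη : 0 < η) :
    ∫⁻ x : ℝ, ‖cauchyReal (fun y => (f y : ℂ)) (x - I * η)‖ₑ ^ 2 ≤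
      ENNReal.ofReal (2 * Real.pi ^ 2 * ∫ y, f y ^ 2) := by
  set F : ℝ → ℂ := fun x => cauchyReal (fun y => (f y : ℂ)) (x - I * η) with hF
  set Φ : ℝ × ℝ × ℝ → ℂ := fun p => (f p.2.1 * f p.2.2 : ℂ) *
      (((p.1 : ℂ) - (p.2.1 + I * η))⁻¹ * ((p.1 : ℂ) - (p.2.2 - I * η))⁻¹) with hΦ
  have hΦi : Integrable Φ (volume.prod (volume.prod volume)) := integrable_triple hf hη
  have h1 : ∀ x, ∫ q, Φ (x, q) ∂(volume.prod volume) = ((‖F x‖ ^ 2 : ℝ) : ℂ) := by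
    intro x
    have e1 : ∀ q : ℝ × ℝ, Φ (x, q) = (f q.1 * ((q.1 : ℂ) - (x - I * η))⁻¹) *
        (starRingEnd ℂ (f q.2 * ((q.2 : ℂ) - (x - I * η))⁻¹)) := by
      intro q
      simp only [hΦ, map_mul, map_inv₀, map_sub, Complex.conj_ofReal, Complex.conj_I]
      have e2 : (q.1 : ℂ) - (x - I * η) = -((x : ℂ) - (q.1 + I * η)) := by ring
      have e3 : (q.2 : ℂ) - (x - -I * η) = -((x : ℂ) - (q.2 - I * η)) := by ring
      rw [e2, e3, inv_neg, inv_neg]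
      ring
    simp only [e1]
    rw [integral_prod_mul (fun y : ℝ => (f y : ℂ) * ((y : ℂ) - (x - I * η))⁻¹)
      (fun y : ℝ => starRingEnd ℂ ((f y : ℂ) * ((y : ℂ) - (x - I * η))⁻¹)), integral_conj]
    have := Complex.mul_conj' (F x)
    rw [Complex.ofReal_pow]
    exact this
  have hFi : Integrable fun x => ‖F x‖ ^ 2 := by
    have := hΦi.integral_prod_left.re
    refine this.congr (Eventually.of_forall fun x => ?_)
    simp only [h1]
    exact Complex.ofReal_re _
  have h2 : ∀ q : ℝ × ℝ, ∫ x, Φ (x, q) = (f q.1 * f q.2 : ℂ) *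
      (2 * Real.pi * I / ((q.1 + I * η) - (q.2 - I * η))) := by
    intro q
    simp only [hΦ]
    rw [integral_const_mul, integral_inv_sub_mul_inv_sub (by simpa using hη) (by simpa using hη)]
  have hre : ∀ q : ℝ × ℝ, (∫ x, Φ (x, q)).re =
      f q.1 * f q.2 * (2 * Real.pi * (2 * η / ((q.1 - q.2) ^ 2 + (2 * η) ^ 2))) := by
    intro q
    rw [h2]
    have e1 : (2 * Real.pi * I / ((q.1 + I * η) - (q.2 - I * η)) : ℂ) =
        ((2 * Real.pi : ℝ) : ℂ) * (I / ((q.1 - q.2 : ℝ) + (2 * η : ℝ) * I)) := by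
      push_cast
      ring
    rw [e1, ← Complex.ofReal_mul, Complex.re_ofReal_mul, Complex.re_ofReal_mul,
      Complex.div_re]
    simp only [Complex.I_re, Complex.I_im, Complex.add_re, Complex.add_im, Complex.ofReal_re,
      Complex.ofReal_im, Complex.mul_re, Complex.mul_im, Complex.normSq_apply]
    ring
  obtain ⟨hP1, eP1⟩ := integral_sq_mul_poisson hf2 (show 0 < 2 * η by linarith)
  have hP2 : Integrable (fun q : ℝ × ℝ => f q.2 ^ 2 *
      (2 * η / ((q.2 - q.1) ^ 2 + (2 * η) ^ 2))) (volume.prod volume) := hP1.swap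
  have eP2 : ∫ q : ℝ × ℝ, f q.2 ^ 2 * (2 * η / ((q.2 - q.1) ^ 2 + (2 * η) ^ 2)) =
      Real.pi * ∫ y, f y ^ 2 := by
    rw [← eP1]
    exact integral_prod_swap (fun q : ℝ × ℝ => f q.1 ^ 2 *
      (2 * η / ((q.1 - q.2) ^ 2 + (2 * η) ^ 2)))
  have hmain : ∫ x, ‖F x‖ ^ 2 ≤ 2 * Real.pi ^ 2 * ∫ y, f y ^ 2 := by
    have hswap : ∫ x, (∫ q, Φ (x, q) ∂(volume.prod volume)) =
        ∫ q, (∫ x, Φ (x, q)) ∂(volume.prod volume) :=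
      integral_integral_swap (f := fun x q => Φ (x, q)) hΦi
    have hqi : Integrable (fun q => ∫ x, Φ (x, q)) (volume.prod volume) :=
      hΦi.integral_prod_right
    have e1 : ((∫ x, ‖F x‖ ^ 2 : ℝ) : ℂ) = ∫ q, (∫ x, Φ (x, q)) ∂(volume.prod volume) := by
      rw [← hswap, ← integral_complex_ofReal]
      simp only [h1]
    have e2 : ∫ x, ‖F x‖ ^ 2 = ∫ q, (∫ x, Φ (x, q)).re ∂(volume.prod volume) := by
      have h3 := integral_re hqi
      simp only [RCLike.re_to_complex] at h3
      rw [h3, ← e1, Complex.ofReal_re]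
    have hqre : Integrable (fun q => (∫ x, Φ (x, q)).re) (volume.prod volume) := hqi.re
    rw [e2]
    have h4 := integral_mono hqre ((hP1.add hP2).const_mul Real.pi) fun q => by
      rw [hre q]
      simp only [Pi.add_apply]
      have e3 : (q.2 - q.1) ^ 2 = (q.1 - q.2) ^ 2 := by ring
      rw [e3]
      have hp : 0 ≤ 2 * η / ((q.1 - q.2) ^ 2 + (2 * η) ^ 2) := by positivity
      have := mul_nonneg (mul_nonneg Real.pi_pos.le hp) (sq_nonneg (f q.1 - f q.2))
      nlinarith
    refine h4.trans (le_of_eq ?_)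
    simp only [Pi.add_apply]
    rw [integral_const_mul, integral_add hP1 hP2]
    rw [Measure.volume_eq_prod] at eP1 eP2
    rw [eP1, eP2]
    ring
  calc ∫⁻ x : ℝ, ‖F x‖ₑ ^ 2 = ∫⁻ x, ENNReal.ofReal (‖F x‖ ^ 2) := by
        refine lintegral_congr fun x => ?_
        rw [ENNReal.ofReal_pow (norm_nonneg _), ofReal_norm]
    _ = ENNReal.ofReal (∫ x, ‖F x‖ ^ 2) :=
        (ofReal_integral_eq_lintegral_ofReal hFi
          (Eventually.of_forall fun x => sq_nonneg _)).symm
    _ ≤ _ := ENNReal.ofReal_le_ofReal hmain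

lemma enorm_add_sq_le (a b : ℂ) : ‖a + b‖ₑ ^ 2 ≤ 2 * (‖a‖ₑ ^ 2 + ‖b‖ₑ ^ 2) := by
  have h1 : ‖a + b‖ ^ 2 ≤ 2 * (‖a‖ ^ 2 + ‖b‖ ^ 2) := by
    have := pow_le_pow_left₀ (norm_nonneg _) (norm_add_le a b) 2
    nlinarith [sq_nonneg (‖a‖ - ‖b‖)]
  have h2 := ENNReal.ofReal_le_ofReal h1
  rwa [ENNReal.ofReal_mul (by norm_num), ENNReal.ofReal_add (by positivity) (by positivity),
    ENNReal.ofReal_pow (norm_nonneg _), ENNReal.ofReal_pow (norm_nonneg _),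
    ENNReal.ofReal_pow (norm_nonneg _), ofReal_norm, ofReal_norm,
    ofReal_norm, ENNReal.ofReal_ofNat] at h2

lemma lintegral_enorm_sq_eq {f : ℝ → ℂ} (hf : MemLp f 2) :
    ∫⁻ y, ‖f y‖ₑ ^ 2 = ENNReal.ofReal (∫ y, ‖f y‖ ^ 2) := by
  rw [ofReal_integral_eq_lintegral_ofReal ((memLp_two_iff_integrable_sq_norm hf.1).1 hf)
    (Eventually.of_forall fun x => sq_nonneg _)]
  refine lintegral_congr fun x => ?_
  rw [ENNReal.ofReal_pow (norm_nonneg _), ofReal_norm]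

lemma lintegral_sq_cauchyReal_le_of_integrable {f : ℝ → ℂ} (hf : Integrable f) (hf2 : MemLp f 2)
    {η : ℝ} (hη : 0 < η) : ∫⁻ x : ℝ, ‖cauchyReal f (x - I * η)‖ₑ ^ 2 ≤
      ENNReal.ofReal (4 * Real.pi ^ 2) * ∫⁻ y, ‖f y‖ₑ ^ 2 := by
  have hsq := (memLp_two_iff_integrable_sq_norm hf2.1).1 hf2
  have hr2 : Integrable fun y => (f y).re ^ 2 := by
    refine hsq.mono' (hf.re.1.pow 2) (Eventually.of_forall fun y => ?_)
    rw [Real.norm_eq_abs, abs_of_nonneg (sq_nonneg _), ← sq_abs]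
    exact pow_le_pow_left₀ (abs_nonneg _) (Complex.abs_re_le_norm _) 2
  have hi2 : Integrable fun y => (f y).im ^ 2 := by
    refine hsq.mono' (hf.im.1.pow 2) (Eventually.of_forall fun y => ?_)
    rw [Real.norm_eq_abs, abs_of_nonneg (sq_nonneg _), ← sq_abs]
    exact pow_le_pow_left₀ (abs_nonneg _) (Complex.abs_im_le_norm _) 2
  have h1 := lintegral_sq_cauchyReal_le_of_real hf.re hr2 hη
  have h2 := lintegral_sq_cauchyReal_le_of_real hf.im hi2 hη
  simp only [RCLike.re_to_complex, RCLike.im_to_complex] at h1 h2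
  have him : ∀ x : ℝ, ((x : ℂ) - I * η).im ≠ 0 := fun x => by simpa using hη.ne'
  have hrc : Integrable fun y => ((f y).re : ℂ) := hf.re.ofReal
  have hic : Integrable fun y => ((f y).im : ℂ) := hf.im.ofReal
  have hbdd : ∀ (g : ℝ → ℂ), Integrable g → ∀ x : ℝ,
      Integrable fun y : ℝ => g y * ((y : ℂ) - (x - I * η))⁻¹ := by
    intro g hg x
    refine hg.mul_bdd (c := η⁻¹) (continuous_inv_sub (him x)).aestronglyMeasurable
      (Eventually.of_forall fun y => ?_)
    rw [norm_inv]
    refine inv_anti₀ hη ?_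
    have := Complex.abs_im_le_norm ((y : ℂ) - (x - I * η))
    simpa [abs_of_pos hη] using this
  have e : ∀ x : ℝ, cauchyReal f (x - I * η) =
      cauchyReal (fun y => ((f y).re : ℂ)) (x - I * η) +
        I * cauchyReal (fun y => ((f y).im : ℂ)) (x - I * η) := by
    intro x
    rw [cauchyReal, cauchyReal, cauchyReal, ← integral_const_mul,
      ← integral_add (hbdd _ hrc x) ((hbdd _ hic x).const_mul I)]
    refine integral_congr_ae (Eventually.of_forall fun y => ?_)
    simp only
    linear_combination -(((y : ℂ) - (x - I * η))⁻¹) * Complex.re_add_im (f y)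
  calc ∫⁻ x : ℝ, ‖cauchyReal f (x - I * η)‖ₑ ^ 2
      ≤ ∫⁻ x : ℝ, 2 * (‖cauchyReal (fun y => ((f y).re : ℂ)) (x - I * η)‖ₑ ^ 2 +
        ‖cauchyReal (fun y => ((f y).im : ℂ)) (x - I * η)‖ₑ ^ 2) := by
        refine lintegral_mono fun x => ?_
        rw [e x]
        refine (enorm_add_sq_le _ _).trans (le_of_eq ?_)
        rw [enorm_mul, show ‖I‖ₑ = 1 by rw [← ofReal_norm]; simp, one_mul]
    _ = 2 * ((∫⁻ x : ℝ, ‖cauchyReal (fun y => ((f y).re : ℂ)) (x - I * η)‖ₑ ^ 2) +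
        ∫⁻ x : ℝ, ‖cauchyReal (fun y => ((f y).im : ℂ)) (x - I * η)‖ₑ ^ 2) := by
        rw [lintegral_const_mul' _ _ (by norm_num), lintegral_add_left']
        have := aestronglyMeasurable_cauchyReal hrc.1 (-(I * η))
        simp only [← sub_eq_add_neg] at this
        exact this.enorm.pow_const 2
    _ ≤ 2 * (ENNReal.ofReal (2 * Real.pi ^ 2 * ∫ y, (f y).re ^ 2) +
        ENNReal.ofReal (2 * Real.pi ^ 2 * ∫ y, (f y).im ^ 2)) := by gcongr
    _ = ENNReal.ofReal (4 * Real.pi ^ 2) * ∫⁻ y, ‖f y‖ₑ ^ 2 := by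
        have h0 : ∀ g : ℝ → ℝ, 0 ≤ 2 * Real.pi ^ 2 * ∫ y, g y ^ 2 := fun g =>
          mul_nonneg (by positivity) (integral_nonneg fun y => sq_nonneg _)
        rw [← ENNReal.ofReal_add (h0 _) (h0 _), lintegral_enorm_sq_eq hf2,
          ← ENNReal.ofReal_mul (by positivity), ← mul_add, ← integral_add hr2 hi2,
          show (2 : ENNReal) = ENNReal.ofReal 2 by simp, ← ENNReal.ofReal_mul (by norm_num)]
        have e2 : ∀ y, (f y).re ^ 2 + (f y).im ^ 2 = ‖f y‖ ^ 2 := fun y => by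
          rw [← Complex.normSq_eq_norm_sq, Complex.normSq_apply]
          ring
        simp only [e2]
        ring_nf

/-- The Cauchy integral along horizontal lines below the real axis is bounded on `L²`, uniformly in
the distance of the lines. -/
lemma lintegral_sq_cauchyReal_le {f : ℝ → ℂ} (hf : MemLp f 2) {w : ℂ} (hw : 0 < w.im) :
    ∫⁻ x : ℝ, ‖cauchyReal f (x - w)‖ₑ ^ 2 ≤
      ENNReal.ofReal (4 * Real.pi ^ 2) * ∫⁻ y, ‖f y‖ₑ ^ 2 := by
  have htrans : ∫⁻ x : ℝ, ‖cauchyReal f (x - w)‖ₑ ^ 2 =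
      ∫⁻ x : ℝ, ‖cauchyReal f (x - I * w.im)‖ₑ ^ 2 := by
    rw [← lintegral_sub_right_eq_self (fun x : ℝ => ‖cauchyReal f (x - I * w.im)‖ₑ ^ 2) w.re]
    refine lintegral_congr fun x => ?_
    congr 3
    apply Complex.ext <;> simp
  rw [htrans]
  set fn : ℕ → ℝ → ℂ := fun n => (Set.Icc (-(n : ℝ)) n).indicator f with hfn
  have hfn2 : ∀ n, MemLp (fn n) 2 := fun n => hf.indicator measurableSet_Icc
  have hfn1 : ∀ n, Integrable (fn n) := by
    intro n
    rw [hfn, integrable_indicator_iff measurableSet_Icc]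
    have : MemLp f 2 (volume.restrict (Set.Icc (-(n : ℝ)) n)) := hf.restrict _
    exact this.integrable (by norm_num)
  have hle : ∀ n y, ‖fn n y‖ₑ ≤ ‖f y‖ₑ := fun n y => enorm_indicator_le_enorm_self _ _
  have hlim : ∀ x : ℝ, Tendsto (fun n => cauchyReal (fn n) (x - I * w.im)) atTop
      (𝓝 (cauchyReal f (x - I * w.im))) := by
    intro x
    have him : ((x : ℂ) - I * w.im).im ≠ 0 := by simpa using hw.ne'
    have hint := integrable_mul_inv_sub hf him
    refine tendsto_integral_of_dominated_convergence
      (fun y => ‖f y * ((y : ℂ) - (x - I * w.im))⁻¹‖)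
      (fun n => (integrable_mul_inv_sub (hfn2 n) him).1) hint.norm ?_ ?_
    · intro n
      refine Eventually.of_forall fun y => ?_
      rw [norm_mul, norm_mul]
      exact mul_le_mul_of_nonneg_right (norm_indicator_le_norm_self _ _) (norm_nonneg _)
    · refine Eventually.of_forall fun y => ?_
      refine tendsto_const_nhds.congr' ?_
      obtain ⟨N, hN⟩ := exists_nat_ge |y|
      filter_upwards [eventually_ge_atTop N] with n hn
      have h1 : |y| ≤ n := hN.trans (Nat.cast_le.2 hn)
      simp only [hfn]
      rw [Set.indicator_of_mem (Set.mem_Icc.2 (abs_le.1 h1))]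
  have hmeas : ∀ n, AEMeasurable (fun x : ℝ => ‖cauchyReal (fn n) (x - I * w.im)‖ₑ ^ 2) := by
    intro n
    have := aestronglyMeasurable_cauchyReal (hfn2 n).1 (-(I * w.im))
    simp only [← sub_eq_add_neg] at this
    exact this.enorm.pow_const 2
  calc ∫⁻ x : ℝ, ‖cauchyReal f (x - I * w.im)‖ₑ ^ 2
      = ∫⁻ x : ℝ, liminf (fun n => ‖cauchyReal (fn n) (x - I * w.im)‖ₑ ^ 2) atTop := by
        refine lintegral_congr fun x => ?_
        exact (((ENNReal.continuous_pow 2).tendsto _).comp (hlim x).enorm).liminf_eq.symm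
    _ ≤ liminf (fun n => ∫⁻ x : ℝ, ‖cauchyReal (fn n) (x - I * w.im)‖ₑ ^ 2) atTop :=
        lintegral_liminf_le' hmeas
    _ ≤ ENNReal.ofReal (4 * Real.pi ^ 2) * ∫⁻ y, ‖f y‖ₑ ^ 2 := by
        refine liminf_le_of_frequently_le' (Frequently.of_forall fun n => ?_)
        refine (lintegral_sq_cauchyReal_le_of_integrable (hfn1 n) (hfn2 n) hw).trans ?_
        gcongr with y
        exact hle n y

/-! ### The jump of Cauchy integrals of square integrable functions -/

lemma lintegral_enorm_inv_sub_sub_le (x : ℝ) {w : ℂ} (hw : 0 < w.im) :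
    ∫⁻ y : ℝ, ‖((y : ℂ) - (x + w))⁻¹ - ((y : ℂ) - (x - w))⁻¹‖ₑ ≤
      ENNReal.ofReal (2 * Real.pi * ‖w‖ / w.im) := by
  have hα : ((x : ℂ) + w).im ≠ 0 := by simpa using hw.ne'
  have hβ : ((x : ℂ) - w).im ≠ 0 := by simpa using hw.ne'
  have e : ∀ y : ℝ, ((y : ℂ) - (x + w))⁻¹ - ((y : ℂ) - (x - w))⁻¹ =
      2 * w * (((y : ℂ) - (x + w))⁻¹ * ((y : ℂ) - (x - w))⁻¹) := by
    intro y
    have h1 := ofReal_sub_ne_zero hα y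
    have h2 := ofReal_sub_ne_zero hβ y
    field_simp
    ring
  have hi := (integrable_inv_sub_mul_inv_sub hα hβ).const_mul (2 * w)
  simp only [e]
  rw [← ofReal_integral_norm_eq_lintegral_enorm hi]
  refine ENNReal.ofReal_le_ofReal ?_
  simp only [norm_mul (2 * w)]
  rw [integral_const_mul]
  have := integral_norm_inv_sub_mul_inv_sub_le hw (α := x + w) (β := x - w)
    (by simp [abs_of_pos hw]) (by simp [abs_of_pos hw])
  have h3 := mul_le_mul_of_nonneg_left this (norm_nonneg (2 * w))
  refine h3.trans (le_of_eq ?_)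
  rw [norm_mul, Complex.norm_ofNat]
  ring

/-- The difference of Cauchy integrals on two sides of the real axis is bounded on `L²`. -/
lemma lintegral_sq_cauchyReal_sub_le {g : ℝ → ℂ} (hg : MemLp g 2) {w : ℂ} (hw : 0 < w.im) :
    ∫⁻ x : ℝ, ‖cauchyReal g (x + w) - cauchyReal g (x - w)‖ₑ ^ 2 ≤
      ENNReal.ofReal (2 * Real.pi * ‖w‖ / w.im) ^ 2 * ∫⁻ y, ‖g y‖ₑ ^ 2 := by
  refine le_trans (lintegral_mono fun x => ?_) (lintegral_sq_lintegral_le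
    (k := fun x y : ℝ => ‖((y : ℂ) - (x + w))⁻¹ - ((y : ℂ) - (x - w))⁻¹‖ₑ)
    (p := fun _ => 1) ?_ measurable_const hg.1.enorm (by simp) (by simp) ?_ ?_)
  · refine pow_le_pow_left' ?_ 2
    have hα : ((x : ℂ) + w).im ≠ 0 := by simpa using hw.ne'
    have hβ : ((x : ℂ) - w).im ≠ 0 := by simpa using hw.ne'
    rw [cauchyReal, cauchyReal, ← integral_sub (integrable_mul_inv_sub hg hα)
      (integrable_mul_inv_sub hg hβ)]
    refine (enorm_integral_le_lintegral_enorm _).trans (le_of_eq ?_)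
    refine lintegral_congr fun y => ?_
    rw [← mul_sub, enorm_mul, mul_comm]
  · unfold Function.uncurry
    fun_prop
  · refine Eventually.of_forall fun x => ?_
    simp only [mul_one]
    exact lintegral_enorm_inv_sub_sub_le x hw
  · refine Eventually.of_forall fun y => ?_
    simp only [mul_one]
    refine le_trans (le_of_eq ?_) (lintegral_enorm_inv_sub_sub_le y hw)
    refine lintegral_congr fun x => ?_
    have e1 : (y : ℂ) - (x + w) = -((x : ℂ) - (y - w)) := by ring
    have e2 : (y : ℂ) - (x - w) = -((x : ℂ) - (y + w)) := by ring
    rw [e1, e2, inv_neg, inv_neg]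
    congr 1
    ring

lemma cauchyReal_sub_eq_integral {φ : ℝ → ℂ} (hφ : MemLp φ 2) (x : ℝ) {w : ℂ} (hw : 0 < w.im)
    {η : ℝ} (hη : 0 < η) : cauchyReal φ (x + η * w) - cauchyReal φ (x - η * w) =
      ∫ v : ℝ, φ (x + η * v) * (((v : ℂ) - w)⁻¹ - ((v : ℂ) - (-w))⁻¹) := by
  have hη' : (η : ℂ) ≠ 0 := Complex.ofReal_ne_zero.2 hη.ne'
  have hα : ((x : ℂ) + η * w).im ≠ 0 := by simp [hη.ne', hw.ne']
  have hβ : ((x : ℂ) - η * w).im ≠ 0 := by simp [hη.ne', hw.ne']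
  rw [cauchyReal, cauchyReal, ← integral_sub (integrable_mul_inv_sub hφ hα)
      (integrable_mul_inv_sub hφ hβ),
    ← integral_add_left_eq_self (fun y : ℝ => φ y * ((y : ℂ) - (x + η * w))⁻¹ -
      φ y * ((y : ℂ) - (x - η * w))⁻¹) x]
  have h1 := Measure.integral_comp_mul_left (fun u : ℝ => φ (x + u) *
    (((x + u : ℝ) : ℂ) - (x + η * w))⁻¹ - φ (x + u) * (((x + u : ℝ) : ℂ) - (x - η * w))⁻¹) η
  rw [abs_of_pos (inv_pos.2 hη)] at h1
  have h2 := congrArg (fun z => η • z) h1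
  simp only [smul_smul, mul_inv_cancel₀ hη.ne', one_smul] at h2
  rw [← h2, ← integral_smul]
  refine integral_congr_ae (Eventually.of_forall fun v => ?_)
  have hv1 : (v : ℂ) - w ≠ 0 := ofReal_sub_ne_zero hw.ne' v
  have hv2 : (v : ℂ) - (-w) ≠ 0 := ofReal_sub_ne_zero (by simpa using hw.ne') v
  have e1 : ((x + η * v : ℝ) : ℂ) - (x + η * w) = η * (v - w) := by push_cast; ring
  have e2 : ((x + η * v : ℝ) : ℂ) - (x - η * w) = η * (v - (-w)) := by push_cast; ring
  simp only
  rw [e1, e2, mul_inv, mul_inv, Complex.real_smul]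
  field_simp

lemma tendsto_cauchyReal_sub_of_continuous {φ : ℝ → ℂ} (hφ : Continuous φ)
    (hc : HasCompactSupport φ) {w : ℂ} (hw : 0 < w.im) {u : ℕ → ℝ} (hu : ∀ n, 0 < u n)
    (hu0 : Tendsto u atTop (𝓝 0)) (x : ℝ) :
    Tendsto (fun n => cauchyReal φ (x + u n * w) - cauchyReal φ (x - u n * w)) atTop
      (𝓝 (2 * Real.pi * I * φ x)) := by
  have hφ2 : MemLp φ 2 := hφ.memLp_of_hasCompactSupport hc
  simp only [cauchyReal_sub_eq_integral hφ2 x hw (hu _)]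
  have hk : Integrable fun v : ℝ => ((v : ℂ) - w)⁻¹ - ((v : ℂ) - (-w))⁻¹ := by
    have hn : (-w).im ≠ 0 := by simpa using hw.ne'
    refine ((integrable_inv_sub_mul_inv_sub hw.ne' hn).const_mul (2 * w)).congr
      (Eventually.of_forall fun v => ?_)
    have h1 := ofReal_sub_ne_zero hw.ne' v
    have h2 := ofReal_sub_ne_zero hn v
    simp only
    field_simp
    ring
  obtain ⟨C, hC⟩ := hc.exists_bound_of_continuous hφ
  have hlim : 2 * Real.pi * I * φ x =
      ∫ v : ℝ, φ x * (((v : ℂ) - w)⁻¹ - ((v : ℂ) - (-w))⁻¹) := by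
    rw [integral_const_mul, integral_inv_sub_sub_inv_sub hw (by simpa using hw)]
    ring
  rw [hlim]
  refine tendsto_integral_of_dominated_convergence
    (fun v => C * ‖((v : ℂ) - w)⁻¹ - ((v : ℂ) - (-w))⁻¹‖) (fun n => ?_) (hk.norm.const_mul C)
    (fun n => Eventually.of_forall fun v => ?_) (Eventually.of_forall fun v => ?_)
  · refine AEStronglyMeasurable.mul ?_ hk.1
    exact (hφ.comp (by fun_prop : Continuous fun v : ℝ => x + u n * v)).aestronglyMeasurable
  · rw [norm_mul]
    exact mul_le_mul_of_nonneg_right (hC _) (norm_nonneg _)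
  · refine Tendsto.mul_const _ ?_
    refine (hφ.tendsto x).comp ?_
    have := (hu0.mul_const v).const_add x
    rwa [zero_mul, add_zero] at this

/-- If the jump of the Cauchy integral of a square integrable function exists almost everywhere,
it is given by the Sokhotski-Plemelj formula: the formula holds for continuous densities with
compact support, and the jump depends continuously on the density in `L²`. -/
lemma ae_eq_of_tendsto_cauchyReal_sub {g : ℝ → ℂ} (hg : MemLp g 2) {w : ℂ} (hw : 0 < w.im)
    {u : ℕ → ℝ} (hu : ∀ n, 0 < u n) (hu0 : Tendsto u atTop (𝓝 0)) {S : Set ℝ} {J : ℝ → ℂ}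
    (hJ : ∀ᵐ (x : ℝ) ∂(volume.restrict S), Tendsto
      (fun n => cauchyReal g (x + u n * w) - cauchyReal g (x - u n * w)) atTop (𝓝 (J x))) :
    ∀ᵐ x ∂(volume.restrict S), J x = 2 * Real.pi * I * g x := by
  set B : ENNReal := ENNReal.ofReal (2 * Real.pi * ‖w‖ / w.im) ^ 2 with hB
  set c : ℂ := 2 * Real.pi * I with hcdef
  have hmeas : ∀ (r : ℝ → ℂ), MemLp r 2 → ∀ n, AEMeasurable (fun x : ℝ =>
      ‖cauchyReal r (x + u n * w) - cauchyReal r (x - u n * w)‖ₑ ^ 2) (volume.restrict S) := by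
    intro r hr n
    have h1 := aestronglyMeasurable_cauchyReal hr.1 (u n * w)
    have h2 := aestronglyMeasurable_cauchyReal hr.1 (-(u n * w))
    simp only [← sub_eq_add_neg] at h2
    exact ((h1.sub h2).enorm.pow_const 2).restrict
  have hJm : AEStronglyMeasurable J (volume.restrict S) := by
    refine aestronglyMeasurable_of_tendsto_ae atTop (fun n => ?_) hJ
    have h1 := aestronglyMeasurable_cauchyReal hg.1 (u n * w)
    have h2 := aestronglyMeasurable_cauchyReal hg.1 (-(u n * w))
    simp only [← sub_eq_add_neg] at h2
    exact (h1.sub h2).restrict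
  have hbound : ∀ φ : ℝ → ℂ, Continuous φ → HasCompactSupport φ →
      ∫⁻ x in S, ‖J x - c * g x‖ₑ ^ 2 ≤
        2 * (B + ‖c‖ₑ ^ 2) * ∫⁻ y, ‖g y - φ y‖ₑ ^ 2 := by
    intro φ hφ hφc
    have hφ2 : MemLp φ 2 := hφ.memLp_of_hasCompactSupport hφc
    have hr : MemLp (g - φ) 2 := hg.sub hφ2
    have hlin : ∀ (x : ℝ) n, cauchyReal (g - φ) (x + u n * w) - cauchyReal (g - φ) (x - u n * w) =
        (cauchyReal g (x + u n * w) - cauchyReal g (x - u n * w)) -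
          (cauchyReal φ (x + u n * w) - cauchyReal φ (x - u n * w)) := by
      intro x n
      have hα : ((x : ℂ) + u n * w).im ≠ 0 := by simp [(hu n).ne', hw.ne']
      have hβ : ((x : ℂ) - u n * w).im ≠ 0 := by simp [(hu n).ne', hw.ne']
      have key : ∀ z : ℂ, z.im ≠ 0 →
          cauchyReal (g - φ) z = cauchyReal g z - cauchyReal φ z := by
        intro z hz
        rw [cauchyReal, cauchyReal, cauchyReal, ← integral_sub (integrable_mul_inv_sub hg hz)
          (integrable_mul_inv_sub hφ2 hz)]
        refine integral_congr_ae (Eventually.of_forall fun y => ?_)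
        simp only [Pi.sub_apply, sub_mul]
      rw [key _ hα, key _ hβ]
      ring
    have hfat : ∫⁻ x in S, ‖J x - c * φ x‖ₑ ^ 2 ≤ B * ∫⁻ y, ‖g y - φ y‖ₑ ^ 2 := by
      calc ∫⁻ x in S, ‖J x - c * φ x‖ₑ ^ 2
          = ∫⁻ x in S, liminf (fun n => ‖cauchyReal (g - φ) (x + u n * w) -
              cauchyReal (g - φ) (x - u n * w)‖ₑ ^ 2) atTop := by
            refine lintegral_congr_ae ?_
            filter_upwards [hJ] with x hx
            have h1 := hx.sub (tendsto_cauchyReal_sub_of_continuous hφ hφc hw hu hu0 x)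
            simp only [← hlin] at h1
            exact (((ENNReal.continuous_pow 2).tendsto _).comp h1.enorm).liminf_eq.symm
        _ ≤ liminf (fun n => ∫⁻ x in S, ‖cauchyReal (g - φ) (x + u n * w) -
              cauchyReal (g - φ) (x - u n * w)‖ₑ ^ 2) atTop :=
            lintegral_liminf_le' (hmeas _ hr)
        _ ≤ B * ∫⁻ y, ‖g y - φ y‖ₑ ^ 2 := by
            refine liminf_le_of_frequently_le' (Frequently.of_forall fun n => ?_)
            refine (setLIntegral_le_lintegral _ _).trans ?_
            have him : 0 < ((u n : ℂ) * w).im := by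
              rw [Complex.im_ofReal_mul]
              exact mul_pos (hu n) hw
            refine (lintegral_sq_cauchyReal_sub_le hr him).trans (le_of_eq ?_)
            rw [Complex.im_ofReal_mul, norm_mul, Complex.norm_real, Real.norm_of_nonneg (hu n).le]
            have hun := (hu n).ne'
            have e : 2 * Real.pi * (u n * ‖w‖) / (u n * w.im) = 2 * Real.pi * ‖w‖ / w.im := by
              field_simp
            rw [e]
            rfl
    calc ∫⁻ x in S, ‖J x - c * g x‖ₑ ^ 2
        ≤ ∫⁻ x in S, 2 * (‖J x - c * φ x‖ₑ ^ 2 + ‖c‖ₑ ^ 2 * ‖g x - φ x‖ₑ ^ 2) := by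
          refine lintegral_mono fun x => ?_
          have e : J x - c * g x = (J x - c * φ x) + -(c * (g x - φ x)) := by ring
          rw [e]
          refine (enorm_add_sq_le _ _).trans (le_of_eq ?_)
          rw [enorm_neg, enorm_mul, mul_pow]
      _ = 2 * ((∫⁻ x in S, ‖J x - c * φ x‖ₑ ^ 2) +
            ‖c‖ₑ ^ 2 * ∫⁻ x in S, ‖g x - φ x‖ₑ ^ 2) := by
          rw [lintegral_const_mul' _ _ (by norm_num), lintegral_add_left',
            lintegral_const_mul' _ _ (ENNReal.pow_ne_top enorm_ne_top)]
          exact (hJm.sub (hφ2.1.const_mul c).restrict).enorm.pow_const 2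
      _ ≤ 2 * (B * (∫⁻ y, ‖g y - φ y‖ₑ ^ 2) + ‖c‖ₑ ^ 2 * ∫⁻ y, ‖g y - φ y‖ₑ ^ 2) := by
          gcongr
          exact Measure.restrict_le_self
      _ = _ := by ring
  have hzero : ∫⁻ x in S, ‖J x - c * g x‖ₑ ^ 2 = 0 := by
    have hBt : 2 * (B + ‖c‖ₑ ^ 2) ≠ ⊤ := by
      refine ENNReal.mul_ne_top (by norm_num) (ENNReal.add_ne_top.2 ⟨?_, ?_⟩)
      · exact ENNReal.pow_ne_top ENNReal.ofReal_ne_top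
      · exact ENNReal.pow_ne_top enorm_ne_top
    have happ : ∀ e : ENNReal, e ≠ 0 →
        ∫⁻ x in S, ‖J x - c * g x‖ₑ ^ 2 ≤ 2 * (B + ‖c‖ₑ ^ 2) * e ^ 2 := by
      intro e he
      obtain ⟨φ, hφc, hle, hφ, -⟩ := hg.exists_hasCompactSupport_eLpNorm_sub_le
        (by norm_num) he
      refine (hbound φ hφ hφc).trans ?_
      have h2 := eLpNorm_nnreal_pow_eq_lintegral (f := g - φ) (μ := volume) (p := 2) two_ne_zero
      simp only [NNReal.coe_ofNat, ENNReal.rpow_ofNat, ENNReal.coe_ofNat, Pi.sub_apply] at h2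
      rw [← h2]
      gcongr
    have hlim : Tendsto (fun n : ℕ => 2 * (B + ‖c‖ₑ ^ 2) * ((n : ENNReal)⁻¹) ^ 2) atTop (𝓝 0) := by
      have h3 := ((ENNReal.continuous_pow 2).tendsto 0).comp ENNReal.tendsto_inv_nat_nhds_zero
      have h4 := ENNReal.Tendsto.const_mul h3 (Or.inr hBt)
      simpa using h4
    refine le_antisymm (ge_of_tendsto hlim (Eventually.of_forall fun n => happ _ ?_)) zero_le
    simp
  have hm : AEMeasurable (fun x => ‖J x - c * g x‖ₑ ^ 2) (volume.restrict S) :=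
    (hJm.sub (hg.1.const_mul c).restrict).enorm.pow_const 2
  rw [lintegral_eq_zero_iff' hm] at hzero
  filter_upwards [hzero] with x hx
  simp only [Pi.zero_apply, pow_eq_zero_iff two_ne_zero, enorm_eq_zero] at hx
  exact sub_eq_zero.1 hx

/-! ### Separation of the pieces of the contour -/

lemma exists_between_interval {j k : Fin 8} (hjk : j < k) :
    (∃ c : ℝ, (∀ x ∈ interval j, x ≤ c) ∧ ∀ y ∈ interval k, c ≤ y) ∨
      (j = 1 ∧ k = 2) ∨ (j = 3 ∧ k = 4) ∨ (j = 5 ∧ k = 6) := by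
  have hlow : ∀ y ∈ interval k, k ≠ 0 → (![0, -2, -2, -1, -1, 1, 1, 2] : Fin 8 → ℝ) k ≤ y := by
    intro y hy hk
    fin_cases k <;> simp [interval] at hy hk ⊢ <;> linarith
  have hk : k ≠ 0 := Fin.ne_zero_of_lt hjk
  by_cases h0 : (j = 1 ∧ k = 2) ∨ (j = 3 ∧ k = 4) ∨ (j = 5 ∧ k = 6)
  · exact Or.inr h0
  · refine Or.inl ⟨_, fun x hx => ?_, fun y hy => hlow y hy hk⟩
    fin_cases k <;> fin_cases j <;> simp [interval] at hjk h0 hx ⊢ <;> linarith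

lemma mul_abs_add_abs_le {d c x y : ℝ} (hd1 : d ≤ 1) (hx : x ≤ c) (hy : c ≤ y) :
    d * (|x - c| + |y - c|) ≤ |y - x| := by
  rw [abs_of_nonpos (by linarith), abs_of_nonneg (by linarith), abs_of_nonneg (by linarith)]
  nlinarith

lemma exists_mul_le_of_lt {d : ℝ} (hd0 : 0 < d) (hd1 : d ≤ 1) {j k : Fin 8} (hjk : j < k) :
    ∃ c : ℝ, ∀ x ∈ interval j, ∀ y ∈ interval k, d * (|x - c| + |y - c|) ≤ |y - x| ∨
      d * (|x - c| + |y - c|) ≤ |height d k y - height d j x| := by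
  rcases exists_between_interval hjk with ⟨c, h1, h2⟩ | ⟨rfl, rfl⟩ | ⟨rfl, rfl⟩ | ⟨rfl, rfl⟩
  · exact ⟨c, fun x hx y hy => Or.inl (mul_abs_add_abs_le hd1 (h1 x hx) (h2 y hy))⟩
  · refine ⟨-2, fun x hx y hy => Or.inr ?_⟩
    simp [interval, height] at hx hy ⊢
    rw [abs_of_nonneg (by linarith), abs_of_nonneg (by linarith), abs_sub_comm,
      abs_of_nonneg (by nlinarith)]
    linarith
  · refine ⟨0, fun x hx y hy => Or.inr ?_⟩
    simp [interval, height] at hx hy ⊢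
    have h1 : |x| ≤ 1 := abs_le.2 hx
    have h2 : |y| ≤ 1 := abs_le.2 hy
    have e : |-d - d| = 2 * d := by
      rw [abs_of_nonpos (by linarith)]
      ring
    rw [e]
    nlinarith
  · refine ⟨2, fun x hx y hy => Or.inr ?_⟩
    simp [interval, height] at hx hy ⊢
    rw [abs_of_nonpos (by linarith), abs_of_nonpos (by linarith), abs_sub_comm,
      abs_of_nonneg (by nlinarith)]
    linarith

section

variable {t γ : ℝ}

/-- Two different pieces of the contour meet at most at one end point, at an angle that is not
much smaller than `δ`. The point `c` separates the two parameter intervals if they do not overlap;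
for an upper and a lower edge with the same interval it is the real part of the vertex at which
they meet, or `0` for the two horizontal edges. -/
lemma exists_mul_le_norm_param_sub (hd : 0 < delta t γ) {j k : Fin 8} (hjk : j ≠ k) :
    ∃ c : ℝ, ∀ x ∈ interval j, ∀ y ∈ interval k,
      delta t γ * (|x - c| + |y - c|) ≤ ‖param t γ k y - param t γ j x‖ := by
  have hd1 : delta t γ ≤ 1 := delta_le_half.trans (by norm_num)
  have key : ∀ (j k : Fin 8), j < k → ∃ c : ℝ, ∀ x ∈ interval j, ∀ y ∈ interval k,
      delta t γ * (|x - c| + |y - c|) ≤ ‖param t γ k y - param t γ j x‖ := by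
    intro j k h0
    obtain ⟨c, hc⟩ := exists_mul_le_of_lt hd hd1 h0
    refine ⟨c, fun x hx y hy => ?_⟩
    rcases hc x hx y hy with h1 | h1
    · refine h1.trans ?_
      have := Complex.abs_re_le_norm (param t γ k y - param t γ j x)
      rwa [Complex.sub_re, param_re, param_re] at this
    · refine h1.trans ?_
      have := Complex.abs_im_le_norm (param t γ k y - param t γ j x)
      rwa [Complex.sub_im, param_im, param_im] at this
  rcases lt_or_gt_of_ne hjk with h0 | h0
  · exact key j k h0
  · obtain ⟨c, hc⟩ := key k j h0
    refine ⟨c, fun x hx y hy => ?_⟩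
    rw [add_comm, norm_sub_rev]
    exact hc y hy x hx

lemma height_sub (d : ℝ) (j : Fin 8) (x y : ℝ) :
    height d j y - height d j x = slope d j * (y - x) := by
  fin_cases j <;> simp [height, slope] <;> ring

lemma param_sub (j : Fin 8) (x y : ℝ) :
    param t γ j y - param t γ j x = tangent t γ j * (y - x) := by
  have := congrArg (fun r : ℝ => (r : ℂ)) (height_sub (delta t γ) j x y)
  simp only [Complex.ofReal_sub, Complex.ofReal_mul] at this
  rw [param, param, tangent]
  linear_combination I * this

lemma tangent_re (j : Fin 8) : (tangent t γ j).re = 1 := by simp [tangent]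

lemma tangent_ne_zero (j : Fin 8) : tangent t γ j ≠ 0 := by
  intro h0
  have := tangent_re (t := t) (γ := γ) j
  rw [h0] at this
  simp at this

lemma norm_tangent_le (hd : 0 < delta t γ) (j : Fin 8) : ‖tangent t γ j‖ ≤ 2 := by
  have h1 : |slope (delta t γ) j| ≤ 1 := by
    have := delta_le_half (t := t) (γ := γ)
    fin_cases j <;> simp [slope, abs_of_pos hd] <;> linarith
  rw [tangent]
  refine (norm_add_le _ _).trans ?_
  rw [norm_one, norm_mul, Complex.norm_I, one_mul, Complex.norm_real, Real.norm_eq_abs]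
  linarith

lemma I_div_tangent_im_pos (j : Fin 8) : 0 < (I / tangent t γ j).im := by
  rw [Complex.div_im, Complex.I_re, Complex.I_im, tangent_re]
  have := Complex.normSq_pos.2 (tangent_ne_zero (t := t) (γ := γ) j)
  simp only [mul_one, zero_mul, zero_div, sub_zero]
  positivity

/-! ### Boundary values of Cauchy integrals over the contour -/

/-- The restriction of a function to the `k`-th piece of the contour, as a function on the real line
that vanishes outside the parameter interval. -/
noncomputable def onPiece (t γ : ℝ) (g : ℂ → ℂ) (k : Fin 8) : ℝ → ℂ :=
  (interval k).indicator fun y => g (param t γ k y)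

/-- The square of the `L²` norm of a function on the contour, with each piece parametrized by the
real part. -/
noncomputable def energy (t γ : ℝ) (g : ℂ → ℂ) : ENNReal :=
  ∑ k : Fin 8, ∫⁻ y in interval k, ‖g (param t γ k y)‖ₑ ^ 2

lemma memLp_onPiece {g : ℂ → ℂ} (hg : MemLp g 2 (arcLength t γ)) (k : Fin 8) :
    MemLp (onPiece t γ g k) 2 := by
  rw [onPiece, memLp_indicator_iff_restrict (measurableSet_interval k)]
  exact memLp_arcLength_iff.1 hg k

lemma lintegral_onPiece (g : ℂ → ℂ) (k : Fin 8) :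
    ∫⁻ y, ‖onPiece t γ g k y‖ₑ ^ 2 = ∫⁻ y in interval k, ‖g (param t γ k y)‖ₑ ^ 2 := by
  rw [← lintegral_indicator (measurableSet_interval k)]
  refine lintegral_congr fun y => ?_
  by_cases hy : y ∈ interval k
  · rw [onPiece, Set.indicator_of_mem hy, Set.indicator_of_mem hy]
  · rw [onPiece, Set.indicator_of_notMem hy, Set.indicator_of_notMem hy]
    simp

/-- The contribution of the `k`-th piece to the Cauchy integral, without the factor `(2πi)⁻¹`. -/
noncomputable def pieceCauchy (t γ : ℝ) (g : ℂ → ℂ) (k : Fin 8) (z : ℂ) : ℂ :=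
  ∫ y : ℝ, onPiece t γ g k y * (param t γ k y - z)⁻¹ * tangent t γ k

lemma lineIntegral_eq_sum_pieceCauchy (g : ℂ → ℂ) (z : ℂ) :
    lineIntegral t γ (fun w => g w / (w - z)) = ∑ k, pieceCauchy t γ g k z := by
  refine Finset.sum_congr rfl fun k _ => ?_
  rw [pieceCauchy, ← integral_indicator (measurableSet_interval k)]
  refine integral_congr_ae (Eventually.of_forall fun y => ?_)
  by_cases hy : y ∈ interval k
  · simp only [onPiece, Set.indicator_of_mem hy, div_eq_mul_inv]
  · simp only [onPiece, Set.indicator_of_notMem hy, zero_mul]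

lemma pieceCauchy_self (g : ℂ → ℂ) (j : Fin 8) (x : ℝ) (η : ℂ) :
    pieceCauchy t γ g j (param t γ j x + I * η) =
      cauchyReal (onPiece t γ g j) (x + η * (I / tangent t γ j)) := by
  refine integral_congr_ae (Eventually.of_forall fun y => ?_)
  have h0 := tangent_ne_zero (t := t) (γ := γ) j
  have e : param t γ j y - (param t γ j x + I * η) =
      tangent t γ j * ((y : ℂ) - (x + η * (I / tangent t γ j))) := by
    rw [← sub_sub, param_sub]
    field_simp
    ring
  simp only
  rw [e, mul_inv]
  field_simp

/-- The denominator of a Cauchy kernel on a piece is comparable with that of a real line. -/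
lemma norm_inv_param_sub_le {k : Fin 8} {y r : ℝ} {z : ℂ} (hr : 0 < r)
    (h : r ≤ ‖param t γ k y - z‖) :
    ‖(param t γ k y - z)⁻¹‖ ≤ 2 * ‖((y : ℂ) - (z.re + I * r))⁻¹‖ := by
  have h1 := Complex.abs_re_le_norm (param t γ k y - z)
  rw [Complex.sub_re, param_re] at h1
  have h2 : ‖(y : ℂ) - (z.re + I * r)‖ ≤ 2 * ‖param t γ k y - z‖ := by
    have e : (y : ℂ) - (z.re + I * r) = ((y - z.re : ℝ) : ℂ) - I * r := by push_cast; ring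
    rw [e]
    refine (norm_sub_le _ _).trans ?_
    rw [norm_mul, Complex.norm_I, one_mul, Complex.norm_real, Complex.norm_real, Real.norm_eq_abs,
      Real.norm_of_nonneg hr.le]
    linarith
  have h3 : 0 < ‖(y : ℂ) - (z.re + I * r)‖ := by
    refine norm_pos_iff.2 (ofReal_sub_ne_zero ?_ y)
    simpa using hr.ne'
  have h4 : 0 < ‖param t γ k y - z‖ := hr.trans_le h
  rw [norm_inv, norm_inv, ← div_eq_mul_inv, inv_eq_one_div, div_le_div_iff₀ h4 h3]
  linarith

lemma integrable_onPiece_bound {g : ℂ → ℂ} (hg : MemLp g 2 (arcLength t γ)) (k : Fin 8) (a : ℝ)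
    {r : ℝ} (hr : 0 < r) : Integrable fun y : ℝ =>
      ‖onPiece t γ g k y‖ * (2 * ‖((y : ℂ) - (a + I * r))⁻¹‖) * ‖tangent t γ k‖ := by
  have him : ((a : ℂ) + I * r).im ≠ 0 := by simpa using hr.ne'
  have := ((integrable_mul_inv_sub (memLp_onPiece hg k) him).norm.const_mul 2).mul_const
    ‖tangent t γ k‖
  refine this.congr (Eventually.of_forall fun y => ?_)
  simp only [norm_mul]
  ring

lemma aestronglyMeasurable_kernel {g : ℂ → ℂ} (hg : MemLp g 2 (arcLength t γ)) (k : Fin 8)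
    (z : ℂ) : AEStronglyMeasurable fun y : ℝ =>
      onPiece t γ g k y * (param t γ k y - z)⁻¹ * tangent t γ k := by
  have hp := (continuous_param (t := t) (γ := γ) k).measurable
  have h1 : Measurable fun y : ℝ => (param t γ k y - z)⁻¹ := (hp.sub_const z).inv
  exact ((memLp_onPiece hg k).1.mul h1.aestronglyMeasurable).mul_const _

lemma norm_kernel_le {g : ℂ → ℂ} {k : Fin 8} {r : ℝ} {z : ℂ} (hr : 0 < r)
    (h : ∀ y ∈ interval k, r ≤ ‖param t γ k y - z‖) (y : ℝ) :
    ‖onPiece t γ g k y * (param t γ k y - z)⁻¹ * tangent t γ k‖ ≤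
      ‖onPiece t γ g k y‖ * (2 * ‖((y : ℂ) - (z.re + I * r))⁻¹‖) * ‖tangent t γ k‖ := by
  rw [norm_mul, norm_mul]
  by_cases hy : y ∈ interval k
  · have := norm_inv_param_sub_le hr (h y hy)
    gcongr
  · rw [onPiece, Set.indicator_of_notMem hy]
    simp

lemma integrable_kernel {g : ℂ → ℂ} (hg : MemLp g 2 (arcLength t γ)) {k : Fin 8} {r : ℝ} {z : ℂ}
    (hr : 0 < r) (h : ∀ y ∈ interval k, r ≤ ‖param t γ k y - z‖) : Integrable fun y : ℝ =>
      onPiece t γ g k y * (param t γ k y - z)⁻¹ * tangent t γ k :=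
  (integrable_onPiece_bound hg k z.re hr).mono' (aestronglyMeasurable_kernel hg k z)
    (Eventually.of_forall (norm_kernel_le hr h))

/-- Away from the `k`-th piece its contribution is continuous along vertical lines. -/
lemma tendsto_pieceCauchy {g : ℂ → ℂ} (hg : MemLp g 2 (arcLength t γ)) {k : Fin 8} {r : ℝ} {z : ℂ}
    (hr : 0 < r) (h : ∀ y ∈ interval k, r ≤ ‖param t γ k y - z‖) {u : ℕ → ℝ}
    (hu : Tendsto u atTop (𝓝 0)) :
    Tendsto (fun n => pieceCauchy t γ g k (z + I * u n)) atTop (𝓝 (pieceCauchy t γ g k z)) := by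
  have hcont : Tendsto (fun n => z + I * (u n : ℂ)) atTop (𝓝 z) := by
    have h1 := ((Complex.continuous_ofReal.tendsto 0).comp hu).const_mul I
    have h2 := h1.const_add z
    simpa using h2
  refine tendsto_integral_filter_of_dominated_convergence
    (fun y : ℝ => ‖onPiece t γ g k y‖ * (2 * ‖((y : ℂ) - (z.re + I * ((r / 2 : ℝ) : ℂ)))⁻¹‖) *
      ‖tangent t γ k‖) (Eventually.of_forall fun n => aestronglyMeasurable_kernel hg k _) ?_
    (integrable_onPiece_bound hg k z.re (half_pos hr)) ?_
  · have hsmall : ∀ᶠ n in atTop, |u n| < r / 2 := by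
      have := hu.abs
      rw [abs_zero] at this
      exact this.eventually_lt_const (half_pos hr)
    filter_upwards [hsmall] with n hn
    refine Eventually.of_forall fun y => ?_
    have h0 : ∀ y ∈ interval k, r / 2 ≤ ‖param t γ k y - (z + I * u n)‖ := by
      intro y hy
      have h2 := norm_sub_norm_le (param t γ k y - z) (I * u n)
      rw [norm_mul, Complex.norm_I, one_mul, Complex.norm_real, Real.norm_eq_abs, sub_sub] at h2
      linarith [h y hy]
    have h1 := norm_kernel_le (g := g) (half_pos hr) h0 y
    have e : (z + I * u n).re = z.re := by simp
    rwa [e] at h1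
  · refine Eventually.of_forall fun y => ?_
    by_cases hy : y ∈ interval k
    · have hne : param t γ k y - z ≠ 0 := by
        rw [← norm_pos_iff]
        exact hr.trans_le (h y hy)
      exact (((hcont.const_sub _).inv₀ hne).const_mul _).mul_const _
    · simp only [onPiece, Set.indicator_of_notMem hy, zero_mul]
      exact tendsto_const_nhds

/-- The contribution of one piece on another piece is controlled by a Hilbert-type kernel. -/
lemma lintegral_sq_pieceCauchy_le (hd : 0 < delta t γ) {g : ℂ → ℂ}
    (hg : MemLp g 2 (arcLength t γ)) {j k : Fin 8} (hjk : j ≠ k) :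
    ∫⁻ x in interval j, ‖pieceCauchy t γ g k (param t γ j x)‖ₑ ^ 2 ≤
      ENNReal.ofReal (4 * Real.pi / delta t γ) ^ 2 *
        ∫⁻ y in interval k, ‖g (param t γ k y)‖ₑ ^ 2 := by
  obtain ⟨c, hc⟩ := exists_mul_le_norm_param_sub hd hjk
  have hv : AEMeasurable fun y => ENNReal.ofReal (2 / delta t γ) * ‖onPiece t γ g k y‖ₑ :=
    (memLp_onPiece hg k).1.enorm.const_mul _
  have hne : ∀ᵐ x : ℝ, x ≠ c := by
    have : ∀ᵐ x : ℝ, x ∉ ({c} : Set ℝ) := (Set.countable_singleton c).ae_notMem volume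
    exact this
  calc ∫⁻ x in interval j, ‖pieceCauchy t γ g k (param t γ j x)‖ₑ ^ 2
      ≤ ∫⁻ x in interval j, (∫⁻ y : ℝ, ENNReal.ofReal (|x - c| + |y - c|)⁻¹ *
          (ENNReal.ofReal (2 / delta t γ) * ‖onPiece t γ g k y‖ₑ)) ^ 2 := by
        refine lintegral_mono_ae ?_
        filter_upwards [ae_restrict_mem (measurableSet_interval j), ae_restrict_of_ae hne]
          with x hx hxc
        refine pow_le_pow_left' ?_ 2
        refine (enorm_integral_le_lintegral_enorm _).trans (lintegral_mono fun y => ?_)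
        by_cases hy : y ∈ interval k
        · have hpos : 0 < |x - c| + |y - c| := by
            have := abs_pos.2 (sub_ne_zero.2 hxc)
            positivity
          have h1 : ‖(param t γ k y - param t γ j x)⁻¹‖ ≤
              (delta t γ * (|x - c| + |y - c|))⁻¹ := by
            rw [norm_inv]
            exact inv_anti₀ (by positivity) (hc x hx y hy)
          have h2 : ‖(param t γ k y - param t γ j x)⁻¹‖ * ‖tangent t γ k‖ ≤
              (|x - c| + |y - c|)⁻¹ * (2 / delta t γ) := by
            refine (mul_le_mul h1 (norm_tangent_le hd k) (norm_nonneg _)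
              (by positivity)).trans (le_of_eq ?_)
            field_simp
          have h3 := ENNReal.ofReal_le_ofReal h2
          rw [ENNReal.ofReal_mul (norm_nonneg _), ENNReal.ofReal_mul (by positivity),
            ofReal_norm, ofReal_norm] at h3
          rw [enorm_mul, enorm_mul, mul_assoc, mul_comm, ← mul_assoc]
          gcongr
        · rw [onPiece, Set.indicator_of_notMem hy]
          simp
    _ ≤ ∫⁻ x : ℝ, (∫⁻ y : ℝ, ENNReal.ofReal (|x - c| + |y - c|)⁻¹ *
          (ENNReal.ofReal (2 / delta t γ) * ‖onPiece t γ g k y‖ₑ)) ^ 2 :=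
        setLIntegral_le_lintegral _ _
    _ ≤ ENNReal.ofReal (2 * Real.pi) ^ 2 *
          ∫⁻ y, (ENNReal.ofReal (2 / delta t γ) * ‖onPiece t γ g k y‖ₑ) ^ 2 :=
        lintegral_sq_hilbert_le c hv
    _ = _ := by
        simp only [mul_pow]
        rw [lintegral_const_mul' _ _ (ENNReal.pow_ne_top ENNReal.ofReal_ne_top),
          lintegral_onPiece, ← mul_assoc, ← mul_pow, ← ENNReal.ofReal_mul (by positivity)]
        congr 3
        ring

end

section

variable {t γ : ℝ}

lemma ae_exists_le_norm_param_sub (hd : 0 < delta t γ) (j : Fin 8) :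
    ∀ᵐ x ∂(volume.restrict (interval j)), ∀ k, k ≠ j →
      ∃ r > 0, ∀ y ∈ interval k, r ≤ ‖param t γ k y - param t γ j x‖ := by
  rw [ae_all_iff]
  intro k
  by_cases hk : k = j
  · exact Eventually.of_forall fun x h0 => absurd hk h0
  obtain ⟨c, hc⟩ := exists_mul_le_norm_param_sub hd (Ne.symm hk)
  have hne : ∀ᵐ x : ℝ, x ∉ ({c} : Set ℝ) := (Set.countable_singleton c).ae_notMem volume
  filter_upwards [ae_restrict_mem (measurableSet_interval j), ae_restrict_of_ae hne] with x hx hxc _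
  have hpos : 0 < |x - c| := abs_pos.2 (sub_ne_zero.2 hxc)
  refine ⟨delta t γ * |x - c|, mul_pos hd hpos, fun y hy => le_trans ?_ (hc x hx y hy)⟩
  exact mul_le_mul_of_nonneg_left (le_add_of_nonneg_right (abs_nonneg _)) hd.le

lemma aestronglyMeasurable_pieceCauchy {g : ℂ → ℂ} (hg : MemLp g 2 (arcLength t γ)) (j k : Fin 8) :
    AEStronglyMeasurable fun x : ℝ => pieceCauchy t γ g k (param t γ j x) := by
  have hk := (continuous_param (t := t) (γ := γ) k).measurable
  have hj := (continuous_param (t := t) (γ := γ) j).measurable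
  have h1 : Measurable fun p : ℝ × ℝ => (param t γ k p.2 - param t γ j p.1)⁻¹ :=
    ((hk.comp measurable_snd).sub (hj.comp measurable_fst)).inv
  have h2 : AEStronglyMeasurable (fun p : ℝ × ℝ => onPiece t γ g k p.2 *
      (param t γ k p.2 - param t γ j p.1)⁻¹ * tangent t γ k) (volume.prod volume) :=
    ((memLp_onPiece hg k).1.comp_snd.mul h1.aestronglyMeasurable).mul_const _
  exact h2.integral_prod_right'

lemma enorm_sum_sq_le {ι : Type*} (s : Finset ι) (a : ι → ℂ) :
    ‖∑ k ∈ s, a k‖ₑ ^ 2 ≤ s.card * ∑ k ∈ s, ‖a k‖ₑ ^ 2 := by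
  have h1 : ‖∑ k ∈ s, a k‖ ^ 2 ≤ s.card * ∑ k ∈ s, ‖a k‖ ^ 2 :=
    (pow_le_pow_left₀ (norm_nonneg _) (norm_sum_le s a) 2).trans sq_sum_le_card_mul_sum_sq
  have h2 := ENNReal.ofReal_le_ofReal h1
  rw [ENNReal.ofReal_mul (by positivity), ENNReal.ofReal_natCast,
    ENNReal.ofReal_sum_of_nonneg fun k _ => sq_nonneg _, ENNReal.ofReal_pow (norm_nonneg _),
    ofReal_norm] at h2
  simpa only [ENNReal.ofReal_pow (norm_nonneg _), ofReal_norm] using h2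

/-- If the boundary values of the Cauchy integral of an `L²` density on a piece of the contour exist
almost everywhere, their difference is the density, and they are bounded in `L²` by the density on
the full contour. -/
lemma boundary_values_of_tendsto (hd : 0 < delta t γ) {g : ℂ → ℂ}
    (hg : MemLp g 2 (arcLength t γ)) (j : Fin 8) {np nm : ℂ → ℂ}
    (hp : ∀ᵐ x ∂(volume.restrict (interval j)), Tendsto (fun η : ℝ => (2 * (Real.pi : ℂ) * I)⁻¹ *
      lineIntegral t γ (fun w => g w / (w - (param t γ j x + I * η)))) (𝓝[>] 0)
      (𝓝 (np (param t γ j x))))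
    (hm : ∀ᵐ x ∂(volume.restrict (interval j)), Tendsto (fun η : ℝ => (2 * (Real.pi : ℂ) * I)⁻¹ *
      lineIntegral t γ (fun w => g w / (w - (param t γ j x - I * η)))) (𝓝[>] 0)
      (𝓝 (nm (param t γ j x)))) :
    (∀ᵐ x ∂(volume.restrict (interval j)),
      np (param t γ j x) - nm (param t γ j x) = g (param t γ j x)) ∧
    ∫⁻ x in interval j, ‖nm (param t γ j x)‖ₑ ^ 2 ≤
      ENNReal.ofReal (32 / delta t γ ^ 2) * energy t γ g := by
  set c : ℂ := 2 * (Real.pi : ℂ) * I with hc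
  have hc0 : c ≠ 0 := Complex.two_pi_I_ne_zero
  set w : ℂ := I / tangent t γ j with hw
  have hw0 : 0 < w.im := I_div_tangent_im_pos j
  set u : ℕ → ℝ := fun n => 1 / ((n : ℝ) + 1) with hu
  have hupos : ∀ n, 0 < u n := fun n => Nat.one_div_pos_of_nat
  have hu0 : Tendsto u atTop (𝓝 0) := tendsto_one_div_add_atTop_nhds_zero_nat
  have hu0' : Tendsto u atTop (𝓝[>] 0) :=
    tendsto_nhdsWithin_iff.2 ⟨hu0, Eventually.of_forall hupos⟩
  set G := onPiece t γ g j with hG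
  have hG2 : MemLp G 2 := memLp_onPiece hg j
  set R : ℝ → ℂ := fun x => ∑ k ∈ Finset.univ.erase j, pieceCauchy t γ g k (param t γ j x) with hR
  have hsplit : ∀ (x η : ℝ), lineIntegral t γ (fun w => g w / (w - (param t γ j x + I * η))) =
      cauchyReal G (x + η * w) +
        ∑ k ∈ Finset.univ.erase j, pieceCauchy t γ g k (param t γ j x + I * η) := by
    intro x η
    rw [lineIntegral_eq_sum_pieceCauchy, ← Finset.add_sum_erase _ _ (Finset.mem_univ j),
      pieceCauchy_self]
  have hcross : ∀ᵐ x ∂(volume.restrict (interval j)), ∀ v : ℕ → ℝ, Tendsto v atTop (𝓝 0) →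
      Tendsto (fun n => ∑ k ∈ Finset.univ.erase j, pieceCauchy t γ g k (param t γ j x + I * v n))
        atTop (𝓝 (R x)) := by
    filter_upwards [ae_exists_le_norm_param_sub hd j] with x hx v hv
    refine tendsto_finsetSum _ fun k hk => ?_
    obtain ⟨r, hr, h⟩ := hx k (Finset.ne_of_mem_erase hk)
    exact tendsto_pieceCauchy hg hr h hv
  have hown_p : ∀ᵐ (x : ℝ) ∂(volume.restrict (interval j)),
      Tendsto (fun n => cauchyReal G (x + u n * w)) atTop (𝓝 (c * np (param t γ j x) - R x)) := by
    filter_upwards [hp, hcross] with x hx hcr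
    refine (((hx.comp hu0').const_mul c).sub (hcr u hu0)).congr fun n => ?_
    simp only [Function.comp_apply]
    rw [hsplit, mul_inv_cancel_left₀ hc0]
    ring
  have hown_m : ∀ᵐ (x : ℝ) ∂(volume.restrict (interval j)),
      Tendsto (fun n => cauchyReal G (x - u n * w)) atTop (𝓝 (c * nm (param t γ j x) - R x)) := by
    filter_upwards [hm, hcross] with x hx hcr
    have hv : Tendsto (fun n => -u n) atTop (𝓝 0) := by simpa using hu0.neg
    refine (((hx.comp hu0').const_mul c).sub (hcr _ hv)).congr fun n => ?_
    simp only [Function.comp_apply]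
    have e : param t γ j x - I * (u n : ℂ) = param t γ j x + I * ((-u n : ℝ) : ℂ) := by
      push_cast
      ring
    rw [e, hsplit, mul_inv_cancel_left₀ hc0, Complex.ofReal_neg, neg_mul, ← sub_eq_add_neg]
    ring
  constructor
  · have h1 := ae_eq_of_tendsto_cauchyReal_sub hG2 hw0 hupos hu0 (S := interval j)
      (J := fun x => c * (np (param t γ j x) - nm (param t γ j x))) (by
        filter_upwards [hown_p, hown_m] with x h1 h2
        have h3 := h1.sub h2
        have e : c * np (param t γ j x) - R x - (c * nm (param t γ j x) - R x) =
            c * (np (param t γ j x) - nm (param t γ j x)) := by ring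
        rwa [e] at h3)
    filter_upwards [h1, ae_restrict_mem (measurableSet_interval j)] with x hx hxj
    rw [hG, onPiece, Set.indicator_of_mem hxj] at hx
    exact mul_left_cancel₀ hc0 hx
  · set L : ℝ → ℂ := fun x => c * nm (param t γ j x) - R x with hL
    have hmeas : ∀ n, AEStronglyMeasurable (fun x : ℝ => cauchyReal G (x - u n * w)) := by
      intro n
      have := aestronglyMeasurable_cauchyReal hG2.1 (-(u n * w))
      simpa only [← sub_eq_add_neg] using this
    have hLm : AEStronglyMeasurable L (volume.restrict (interval j)) :=
      aestronglyMeasurable_of_tendsto_ae atTop (fun n => (hmeas n).restrict) hown_m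
    have hLb : ∫⁻ x in interval j, ‖L x‖ₑ ^ 2 ≤
        ENNReal.ofReal (4 * Real.pi ^ 2) * ∫⁻ y in interval j, ‖g (param t γ j y)‖ₑ ^ 2 := by
      calc ∫⁻ x in interval j, ‖L x‖ₑ ^ 2
          = ∫⁻ x in interval j, liminf (fun n => ‖cauchyReal G (x - u n * w)‖ₑ ^ 2) atTop := by
            refine lintegral_congr_ae ?_
            filter_upwards [hown_m] with x hx
            exact (((ENNReal.continuous_pow 2).tendsto _).comp hx.enorm).liminf_eq.symm
        _ ≤ liminf (fun n => ∫⁻ x in interval j, ‖cauchyReal G (x - u n * w)‖ₑ ^ 2) atTop :=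
            lintegral_liminf_le' fun n => ((hmeas n).restrict).enorm.pow_const 2
        _ ≤ ENNReal.ofReal (4 * Real.pi ^ 2) * ∫⁻ y in interval j, ‖g (param t γ j y)‖ₑ ^ 2 := by
            refine liminf_le_of_frequently_le' (Frequently.of_forall fun n => ?_)
            refine (setLIntegral_le_lintegral _ _).trans ?_
            rw [← lintegral_onPiece]
            refine lintegral_sq_cauchyReal_le hG2 ?_
            rw [Complex.im_ofReal_mul]
            exact mul_pos (hupos n) hw0
    set a : Fin 8 → ℝ → ℂ := fun k x =>
      if k = j then L x else pieceCauchy t γ g k (param t γ j x) with ha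
    have hsum : ∀ x, nm (param t γ j x) = c⁻¹ * ∑ k, a k x := by
      intro x
      have h1 : ∑ k ∈ Finset.univ.erase j, a k x = R x :=
        Finset.sum_congr rfl fun k hk => if_neg (Finset.ne_of_mem_erase hk)
      have h2 : a j x = L x := if_pos rfl
      rw [← Finset.add_sum_erase _ _ (Finset.mem_univ j), h1, h2, hL]
      simp only
      field_simp
      ring
    have ham : ∀ k, AEStronglyMeasurable (a k) (volume.restrict (interval j)) := by
      intro k
      by_cases hk : k = j
      · simpa only [ha, hk, if_true] using hLm
      · simpa only [ha, hk, if_false] using (aestronglyMeasurable_pieceCauchy hg j k).restrict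
    have hab : ∀ k, ∫⁻ x in interval j, ‖a k x‖ₑ ^ 2 ≤
        ENNReal.ofReal (4 * Real.pi / delta t γ) ^ 2 * ∫⁻ y in interval k, ‖g (param t γ k y)‖ₑ ^ 2 := by
      intro k
      by_cases hk : k = j
      · subst hk
        simp only [ha, if_true]
        refine hLb.trans ?_
        rw [← ENNReal.ofReal_pow (by positivity)]
        gcongr
        rw [div_pow, le_div_iff₀ (by positivity)]
        have h1 : delta t γ ^ 2 ≤ 1 := by
          have := delta_le_half (t := t) (γ := γ)
          nlinarith
        nlinarith [Real.pi_pos, sq_nonneg Real.pi]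
      · simp only [ha, hk, if_false]
        exact lintegral_sq_pieceCauchy_le hd hg (Ne.symm hk)
    calc ∫⁻ x in interval j, ‖nm (param t γ j x)‖ₑ ^ 2
        ≤ ∫⁻ x in interval j, ‖c⁻¹‖ₑ ^ 2 * (8 * ∑ k, ‖a k x‖ₑ ^ 2) := by
          refine lintegral_mono fun x => ?_
          rw [hsum, enorm_mul, mul_pow]
          gcongr
          have := enorm_sum_sq_le Finset.univ fun k => a k x
          simpa using this
      _ = ‖c⁻¹‖ₑ ^ 2 * (8 * ∑ k, ∫⁻ x in interval j, ‖a k x‖ₑ ^ 2) := by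
          rw [lintegral_const_mul' _ _ (ENNReal.pow_ne_top enorm_ne_top),
            lintegral_const_mul' _ _ (by norm_num),
            lintegral_finsetSum' _ fun k _ => (ham k).enorm.pow_const 2]
      _ ≤ ‖c⁻¹‖ₑ ^ 2 * (8 * ∑ k, ENNReal.ofReal (4 * Real.pi / delta t γ) ^ 2 *
            ∫⁻ y in interval k, ‖g (param t γ k y)‖ₑ ^ 2) := by
          gcongr with k
          exact hab k
      _ = ENNReal.ofReal (32 / delta t γ ^ 2) * energy t γ g := by
          rw [← Finset.mul_sum, ← mul_assoc, ← mul_assoc, energy]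
          congr 1
          have hcn : ‖c⁻¹‖ = (2 * Real.pi)⁻¹ := by
            rw [norm_inv, hc, norm_mul, norm_mul, Complex.norm_I, Complex.norm_real,
              Real.norm_of_nonneg Real.pi_pos.le, Complex.norm_ofNat, mul_one]
          rw [← ofReal_norm, hcn, ← ENNReal.ofReal_pow (by positivity),
            ← ENNReal.ofReal_pow (by positivity), show (8 : ENNReal) = ENNReal.ofReal 8 by simp,
            ← ENNReal.ofReal_mul (by positivity), ← ENNReal.ofReal_mul (by positivity)]
          congr 1
          have := Real.pi_ne_zero
          field_simp
          norm_num

/-! ### Uniqueness -/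

lemma exists_le_norm_sub_of_notMem_contour {z : ℂ} (hz : z ∉ contour t γ) :
    ∃ r > 0, ∀ k, ∀ y ∈ interval k, r ≤ ‖param t γ k y - z‖ := by
  have hcl : IsClosed (contour t γ) := by
    have e : contour t γ = {z : ℂ | z.im = upperHeight (delta t γ) z.re} ∪
        {z : ℂ | z.im = -upperHeight (delta t γ) z.re} := by
      ext z
      exact mem_contour_iff
    have hc : Continuous fun w : ℂ => upperHeight (delta t γ) w.re :=
      continuous_upperHeight.comp Complex.continuous_re
    rw [e]
    exact (isClosed_eq Complex.continuous_im hc).union (isClosed_eq Complex.continuous_im hc.neg)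
  obtain ⟨r, hr, hball⟩ := Metric.isOpen_iff.1 hcl.isOpen_compl z hz
  refine ⟨r, hr, fun k y hy => not_lt.1 fun hlt => hball ?_ (Set.mem_iUnion.2 ⟨k, y, hy, rfl⟩)⟩
  rwa [Metric.mem_ball, dist_eq_norm]

lemma lineIntegral_sub_div {f g : ℂ → ℂ} (hf : MemLp f 2 (arcLength t γ))
    (hg : MemLp g 2 (arcLength t γ)) {z : ℂ} (hz : z ∉ contour t γ) :
    lineIntegral t γ (fun w => (f w - g w) / (w - z)) =
      lineIntegral t γ (fun w => f w / (w - z)) - lineIntegral t γ (fun w => g w / (w - z)) := by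
  obtain ⟨r, hr, h⟩ := exists_le_norm_sub_of_notMem_contour hz
  rw [lineIntegral_eq_sum_pieceCauchy, lineIntegral_eq_sum_pieceCauchy,
    lineIntegral_eq_sum_pieceCauchy, ← Finset.sum_sub_distrib]
  refine Finset.sum_congr rfl fun k _ => ?_
  rw [pieceCauchy, pieceCauchy, pieceCauchy, ← integral_sub (integrable_kernel hf hr (h k))
    (integrable_kernel hg hr (h k))]
  refine integral_congr_ae (Eventually.of_forall fun y => ?_)
  by_cases hy : y ∈ interval k
  · simp only [onPiece, Set.indicator_of_mem hy]
    ring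
  · simp only [onPiece, Set.indicator_of_notMem hy]
    ring

/-- Short vertical segments issuing from a point of the contour leave the contour. -/
lemma eventually_notMem_contour (hd : 0 < delta t γ) {z : ℂ} (hz : z ∈ contour t γ) :
    ∀ᶠ η : ℝ in 𝓝[>] 0, z + I * η ∉ contour t γ ∧ z - I * η ∉ contour t γ := by
  have h0 := upperHeight_nonneg hd.le z.re
  have key : ∀ᶠ η : ℝ in 𝓝[>] 0, 0 < η ∧ (upperHeight (delta t γ) z.re = 0 ∨
      η < 2 * upperHeight (delta t γ) z.re) := by
    rcases h0.eq_or_lt with h1 | h1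
    · filter_upwards [self_mem_nhdsWithin] with η hη using ⟨hη, Or.inl h1.symm⟩
    · filter_upwards [Ioo_mem_nhdsGT (show 0 < 2 * upperHeight (delta t γ) z.re by linarith)]
        with η hη using ⟨hη.1, Or.inr hη.2⟩
  filter_upwards [key] with η hη
  have e1 : (z + I * η).re = z.re ∧ (z + I * η).im = z.im + η := by simp
  have e2 : (z - I * η).re = z.re ∧ (z - I * η).im = z.im - η := by simp
  rw [mem_contour_iff, mem_contour_iff, e1.1, e1.2, e2.1, e2.2]
  obtain ⟨hη0, hη1⟩ := hη
  have hz' := mem_contour_iff.1 hz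
  constructor <;> rintro (h2 | h2) <;> rcases hz' with h3 | h3 <;> rcases hη1 with h4 | h4 <;>
    linarith

lemma energy_ne_top {g : ℂ → ℂ} (hg : MemLp g 2 (arcLength t γ)) : energy t γ g ≠ ⊤ := by
  refine ENNReal.sum_ne_top.2 fun k _ => ?_
  rw [← lintegral_onPiece, lintegral_enorm_sq_eq (memLp_onPiece hg k)]
  exact ENNReal.ofReal_ne_top

lemma lineIntegral_eq_zero_of_energy {g : ℂ → ℂ} (hg : MemLp g 2 (arcLength t γ))
    (h0 : energy t γ g = 0) (z : ℂ) : lineIntegral t γ (fun w => g w / (w - z)) = 0 := by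
  rw [lineIntegral_eq_sum_pieceCauchy]
  refine Finset.sum_eq_zero fun k _ => integral_eq_zero_of_ae ?_
  have h1 : ∫⁻ y, ‖onPiece t γ g k y‖ₑ ^ 2 = 0 := by
    rw [lintegral_onPiece]
    exact (Finset.sum_eq_zero_iff.1 h0) k (Finset.mem_univ k)
  rw [lintegral_eq_zero_iff' ((memLp_onPiece hg k).1.enorm.pow_const 2)] at h1
  filter_upwards [h1] with y hy
  simp only [Pi.zero_apply, pow_eq_zero_iff two_ne_zero, enorm_eq_zero] at hy
  rw [hy, zero_mul, zero_mul]
  rfl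

lemma energy_le_of_jump {g a b p r : ℂ → ℂ} {q : ℝ} (hq : 0 ≤ q)
    (ha : MemLp a 2 (arcLength t γ))
    (hpr : ∀ z ∈ contour t γ, ‖p z‖ ≤ q ∧ ‖r z‖ ≤ q)
    (hg : ∀ᵐ z ∂(arcLength t γ), g z = a z * p z + b z * r z) :
    energy t γ g ≤ ENNReal.ofReal (2 * q ^ 2) * (energy t γ a + energy t γ b) := by
  rw [energy, energy, energy, ← Finset.sum_add_distrib, Finset.mul_sum]
  refine Finset.sum_le_sum fun k _ => ?_
  have hak := (memLp_arcLength_iff.1 ha k).1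
  rw [← lintegral_add_left' (hak.enorm.pow_const 2),
    ← lintegral_const_mul' _ _ ENNReal.ofReal_ne_top]
  refine lintegral_mono_ae ?_
  filter_upwards [ae_arcLength_iff.1 hg k, ae_restrict_mem (measurableSet_interval k)] with x hx hxk
  obtain ⟨h1, h2⟩ := hpr _ (Set.mem_iUnion.2 ⟨k, x, hxk, rfl⟩)
  have h3 := ENNReal.ofReal_le_ofReal h1
  have h4 := ENNReal.ofReal_le_ofReal h2
  rw [ofReal_norm] at h3 h4
  rw [hx]
  refine (enorm_add_sq_le _ _).trans ?_
  rw [enorm_mul, enorm_mul, mul_pow, mul_pow]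
  calc 2 * (‖a (param t γ k x)‖ₑ ^ 2 * ‖p (param t γ k x)‖ₑ ^ 2 +
        ‖b (param t γ k x)‖ₑ ^ 2 * ‖r (param t γ k x)‖ₑ ^ 2)
      ≤ 2 * (‖a (param t γ k x)‖ₑ ^ 2 * ENNReal.ofReal q ^ 2 +
        ‖b (param t γ k x)‖ₑ ^ 2 * ENNReal.ofReal q ^ 2) := by gcongr
    _ = ENNReal.ofReal (2 * q ^ 2) *
        (‖a (param t γ k x)‖ₑ ^ 2 + ‖b (param t γ k x)‖ₑ ^ 2) := by
      rw [ENNReal.ofReal_mul (by norm_num), ENNReal.ofReal_pow hq, ENNReal.ofReal_ofNat]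
      ring

/-- Uniqueness for the Riemann-Hilbert problem when the jump matrix is close to the identity: the
difference of the densities of two solutions is bounded by a small multiple of itself. -/
theorem eqOn_of_isSolution (hd : 0 < delta t γ) {q : ℝ} (hq : 0 ≤ q)
    (hjump : ∀ z ∈ contour t γ, ∀ i k, ‖(jump t γ z - 1) i k‖ ≤ q) (hsmall : 32 * q < delta t γ)
    {M M' : ℂ → Mat} (hM : IsSolution t γ M) (hM' : IsSolution t γ M') :
    Set.EqOn M' M (contour t γ)ᶜ := by
  obtain ⟨f, hf, hfM⟩ := hM.cauchy_rep
  obtain ⟨f', hf', hfM'⟩ := hM'.cauchy_rep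
  obtain ⟨Mp, Mm, hMp, hMm, hlim⟩ := hM.jump_rel
  obtain ⟨Mp', Mm', hMp', hMm', hlim'⟩ := hM'.jump_rel
  set g : Fin 2 → Fin 2 → ℂ → ℂ := fun i k z => f' z i k - f z i k with hgdef
  have hg : ∀ i k, MemLp (g i k) 2 (arcLength t γ) := fun i k => (hf' i k).sub (hf i k)
  have hdiff : ∀ z ∉ contour t γ, ∀ i k, M' z i k - M z i k = (2 * (Real.pi : ℂ) * I)⁻¹ *
      lineIntegral t γ (fun w => g i k w / (w - z)) := by
    intro z hz i k
    rw [hfM z hz, hfM' z hz, hgdef, lineIntegral_sub_div (hf' i k) (hf i k) hz]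
    simp only [Matrix.add_apply, cauchy, Matrix.of_apply]
    ring
  set Np : Fin 2 → Fin 2 → ℂ → ℂ := fun i k z => Mp' z i k - Mp z i k with hNp
  set Nm : Fin 2 → Fin 2 → ℂ → ℂ := fun i k z => Mm' z i k - Mm z i k with hNm
  have hNm2 : ∀ i k, MemLp (Nm i k) 2 (arcLength t γ) := by
    intro i k
    refine ((hMm' i k).sub (hMm i k)).ae_eq (Eventually.of_forall fun z => ?_)
    simp [hNm]
  have hentry : ∀ {F : ℝ → Mat} {A : Mat}, Tendsto F (𝓝[>] 0) (𝓝 A) → ∀ i k,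
      Tendsto (fun η => F η i k) (𝓝[>] 0) (𝓝 (A i k)) := fun h i k =>
    tendsto_pi_nhds.1 (tendsto_pi_nhds.1 h i) k
  have hbv : ∀ i k j,
      (∀ᵐ x ∂(volume.restrict (interval j)),
        Np i k (param t γ j x) - Nm i k (param t γ j x) = g i k (param t γ j x)) ∧
      ∫⁻ x in interval j, ‖Nm i k (param t γ j x)‖ₑ ^ 2 ≤
        ENNReal.ofReal (32 / delta t γ ^ 2) * energy t γ (g i k) := by
    intro i k j
    refine boundary_values_of_tendsto hd (hg i k) j ?_ ?_
    · filter_upwards [ae_arcLength_iff.1 hlim j, ae_arcLength_iff.1 hlim' j,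
        ae_restrict_mem (measurableSet_interval j)] with x h1 h2 hx
      refine ((hentry h2.1 i k).sub (hentry h1.1 i k)).congr' ?_
      filter_upwards [eventually_notMem_contour hd (Set.mem_iUnion.2 ⟨j, x, hx, rfl⟩)] with η hη
      exact hdiff _ hη.1 i k
    · filter_upwards [ae_arcLength_iff.1 hlim j, ae_arcLength_iff.1 hlim' j,
        ae_restrict_mem (measurableSet_interval j)] with x h1 h2 hx
      refine ((hentry h2.2.1 i k).sub (hentry h1.2.1 i k)).congr' ?_
      filter_upwards [eventually_notMem_contour hd (Set.mem_iUnion.2 ⟨j, x, hx, rfl⟩)] with η hη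
      exact hdiff _ hη.2 i k
  have hNmE : ∀ i k, energy t γ (Nm i k) ≤
      ENNReal.ofReal (256 / delta t γ ^ 2) * energy t γ (g i k) := by
    intro i k
    refine (Finset.sum_le_sum fun j _ => (hbv i k j).2).trans (le_of_eq ?_)
    rw [Finset.sum_const, Finset.card_univ, Fintype.card_fin, nsmul_eq_mul, ← mul_assoc,
      ← ENNReal.ofReal_natCast, ← ENNReal.ofReal_mul (by norm_num)]
    congr 2
    push_cast
    ring
  have hgN : ∀ i k, ∀ᵐ z ∂(arcLength t γ), g i k z =
      Nm i 0 z * (jump t γ z - 1) 0 k + Nm i 1 z * (jump t γ z - 1) 1 k := by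
    intro i k
    have h1 : ∀ᵐ z ∂(arcLength t γ), Np i k z - Nm i k z = g i k z :=
      ae_arcLength_iff.2 fun j => (hbv i k j).1
    have e : ∀ F : Mat, F i k = F i 0 * (1 : Mat) 0 k + F i 1 * (1 : Mat) 1 k := fun F => by
      rw [← Fin.sum_univ_two (f := fun l => F i l * (1 : Mat) l k), ← Matrix.mul_apply, mul_one]
    filter_upwards [h1, hlim, hlim'] with z h2 h3 h4
    rw [← h2, hNp, hNm]
    simp only
    rw [h3.2.2, h4.2.2, Matrix.mul_apply, Matrix.mul_apply, Fin.sum_univ_two, Fin.sum_univ_two]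
    simp only [Matrix.sub_apply]
    linear_combination e (Mm z) - e (Mm' z)
  have hE : ∀ i k, energy t γ (g i k) ≤ ENNReal.ofReal (512 * q ^ 2 / delta t γ ^ 2) *
      (energy t γ (g i 0) + energy t γ (g i 1)) := by
    intro i k
    refine (energy_le_of_jump hq (hNm2 i 0)
      (fun z hz => ⟨hjump z hz 0 k, hjump z hz 1 k⟩) (hgN i k)).trans ?_
    have e : 512 * q ^ 2 / delta t γ ^ 2 = 2 * q ^ 2 * (256 / delta t γ ^ 2) := by ring
    rw [e, ENNReal.ofReal_mul (p := 2 * q ^ 2) (by positivity), mul_assoc,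
      mul_add (ENNReal.ofReal (256 / _))]
    gcongr
    · exact hNmE i 0
    · exact hNmE i 1
  have hzero : ∀ i k, energy t γ (g i k) = 0 := by
    intro i
    have hsum : energy t γ (g i 0) + energy t γ (g i 1) = 0 := by
      by_contra hne
      have htop : energy t γ (g i 0) + energy t γ (g i 1) ≠ ⊤ :=
        ENNReal.add_ne_top.2 ⟨energy_ne_top (hg i 0), energy_ne_top (hg i 1)⟩
      have h1 := add_le_add (hE i 0) (hE i 1)
      rw [← add_mul, ← ENNReal.ofReal_add (by positivity) (by positivity)] at h1
      have h2 : ENNReal.ofReal (512 * q ^ 2 / delta t γ ^ 2 + 512 * q ^ 2 / delta t γ ^ 2) < 1 := by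
        rw [ENNReal.ofReal_lt_one, ← add_div, div_lt_one (by positivity)]
        nlinarith
      have h3 := ENNReal.mul_lt_mul_left hne htop h2
      rw [one_mul] at h3
      exact absurd h1 (not_le.2 h3)
    have h5 := add_eq_zero.1 hsum
    rw [Fin.forall_fin_two]
    exact h5
  intro z hz
  ext i k
  have h1 := hdiff z hz i k
  rw [lineIntegral_eq_zero_of_energy (hg i k) (hzero i k), mul_zero] at h1
  exact sub_eq_zero.1 h1

end

section

variable {t γ : ℝ}

/-! ### Smallness of the jump -/

/-- On the hexagon's horizontal edges the factor `e^{-t² y}` with `y = δ` makes the jump small, and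
on the rest of the contour `e^{-t² x² / 4}` with `|x| ≥ 1` does. -/
lemma norm_upperEntry_le_of_mem_contour (ht : t ≠ 0) (hγ0 : 0 < γ) (hγ1 : γ < 1) {m : ℝ}
    (h1 : m ≤ t ^ 2 / 4) (h2 : m ≤ t ^ 2 * delta t γ) {w : ℂ} (hw : w ∈ contour t γ)
    (h0 : 0 ≤ w.im) : ‖upperEntry t γ w‖ ≤ 4 / (1 - γ) * Real.exp (-m) := by
  have hd := delta_pos ht hγ0 hγ1
  have hγ' : 0 < 1 - γ := by linarith
  have him := im_eq_of_mem_contour hd hw h0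
  have hle := upperHeight_le hd.le w.re
  have hweq : w = (w.re : ℂ) + I * w.im := by
    rw [mul_comm]; exact (Complex.re_add_im w).symm
  have h3 := norm_upperEntry_le ht hγ0 hγ1 w.re h0 (by linarith)
  rw [← hweq] at h3
  refine h3.trans ?_
  gcongr
  by_cases hx : |w.re| ≤ 1
  · rw [upperHeight_of_le_one hx] at him
    rw [him]
    nlinarith [mul_nonneg (sq_nonneg t) (sq_nonneg w.re)]
  · have h4 : 1 ≤ w.re ^ 2 := by
      rw [← sq_abs]
      nlinarith [not_le.1 hx]
    nlinarith [mul_nonneg (sq_nonneg t) h0, sq_nonneg t]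

lemma norm_jump_sub_one_le (ht : t ≠ 0) (hγ0 : 0 < γ) (hγ1 : γ < 1) {m : ℝ}
    (h1 : m ≤ t ^ 2 / 4) (h2 : m ≤ t ^ 2 * delta t γ) {z : ℂ} (hz : z ∈ contour t γ)
    (i k : Fin 2) : ‖(jump t γ z - 1) i k‖ ≤ 4 / (1 - γ) * Real.exp (-m) := by
  have hγ' : 0 < 1 - γ := by linarith
  have hq : 0 ≤ 4 / (1 - γ) * Real.exp (-m) := by positivity
  have hA := fun w hw h0 => norm_upperEntry_le_of_mem_contour (w := w) ht hγ0 hγ1 h1 h2 hw h0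
  have hz' := neg_mem_contour.2 hz
  rcases lt_trichotomy z.im 0 with h0 | h0 | h0
  · rw [jump, if_neg (not_lt.2 h0.le), if_pos h0, sqrt_mul_entry_of_neg ht hγ0 hγ1 h0]
    have := hA (-z) hz' (by simpa using h0.le)
    revert i k
    simp [Fin.forall_fin_two, hq, this]
  · have hzr : z = (z.re : ℂ) := by
      apply Complex.ext <;> simp [h0]
    rw [jump, if_neg h0.not_gt, if_neg h0.not_lt, phaseReal_one ht hγ0 hγ1,
      phaseReal_neg_one ht hγ0 hγ1, ← hzr]
    have e1 := hA z hz h0.ge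
    have e2 := hA (-z) hz' (by simp [h0])
    have e3 : ‖(γ : ℂ) * Complex.exp (-((t : ℂ) ^ 2 * z ^ 2) / 2)‖ ≤
        4 / (1 - γ) * Real.exp (-m) := by
      have hd := delta_pos ht hγ0 hγ1
      have hx : 2 ≤ |z.re| := by
        by_contra hx
        have := upperHeight_pos hd (not_le.1 hx)
        rw [← im_eq_of_mem_contour hd hz h0.ge, h0] at this
        exact lt_irrefl _ this
      have hx2 : 4 ≤ z.re ^ 2 := by
        rw [← sq_abs]
        nlinarith
      have e4 : Complex.exp (-((t : ℂ) ^ 2 * z ^ 2) / 2) =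
          ((Real.exp (-(t ^ 2 * z.re ^ 2) / 2) : ℝ) : ℂ) := by
        rw [hzr]
        push_cast
        simp
      rw [e4, norm_mul, Complex.norm_real, Complex.norm_real, Real.norm_of_nonneg hγ0.le,
        Real.norm_of_nonneg (Real.exp_pos _).le]
      have e5 : Real.exp (-(t ^ 2 * z.re ^ 2) / 2) ≤ Real.exp (-m) :=
        Real.exp_le_exp.2 (by nlinarith [sq_nonneg t])
      have e6 : γ ≤ 4 / (1 - γ) := by
        rw [le_div_iff₀ hγ']
        nlinarith
      exact mul_le_mul e6 e5 (Real.exp_pos _).le (by positivity)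
    revert i k
    simp only [Fin.forall_fin_two]
    simp [hq, e1, e2]
    simpa using e3
  · rw [jump, if_pos h0, sqrt_mul_entry_of_pos ht hγ0 hγ1 h0]
    have := hA z hz h0.le
    revert i k
    simp [Fin.forall_fin_two, hq, this]

lemma inv_one_sub_le_rpow {ε : ℝ} (ht : t ≠ 0) (hγ : γ ≤ 1 - |t| ^ (-ε)) :
    1 / (1 - γ) ≤ |t| ^ ε := by
  have h0 : 0 < |t| := abs_pos.2 ht
  have h1 : 0 < |t| ^ (-ε) := Real.rpow_pos_of_pos h0 _
  have h2 : |t| ^ ε = 1 / |t| ^ (-ε) := by rw [Real.rpow_neg h0.le, one_div, inv_inv]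
  rw [h2]
  exact one_div_le_one_div_of_le h1 (by linarith)

lemma rpow_le_delta {ε : ℝ} (hε : 0 < ε) (ht : 2 ≤ |t|) (hγ0 : 0 < γ)
    (hγ : γ ≤ 1 - |t| ^ (-ε)) : |t| ^ (-1 - ε / 2) ≤ delta t γ := by
  have h0 : 0 < |t| := by linarith
  refine le_min ?_ ?_
  · have h1 : |t| ^ (-ε) ≤ -Real.log γ := by linarith [Real.log_le_sub_one_of_pos hγ0]
    have h2 := Real.sqrt_le_sqrt h1
    have h3 : Real.sqrt (|t| ^ (-ε)) = |t| ^ (-(ε / 2)) := by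
      rw [Real.sqrt_eq_rpow, ← Real.rpow_mul h0.le]
      ring_nf
    rw [le_div_iff₀ h0]
    calc |t| ^ (-1 - ε / 2) * |t| = |t| ^ (-1 - ε / 2 + 1) := by
          rw [Real.rpow_add h0, Real.rpow_one]
      _ = |t| ^ (-(ε / 2)) := by ring_nf
      _ ≤ _ := h3 ▸ h2
  · calc |t| ^ (-1 - ε / 2) ≤ |t| ^ (-1 : ℝ) :=
          Real.rpow_le_rpow_of_exponent_le (by linarith) (by linarith)
      _ = 1 / |t| := by rw [Real.rpow_neg_one, one_div]
      _ ≤ 1 / 2 := one_div_le_one_div_of_le (by norm_num) ht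

lemma rpow_le_sq_mul_delta {ε : ℝ} (hε : 0 < ε) (ht : 2 ≤ |t|) (hγ0 : 0 < γ)
    (hγ : γ ≤ 1 - |t| ^ (-ε)) : |t| ^ (1 - ε / 2) ≤ t ^ 2 * delta t γ := by
  have h0 : 0 < |t| := by linarith
  calc |t| ^ (1 - ε / 2) = |t| ^ (2 : ℝ) * |t| ^ (-1 - ε / 2) := by
        rw [← Real.rpow_add h0]
        ring_nf
    _ = t ^ 2 * |t| ^ (-1 - ε / 2) := by rw [Real.rpow_two, sq_abs]
    _ ≤ t ^ 2 * delta t γ := by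
        gcongr
        exact rpow_le_delta hε ht hγ0 hγ

lemma rpow_le_sq_div_four {ε : ℝ} (hε : 0 < ε) (ht : 4 ≤ |t|) :
    |t| ^ (1 - ε / 2) ≤ t ^ 2 / 4 := by
  calc |t| ^ (1 - ε / 2) ≤ |t| ^ (1 : ℝ) :=
        Real.rpow_le_rpow_of_exponent_le (by linarith) (by linarith)
    _ = |t| := Real.rpow_one _
    _ ≤ t ^ 2 / 4 := by
        rw [← sq_abs]
        nlinarith

lemma eventually_rpow_mul_exp_lt {a s : ℝ} (ha : 0 < a) (c : ℝ) :
    ∀ᶠ T : ℝ in atTop, c * (T ^ s * Real.exp (-T ^ a)) < 1 := by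
  have h1 := (tendsto_rpow_mul_exp_neg_mul_atTop_nhds_zero (s / a) 1 one_pos).comp
    (tendsto_rpow_atTop ha)
  have h2 := h1.const_mul c
  rw [mul_zero] at h2
  filter_upwards [h2.eventually_lt_const one_pos, eventually_gt_atTop 0] with T hT hT0
  simp only [Function.comp_apply] at hT
  rwa [← Real.rpow_mul hT0.le, mul_div_cancel₀ _ ha.ne', neg_one_mul] at hT

end

end GinibreRHP

theorem theorem5p6 (ε : ℝ) (hε₀ : 0 < ε) (hε₂ : ε < 2) :
    ∃ t₀ : ℝ, 0 < t₀ ∧ ∃ c : ℝ, 0 < c ∧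
      ∀ t γ : ℝ, t₀ ≤ -t → 0 < γ → γ ≤ 1 - |t| ^ (-ε) →
        ∃ M : ℂ → GinibreRHP.Mat,
          GinibreRHP.IsSolution t γ M ∧
          (∀ M' : ℂ → GinibreRHP.Mat, GinibreRHP.IsSolution t γ M' →
            Set.EqOn M' M (GinibreRHP.contour t γ)ᶜ) ∧
          ∃ S₁ : GinibreRHP.Mat,
            Tendsto (fun z : ℂ => z • (M z - 1)) (GinibreRHP.atInfinity t γ) (𝓝 S₁) ∧
            ∀ i k : Fin 2,
              ‖S₁ i k‖ ≤ c * (|t| ^ (-1 + ε) * Real.exp (-|t| ^ (1 - ε / 2))) := by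
  obtain ⟨T₀, hT₀⟩ := eventually_atTop.1 (GinibreRHP.eventually_rpow_mul_exp_lt (a := 1 - ε / 2)
    (s := 1 + 3 * ε / 2) (by linarith) 128)
  refine ⟨max T₀ 4, lt_max_of_lt_right (by norm_num), 16, by norm_num, fun t γ ht hγ0 hγ => ?_⟩
  have ht4 : 4 ≤ -t := (le_max_right _ _).trans ht
  have habs : |t| = -t := abs_of_nonpos (by linarith)
  have hT4 : 4 ≤ |t| := habs ▸ ht4
  have hT0 : 0 < |t| := by linarith
  have ht0 : t ≠ 0 := abs_pos.1 hT0
  have hγ1 : γ < 1 := by linarith [Real.rpow_pos_of_pos hT0 (-ε)]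
  have hγ' : 0 < 1 - γ := by linarith
  have hd := GinibreRHP.delta_pos ht0 hγ0 hγ1
  have hsmall := hT₀ |t| (habs ▸ (le_max_left _ _).trans ht)
  set E := Real.exp (-|t| ^ (1 - ε / 2)) with hE
  have hE0 : 0 < E := Real.exp_pos _
  have hinv := GinibreRHP.inv_one_sub_le_rpow ht0 hγ
  have hδ := GinibreRHP.rpow_le_delta hε₀ (by linarith) hγ0 hγ
  have hm1 := GinibreRHP.rpow_le_sq_div_four hε₀ hT4
  have hm2 := GinibreRHP.rpow_le_sq_mul_delta hε₀ (by linarith) hγ0 hγ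
  -- The bound for the jump is small compared with `δ`, whose inverse is the size of the Cauchy
  -- operator near the vertices.
  have hq : 32 * (4 / (1 - γ) * E) < GinibreRHP.delta t γ := by
    refine lt_of_lt_of_le ?_ hδ
    have h1 : 4 / (1 - γ) * E ≤ 4 * (|t| ^ ε * E) := by
      rw [← mul_one_div, mul_assoc]
      gcongr
    have h2 : |t| ^ (1 + 3 * ε / 2) = |t| ^ ε / |t| ^ (-1 - ε / 2) := by
      rw [← Real.rpow_sub hT0]
      ring_nf
    have h3 : 0 < |t| ^ (-1 - ε / 2) := Real.rpow_pos_of_pos hT0 _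
    rw [h2, div_mul_eq_mul_div, ← mul_div_assoc, div_lt_one h3] at hsmall
    linarith
  have hint := GinibreRHP.integral_norm_upperEntry_le ht0 hγ0 hγ1
  have hexp : Real.exp (-(t ^ 2 * GinibreRHP.delta t γ)) ≤ E := Real.exp_le_exp.2 (neg_le_neg hm2)
  have hA : 16 / (1 - γ) / |t| * Real.exp (-(t ^ 2 * GinibreRHP.delta t γ)) ≤
      16 * (|t| ^ (-1 + ε) * E) := by
    rw [Real.rpow_add hT0, Real.rpow_neg_one]
    calc 16 / (1 - γ) / |t| * Real.exp (-(t ^ 2 * GinibreRHP.delta t γ))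
        ≤ 16 / (1 - γ) / |t| * E := by gcongr
      _ = 16 * (|t|⁻¹ * (1 / (1 - γ)) * E) := by ring
      _ ≤ 16 * (|t|⁻¹ * |t| ^ ε * E) := by gcongr
  have hcontr : ∫ x : ℝ,
      ‖GinibreRHP.upperEntry t γ (x + I * ((6 / 5 * GinibreRHP.delta t γ : ℝ) : ℂ))‖ ≤
      2 * (6 / 5 * GinibreRHP.delta t γ) := by
    have h1 : 16 / (1 - γ) / |t| * Real.exp (-(t ^ 2 * GinibreRHP.delta t γ)) ≤
        16 / (1 - γ) * E := by
      exact mul_le_mul (div_le_self (by positivity) (by linarith)) hexp (Real.exp_pos _).le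
        (by positivity)
    have h2 : 16 / (1 - γ) * E = 4 * (4 / (1 - γ) * E) := by ring
    have h3 : 0 ≤ 4 / (1 - γ) * E := by positivity
    linarith
  have hdatum := GinibreRHP.isStripDatum_upperEntry ht0 hγ0 hγ1
  obtain ⟨Wp, hp⟩ := GinibreRHP.exists_isScalarSolution hdatum Complex.norm_I hcontr
  obtain ⟨Wm, hm⟩ := GinibreRHP.exists_isScalarSolution hdatum
    (s := -I) (by rw [norm_neg, Complex.norm_I]) hcontr
  have hsol := GinibreRHP.isSolution_matrixSolution ht0 hγ0 hγ1 hp hm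
  refine ⟨_, hsol, fun M' hM' => ?_, _, GinibreRHP.tendsto_matrixSolution hp hm, fun i k =>
    (GinibreRHP.norm_matrixCoeff_le hp hm i k).trans (hint.trans hA)⟩
  exact GinibreRHP.eqOn_of_isSolution hd (by positivity)
    (fun z hz => GinibreRHP.norm_jump_sub_one_le ht0 hγ0 hγ1 hm1 hm2 hz) hq hsol hM'
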